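/- Let $n \ge 1$, let $0 \le \alpha < \infty$, and let $x_1, \dots, x_n \in \mathbb{R}^2$ be distinct points (the existing particles). Let $$E(x) = \sum_{i=1}^n \frac{1}{\|x-x_i\|^{\alpha}} \quad (\alpha > 0), \qquad E(x) = \sum_{i=1}^n \log \frac{1}{\|x-x_i\|} \quad (\alpha = 0),$$ and assume property $(P)$: $E$ has only finitely many critical points in $\mathbb{R}^2 \setminus \{x_1, \dots, x_n\}$. We say that a point $p$ leads to $x_i$ if the gradient ascent $\gamma' = \nabla E(\gamma)$, $\gamma(0) = p$, reaches distance $1$ from $x_i$ at some finite time $T \ge 0$ and is at distance larger than $1$ from all of $x_1, \dots, x_n$ at all times $0 \le t < T$. Let $p_i(r)$ be the probability that a uniformly distributed random point of the circle $\{\|x\| = r\}$ leads to $x_i$ (for all sufficiently large $r$ the corresponding sets of starting angles are measurable). Then for each $i$ the limit $\lim_{r \to \infty} p_i(r)$ exists, and $$\sum_{i=1}^n \lim_{r\to\infty} p_i(r) = 1.$$ Suppose moreover that the particles form a cluster contained in the disk of radius $n$ around the origin: $\|x_i - x_j\| \ge 1$ for $i \ne j$, the graph on $\{x_1, \dots,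 x_n\}$ joining two particles when they are at distance exactly $1$ is connected, and $\|x_i\| \le n$ for all $i$. Then for every $i$ and every $r \ge 10 n$ the set $$A_r = \{x : \|x\| = r, \ x \text{ leads to } x_i\}$$ coincides, up to a finite number of points, with a union of at most $6$ open intervals (arcs) of the circle $\{\|x\| = r\}$. -/

import Mathlib

noncomputable section

namespace GFA

/-- The Euclidean plane. -/
abbrev Plane : Type := EuclideanSpace ℝ (Fin 2)

/-- The energy generated by the particles `x 0, …, x (n - 1)`; the parameter `α = 0` stands for
the logarithmic energy. -/
def energy {n : ℕ} (α : ℝ) (x : Fin n → Plane) (y : Plane) : ℝ :=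
  if α = 0 then ∑ i, Real.log (1 / ‖y - x i‖) else ∑ i, 1 / ‖y - x i‖ ^ α

/-- The critical points of the energy (which is defined, and smooth, away from the particles). -/
def criticalPoints {n : ℕ} (α : ℝ) (x : Fin n → Plane) : Set Plane :=
  {y | (∀ i, y ≠ x i) ∧ gradient (energy α x) y = 0}

/-- Property (P): the energy has finitely many critical points. -/
def PropertyP {n : ℕ} (α : ℝ) (x : Fin n → Plane) : Prop :=
  (criticalPoints α x).Finite

/-- Gradient ascent started at `p` attaches to particle `i`: it reaches distance `1` from `x i` at
some finite time `T`, and before `T` it is at distance more than `1` from every particle. -/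
def AttachesTo {n : ℕ} (α : ℝ) (x : Fin n → Plane) (i : Fin n) (p : Plane) : Prop :=
  ∃ (T : ℝ) (γ : ℝ → Plane), 0 ≤ T ∧ γ 0 = p ∧
    (∀ t ∈ Set.Icc 0 T,
      HasDerivWithinAt γ (gradient (energy α x) (γ t)) (Set.Icc 0 T) t) ∧
    (∀ t ∈ Set.Ico 0 T, ∀ j, 1 < dist (γ t) (x j)) ∧
    dist (γ T) (x i) = 1

/-- The point with polar coordinates `(r, θ)`. -/
def circlePoint (r θ : ℝ) : Plane := !₂[r * Real.cos θ, r * Real.sin θ]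

/-- The starting angles in `[0, 2π)` on the circle of radius `r` that lead to particle `i`. -/
def attachingAngles {n : ℕ} (α : ℝ) (x : Fin n → Plane) (i : Fin n) (r : ℝ) : Set ℝ :=
  {θ | θ ∈ Set.Ico 0 (2 * Real.pi) ∧ AttachesTo α x i (circlePoint r θ)}

/-- `p_i(r)`: the probability that gradient ascent started at a uniformly distributed point of
the circle of radius `r` around the origin attaches to particle `i`. -/
def attachProb {n : ℕ} (α : ℝ) (x : Fin n → Plane) (i : Fin n) (r : ℝ) : ℝ :=
  MeasureTheory.volume.real (attachingAngles α x i r) / (2 * Real.pi)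

/-- The points of the circle of radius `r` around the origin from which gradient ascent attaches
to particle `i`. -/
def attachingSet {n : ℕ} (α : ℝ) (x : Fin n → Plane) (i : Fin n) (r : ℝ) : Set Plane :=
  {p | ‖p‖ = r ∧ AttachesTo α x i p}

/-- The open interval (arc) of the circle of radius `r` between the angles `a` and `b`. -/
def openArc (r a b : ℝ) : Set Plane := circlePoint r '' Set.Ioo a b

/-- Two particles (disks of radius `1/2`) touch if their centres are at distance `1`. -/
def contactGraph {n : ℕ} (x : Fin n → Plane) : SimpleGraph (Fin n) where
  Adj i j := dist (x i) (x j) = 1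
  symm := ⟨fun i j h => by rw [dist_comm]; exact h⟩
  loopless := ⟨fun i h => by simp at h⟩

/-- The geometry of an aggregate: disks of radius `1/2` that do not overlap and
whose contact graph is connected. -/
structure IsCluster {n : ℕ} (x : Fin n → Plane) : Prop where
  separated : ∀ i j, i ≠ j → 1 ≤ dist (x i) (x j)
  connected : (contactGraph x).Connected

end GFA

end

noncomputable section

namespace GFA

open Set Filter Topology
open scoped NNReal

/-! ### Global flows of bounded Lipschitz vector fields -/

section ODE

variable {E : Type*} [NormedAddCommGroup E] [NormedSpace ℝ E]

/-! The gradient is cut off within distance 1/2 of the particles, giving a bounded Lipschitz `field`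
with a global flow. Before attachment a trajectory stays at distance at least 1 from all particles,
so the cut-off is never felt. Outside the smallest origin-centred disk containing the particles the
flow points strictly inwards. Hence trajectories from distinct points of a large circle are disjoint
(`eq_of_flow_eq`).

The probabilities sum to 1. A trajectory attaching to no particle is bounded, its energy increases
to a limit, and since there are finitely many critical points it converges to one of them. Only
finitely many points of the circle do this. For α > 0 the Laplacian of E is positive, so the
linearization at a critical point has an expanding direction and one coordinate determines a
trajectory staying nearby; each side of the critical point receives at most one trajectory
(`finite_stable_circle_of_pos`). For α = 0 the Laplacian vanishes, but the argument of ∏ (z - x_i)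
is constant along the flow; prescribing it modulo π on a circle is a nontrivial polynomial equation.
Attaching to two particles at once means hitting a common point of two unit circles, which again
happens for finitely many starting points.

The limits exist. In the coordinates u = 1/r and θ, gradient lines solve dθ/du = `polarSlope`, which
is C¹ up to u = 0. Transport from radius r₂ to r₁ ≤ r₂ is therefore Lipschitz in θ with constant
exp(K(1/r₁ - 1/r₂)), so exp(-K/r) times the measure of the attaching angles is monotone in r, and it
is bounded.

At most six arcs. Suppose points leading to x_i alternate around the circle with seven points
leading elsewhere. Each of the latter is joined, along its trajectory and then through the disks of
the other particles, to a neighbour of x_i. If two of them used the same neighbour, the resulting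
path would separate two trajectories ending at x_i without meeting them, contradicting the planar
crossing lemma `curves_meet`. So x_i would have seven neighbours at distance 1 with mutual distances
at least 1, which is impossible. -/

/-- A curve of speed at most L moves at most L(N + 1) in time N + 1, so Picard–Lindelöf applies on
intervals of every length; uniqueness glues the solutions. -/
theorem exists_global_solution [CompleteSpace E] {f : ℝ → E → E} {K L : ℝ≥0}
    (hlip : ∀ t, LipschitzWith K (f t)) (hcont : ∀ x, Continuous fun t => f t x)
    (hL : ∀ t x, ‖f t x‖ ≤ L) (t₀ : ℝ) (x₀ : E) :
    ∃ γ : ℝ → E, γ t₀ = x₀ ∧ ∀ t, HasDerivAt γ (f t (γ t)) t := by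
  have key : ∀ N : ℕ, ∃ γ : ℝ → E, γ t₀ = x₀ ∧
      ∀ t ∈ Ioo (t₀ - (N + 1)) (t₀ + (N + 1)), HasDerivAt γ (f t (γ t)) t := by
    intro N
    have hN : (0 : ℝ) < N + 1 := by positivity
    have hpl : IsPicardLindelof f (tmin := t₀ - (N + 1)) (tmax := t₀ + (N + 1))
        ⟨t₀, by constructor <;> linarith⟩ x₀ (L * (N + 1)) 0 L K :=
      { lipschitzOnWith := fun t _ => (hlip t).lipschitzOnWith
        continuousOn := fun y _ => (hcont y).continuousOn
        norm_le := fun t _ y _ => hL t y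
        mul_max_le := by simp }
    obtain ⟨γ, h0, h⟩ := hpl.exists_eq_forall_mem_Icc_hasDerivWithinAt₀
    exact ⟨γ, h0, fun t ht =>
      (h t (Ioo_subset_Icc_self ht)).hasDerivAt (Icc_mem_nhds ht.1 ht.2)⟩
  choose α h0 hα using key
  have agree : ∀ M N : ℕ, M ≤ N → ∀ t ∈ Ioo (t₀ - (M + 1)) (t₀ + (M + 1)), α M t = α N t := by
    intro M N hMN
    have hM : (0 : ℝ) < M + 1 := by positivity
    have hMN' : (M : ℝ) ≤ N := by exact_mod_cast hMN
    refine ODE_solution_unique_of_mem_Ioo (v := f) (s := fun _ => univ) (K := K) (t₀ := t₀)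
      (fun t _ => (hlip t).lipschitzOnWith) ⟨by linarith, by linarith⟩
      (fun t ht => ⟨hα M t ht, trivial⟩)
      (fun t ht => ⟨hα N t ⟨by linarith [ht.1], by linarith [ht.2]⟩, trivial⟩) ?_
    rw [h0, h0]
  have mem : ∀ t : ℝ, ∀ N : ℕ, |t - t₀| ≤ N → t ∈ Ioo (t₀ - (N + 1)) (t₀ + (N + 1)) := by
    intro t N h
    rw [abs_le] at h
    constructor <;> linarith [h.1, h.2]
  refine ⟨fun t => α ⌈|t - t₀|⌉₊ t, h0 _, fun t => ?_⟩
  set N := ⌈|t - t₀|⌉₊ with hN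
  have htN : |t - t₀| ≤ N := Nat.le_ceil _
  refine (hα N t (mem t N htN)).congr_of_eventuallyEq ?_
  filter_upwards [Ioo_mem_nhds (mem t N htN).1 (mem t N htN).2] with s hs
  rcases le_total ⌈|s - t₀|⌉₊ N with h | h
  · exact agree _ _ h s (mem s _ (Nat.le_ceil _))
  · exact (agree _ _ h s hs).symm

theorem global_solution_unique {f : ℝ → E → E} {K : ℝ≥0} (hlip : ∀ t, LipschitzWith K (f t))
    {γ₁ γ₂ : ℝ → E} (h₁ : ∀ t, HasDerivAt γ₁ (f t (γ₁ t)) t)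
    (h₂ : ∀ t, HasDerivAt γ₂ (f t (γ₂ t)) t) {t₀ : ℝ} (h : γ₁ t₀ = γ₂ t₀) : γ₁ = γ₂ :=
  ODE_solution_unique_univ (v := f) (s := fun _ => univ) (K := K)
    (fun t => (hlip t).lipschitzOnWith) (fun t => ⟨h₁ t, trivial⟩) (fun t => ⟨h₂ t, trivial⟩) h

/-- `φ` is the global flow of the autonomous vector field `v`. -/
structure IsFlow (v : E → E) (φ : ℝ → E → E) : Prop where
  zero : ∀ p, φ 0 p = p
  hasDerivAt : ∀ p t, HasDerivAt (fun s => φ s p) (v (φ t p)) t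

theorem exists_isFlow [CompleteSpace E] {v : E → E} {K L : ℝ≥0} (hv : LipschitzWith K v)
    (hL : ∀ x, ‖v x‖ ≤ L) : ∃ φ : ℝ → E → E, IsFlow v φ := by
  choose γ h0 h using fun p : E => exists_global_solution (f := fun _ => v) (fun _ => hv)
    (fun _ => continuous_const) (fun _ => hL) 0 p
  exact ⟨fun t p => γ p t, h0, fun p t => h p t⟩

namespace IsFlow

variable {v : E → E} {φ : ℝ → E → E} {K : ℝ≥0}

theorem continuous_time (hφ : IsFlow v φ) (p : E) : Continuous fun t => φ t p :=
  continuous_iff_continuousAt.2 fun t => (hφ.hasDerivAt p t).continuousAt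

theorem add (hφ : IsFlow v φ) (hv : LipschitzWith K v) (s t : ℝ) (p : E) :
    φ (s + t) p = φ s (φ t p) := by
  have h1 : ∀ s, HasDerivAt (fun s => φ (s + t) p) (v (φ (s + t) p)) s := fun s =>
    (hφ.hasDerivAt p (s + t)).comp_add_const s t
  have := global_solution_unique (f := fun _ => v) (fun _ => hv) h1
    (hφ.hasDerivAt (φ t p)) (t₀ := 0) (by simp [hφ.zero])
  exact congrFun this s

theorem neg_apply (hφ : IsFlow v φ) (hv : LipschitzWith K v) (t : ℝ) (p : E) :
    φ (-t) (φ t p) = p := by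
  rw [← hφ.add hv, neg_add_cancel, hφ.zero]

theorem injective (hφ : IsFlow v φ) (hv : LipschitzWith K v) (t : ℝ) :
    Function.Injective (φ t) := fun p q h => by
  rw [← hφ.neg_apply hv t p, h, hφ.neg_apply hv]

theorem eq_of_solution (hφ : IsFlow v φ) (hv : LipschitzWith K v) {γ : ℝ → E} {T : ℝ}
    (hγ : ∀ t ∈ Icc 0 T, HasDerivWithinAt γ (v (γ t)) (Icc 0 T) t) :
    ∀ t ∈ Icc 0 T, γ t = φ t (γ 0) := by
  refine ODE_solution_unique (v := fun _ => v) (fun _ => hv)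
    (fun t ht => (hγ t ht).continuousWithinAt) (fun t ht => ?_)
    (hφ.continuous_time _).continuousOn (fun t ht => (hφ.hasDerivAt _ t).hasDerivWithinAt)
    (hφ.zero _).symm
  exact (hγ t (Ico_subset_Icc_self ht)).mono_of_mem_nhdsWithin (Icc_mem_nhdsGE_of_mem ht)

theorem dist_le (hφ : IsFlow v φ) (hv : LipschitzWith K v) {t : ℝ} (ht : 0 ≤ t) (p q : E) :
    dist (φ t p) (φ t q) ≤ dist p q * Real.exp (K * t) := by
  have := dist_le_of_trajectories_ODE (v := fun _ => v) (a := 0) (b := t) (fun _ => hv)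
    (hφ.continuous_time p).continuousOn (fun s _ => (hφ.hasDerivAt p s).hasDerivWithinAt)
    (hφ.continuous_time q).continuousOn (fun s _ => (hφ.hasDerivAt q s).hasDerivWithinAt)
    (δ := dist p q) (by simp [hφ.zero]) t ⟨ht, le_rfl⟩
  simpa using this

theorem continuousOn (hφ : IsFlow v φ) (hv : LipschitzWith K v) (T : ℝ) :
    ContinuousOn (fun z : E × ℝ => φ z.2 z.1) (univ ×ˢ Icc 0 T) := by
  refine continuousOn_prod_of_continuousOn_lipschitzOnWith _
    (Real.toNNReal (Real.exp (K * T))) (fun p _ => (hφ.continuous_time p).continuousOn)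
    (fun t ht => LipschitzOnWith.of_dist_le_mul fun p _ q _ => ?_)
  rw [Real.coe_toNNReal _ (Real.exp_nonneg _), mul_comm]
  refine (hφ.dist_le hv ht.1 p q).trans ?_
  gcongr
  exact ht.2

/-- The points reaching a closed set within time `T` form a closed set. -/
theorem isClosed_reach (hφ : IsFlow v φ) (hv : LipschitzWith K v) {D : Set E} (hD : IsClosed D)
    (T : ℝ) : IsClosed {p | ∃ s ∈ Icc 0 T, φ s p ∈ D} := by
  -- The time interval is compact, so projecting it away preserves closedness.
  have hcl : IsClosed {z : E × Icc (0 : ℝ) T | φ z.2 z.1 ∈ D} := by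
    have hc : Continuous fun z : E × Icc (0 : ℝ) T => φ z.2 z.1 :=
      (hφ.continuousOn hv T).comp_continuous
        (f := fun z : E × Icc (0 : ℝ) T => ((z.1, (z.2 : ℝ)) : E × ℝ)) (by fun_prop)
        (fun z => ⟨trivial, z.2.2⟩)
    exact hD.preimage hc
  have := isClosedMap_fst_of_compactSpace _ hcl
  convert this using 1
  ext p
  constructor
  · rintro ⟨s, hs, h⟩
    exact ⟨(p, ⟨s, hs⟩), h, rfl⟩
  · rintro ⟨⟨p', s⟩, h, rfl⟩
    exact ⟨s, s.2, h⟩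

end IsFlow

end ODE

end GFA

end

noncomputable section

namespace GFA

open Set Filter Topology
open scoped NNReal

/-! ### The truncated force of one particle -/

section Kernel

/-- The vector field `z ↦ ‖z‖ ^ (-β) z`, truncated near the origin. -/
def kernel (β : ℝ) (z : Plane) : Plane := (max ‖z‖ (1 / 2)) ^ (-β) • z

theorem max_half_pos (s : ℝ) : 0 < max s (1 / 2) := lt_max_of_lt_right (by norm_num)

theorem rpow_neg_max_half_le {β : ℝ} (hβ : 0 ≤ β) (s : ℝ) :
    (max s (1 / 2)) ^ (-β) ≤ (1 / 2) ^ (-β) :=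
  Real.rpow_le_rpow_of_nonpos (by norm_num) (le_max_right _ _) (by linarith)

theorem norm_kernel_le {β : ℝ} (hβ : 1 ≤ β) (z : Plane) : ‖kernel β z‖ ≤ (1 / 2) ^ (1 - β) := by
  have h0 := max_half_pos ‖z‖
  rw [kernel, norm_smul, Real.norm_of_nonneg (by positivity)]
  calc (max ‖z‖ (1 / 2)) ^ (-β) * ‖z‖
      ≤ (max ‖z‖ (1 / 2)) ^ (-β) * max ‖z‖ (1 / 2) := by gcongr; exact le_max_left _ _
    _ = (max ‖z‖ (1 / 2)) ^ (1 - β) := by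
        rw [← Real.rpow_add_one h0.ne']; congr 1; ring
    _ ≤ _ := Real.rpow_le_rpow_of_nonpos (by norm_num) (le_max_right _ _) (by linarith)

theorem rpow_neg_sub_le {β s t : ℝ} (hβ : 1 ≤ β) (ht : 0 < t) (hst : t ≤ s) :
    t ^ (-β) - s ^ (-β) ≤ t ^ (-β) * (β * ((s - t) / s)) := by
  have hs : 0 < s := ht.trans_le hst
  have hb := one_add_mul_self_le_rpow_one_add (s := t / s - 1)
    (by have : 0 < t / s := by positivity
        linarith) hβ
  have e : s ^ (-β) = t ^ (-β) * (t / s) ^ β := by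
    rw [Real.div_rpow ht.le hs.le, Real.rpow_neg ht.le, Real.rpow_neg hs.le]
    have : t ^ β ≠ 0 := (Real.rpow_pos_of_pos ht _).ne'
    field_simp
  have e2 : 1 + (t / s - 1) = t / s := by ring
  rw [e2] at hb
  have e3 : (s - t) / s = 1 - t / s := by field_simp
  rw [e, e3]
  have : 0 < t ^ (-β) := Real.rpow_pos_of_pos ht _
  nlinarith

/-- Taking w to be the shorter vector, the variation of the scalar factor is O((s - t)/s) by
Bernoulli's inequality, and ‖w‖ ≤ s cancels the denominator. -/
theorem lipschitz_kernel {β : ℝ} (hβ : 1 ≤ β) : ∃ K : ℝ≥0, LipschitzWith K (kernel β) := by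
  set C : ℝ := (1 / 2) ^ (-β) with hC
  have hC0 : 0 < C := by positivity
  refine ⟨Real.toNNReal (C * (1 + β)), LipschitzWith.of_dist_le_mul ?_⟩
  have main : ∀ z w : Plane, ‖w‖ ≤ ‖z‖ → ‖kernel β z - kernel β w‖ ≤ C * (1 + β) * ‖z - w‖ := by
    intro z w hwz
    set s := max ‖z‖ (1 / 2)
    set t := max ‖w‖ (1 / 2)
    have ht : 0 < t := max_half_pos _
    have hts : t ≤ s := max_le_max hwz le_rfl
    have hs : 0 < s := ht.trans_le hts
    have e : kernel β z - kernel β w = s ^ (-β) • (z - w) - (t ^ (-β) - s ^ (-β)) • w := by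
      simp only [kernel]
      module
    have hdiff : s - t ≤ ‖z - w‖ := by
      have h1 : s - t ≤ |‖z‖ - ‖w‖| := by
        refine (le_abs_self _).trans ?_
        exact abs_max_sub_max_le_abs _ _ _
      exact h1.trans (abs_norm_sub_norm_le z w)
    have h1 : t ^ (-β) - s ^ (-β) ≤ C * (β * ((s - t) / s)) := by
      refine (rpow_neg_sub_le hβ ht hts).trans ?_
      have : 0 ≤ (s - t) / s := div_nonneg (by linarith) hs.le
      gcongr
      exact rpow_neg_max_half_le (by linarith) _
    have h0 : 0 ≤ t ^ (-β) - s ^ (-β) := by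
      have := Real.rpow_le_rpow_of_nonpos ht hts (show -β ≤ 0 by linarith)
      linarith
    have hw : ‖w‖ ≤ s := hwz.trans (le_max_left _ _)
    rw [e]
    refine (norm_sub_le _ _).trans ?_
    rw [norm_smul, norm_smul, Real.norm_of_nonneg h0,
      Real.norm_of_nonneg (by positivity : 0 ≤ s ^ (-β))]
    have h2 : s ^ (-β) ≤ C := rpow_neg_max_half_le (by linarith) _
    calc s ^ (-β) * ‖z - w‖ + (t ^ (-β) - s ^ (-β)) * ‖w‖
        ≤ C * ‖z - w‖ + C * (β * ((s - t) / s)) * s := by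
          gcongr
      _ = C * ‖z - w‖ + C * β * (s - t) := by field_simp
      _ ≤ C * ‖z - w‖ + C * β * ‖z - w‖ := by gcongr
      _ = _ := by ring
  intro z w
  rw [Real.coe_toNNReal _ (by positivity), dist_eq_norm, dist_eq_norm]
  rcases le_total ‖w‖ ‖z‖ with h | h
  · exact main z w h
  · rw [norm_sub_rev (kernel β z), norm_sub_rev z]
    exact main w z h

theorem kernel_eq {β : ℝ} {z : Plane} (hz : 1 / 2 ≤ ‖z‖) : kernel β z = ‖z‖ ^ (-β) • z := by
  rw [kernel, max_eq_left hz]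

theorem norm_rpow_eq_sq_rpow (β : ℝ) (z : Plane) : ‖z‖ ^ (-β) = (‖z‖ ^ 2) ^ (-β / 2) := by
  rw [← Real.rpow_natCast, ← Real.rpow_mul (norm_nonneg _)]
  congr 1
  push_cast
  ring

/-- Symmetry and trace are all that is needed of the Hessian. For β = α + 2 the trace is -α
‖z‖^(-β), which is where α > 0 and α = 0 part ways. Strict differentiability serves to compare two
nearby trajectories. -/
theorem hasStrictFDerivAt_kernel {β : ℝ} {z : Plane} (hz : 1 / 2 < ‖z‖) :
    ∃ H : Plane →L[ℝ] Plane, HasStrictFDerivAt (kernel β) H z ∧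
      H !₂[0, 1] 0 = H !₂[1, 0] 1 ∧
      H !₂[1, 0] 0 + H !₂[0, 1] 1 = (2 - β) * ‖z‖ ^ (-β) := by
  have hz0 : 0 < ‖z‖ := by linarith
  have hsq : ‖z‖ ^ 2 ≠ 0 := by positivity
  have h1 : HasStrictFDerivAt (fun w : Plane => (‖w‖ ^ 2) ^ (-β / 2) • w) _ z :=
    ((hasStrictFDerivAt_norm_sq z).rpow_const (p := -β / 2) (Or.inl hsq)).smul
      (hasStrictFDerivAt_id z)
  refine ⟨_, h1.congr_of_eventuallyEq ?_, ?_, ?_⟩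
  · filter_upwards [(isOpen_lt continuous_const continuous_norm).mem_nhds hz] with w hw
    rw [kernel_eq (le_of_lt hw), norm_rpow_eq_sq_rpow]
  · simp [PiLp.inner_apply]
    ring
  · have hexp : (‖z‖ ^ 2) ^ (-β / 2) = (‖z‖ ^ 2) ^ (-β / 2 - 1) * ‖z‖ ^ 2 := by
      rw [← Real.rpow_add_one hsq]; congr 1; ring
    have hn : ‖z‖ ^ 2 = z 0 ^ 2 + z 1 ^ 2 := by
      rw [EuclideanSpace.norm_sq_eq]; simp
    rw [norm_rpow_eq_sq_rpow]
    simp [PiLp.inner_apply]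
    rw [hexp]
    linear_combination (β * (‖z‖ ^ 2) ^ (-β / 2 - 1)) * hn

end Kernel

/-! ### The truncated gradient field -/

section Field

variable {n : ℕ} (α : ℝ) (x : Fin n → Plane)

/-- The strength of the force exerted by a particle. -/
def strength (α : ℝ) : ℝ := if α = 0 then 1 else α

theorem strength_pos {α : ℝ} (hα : 0 ≤ α) : 0 < strength α := by
  unfold strength
  split_ifs with h
  · norm_num
  · exact lt_of_le_of_ne hα (Ne.symm h)

/-- The gradient of the energy, truncated near the particles. -/
def field (y : Plane) : Plane := -(strength α • ∑ i, kernel (α + 2) (y - x i))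

variable {α x}

theorem lipschitz_field (hα : 0 ≤ α) : ∃ K : ℝ≥0, LipschitzWith K (field α x) := by
  obtain ⟨K, hK⟩ := lipschitz_kernel (β := α + 2) (by linarith)
  have h1 : ∀ s : Finset (Fin n), ∃ K' : ℝ≥0,
      LipschitzWith K' fun y => ∑ i ∈ s, kernel (α + 2) (y - x i) := by
    intro s
    induction s using Finset.induction_on with
    | empty => exact ⟨0, by simp⟩
    | insert a s ha ih =>
      obtain ⟨K', hK'⟩ := ih
      simp only [Finset.sum_insert ha]
      have h1 : LipschitzWith 1 fun y : Plane => y - x a :=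
        LipschitzWith.of_dist_le_mul fun p q => by simp
      have h2 : LipschitzWith (K * 1) fun y => kernel (α + 2) (y - x a) := hK.comp h1
      exact ⟨_, h2.add hK'⟩
  obtain ⟨K', hK'⟩ := h1 Finset.univ
  exact ⟨_, ((lipschitzWith_smul (strength α)).comp hK').neg⟩

theorem bounded_field (hα : 0 ≤ α) : ∃ L : ℝ≥0, ∀ y, ‖field α x y‖ ≤ L := by
  refine ⟨Real.toNNReal (strength α * ∑ _i : Fin n, (1 / 2) ^ (1 - (α + 2))), fun y => ?_⟩
  have h0 := strength_pos hα
  rw [Real.coe_toNNReal _ (by positivity), field, norm_neg, norm_smul, Real.norm_of_nonneg h0.le]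
  gcongr
  exact (norm_sum_le _ _).trans (Finset.sum_le_sum fun i _ => norm_kernel_le (by linarith) _)

theorem exists_hasStrictFDerivAt_field (hn : 1 ≤ n) {y : Plane} (hy : ∀ i, 1 / 2 < dist y (x i)) :
    ∃ H : Plane →L[ℝ] Plane, HasStrictFDerivAt (field α x) H y ∧
      H !₂[0, 1] 0 = H !₂[1, 0] 1 ∧
      (0 < α → 0 < H !₂[1, 0] 0 + H !₂[0, 1] 1) := by
  choose H hH hs ht using fun i => hasStrictFDerivAt_kernel (β := α + 2) (z := y - x i)
    (by rw [← dist_eq_norm]; exact hy i)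
  have h1 : HasStrictFDerivAt (field α x) (-(strength α • ∑ i, H i)) y := by
    refine HasStrictFDerivAt.fun_neg (HasStrictFDerivAt.fun_const_smul ?_ _)
    refine HasStrictFDerivAt.fun_sum fun i _ => ?_
    exact (hH i).comp y ((hasStrictFDerivAt_id y).sub_const (x i))
  refine ⟨_, h1, ?_, fun hα => ?_⟩
  · simp [hs]
  · have hc : 0 < strength α := strength_pos hα.le
    have : (-(strength α • ∑ i, H i)) !₂[1, 0] 0 + (-(strength α • ∑ i, H i)) !₂[0, 1] 1 =
        strength α * ∑ i, α * ‖y - x i‖ ^ (-(α + 2)) := by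
      have e : ∀ i, α * ‖y - x i‖ ^ (-(α + 2)) = -(H i !₂[1, 0] 0 + H i !₂[0, 1] 1) := fun i => by
        rw [ht]; ring
      simp only [e, Finset.sum_neg_distrib, Finset.sum_add_distrib]
      simp
      ring
    rw [this]
    refine mul_pos hc (Finset.sum_pos (fun i _ => ?_) ⟨⟨0, hn⟩, Finset.mem_univ _⟩)
    have : 0 < ‖y - x i‖ := by rw [← dist_eq_norm]; linarith [hy i]
    positivity

theorem hasGradientAt_particle {a y : Plane} (h : y ≠ a) :
    HasGradientAt (fun y => if α = 0 then Real.log (1 / ‖y - a‖) else 1 / ‖y - a‖ ^ α)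
      (-(strength α * ‖y - a‖ ^ (-(α + 2))) • (y - a)) y := by
  have hz : 0 < ‖y - a‖ := norm_pos_iff.2 (sub_ne_zero.2 h)
  have hsq : ‖y - a‖ ^ 2 ≠ 0 := by positivity
  have hN : HasFDerivAt (fun y : Plane => ‖y - a‖ ^ 2) _ y :=
    ((hasFDerivAt_id y).sub_const a).norm_sq
  rw [hasGradientAt_iff_hasFDerivAt]
  unfold strength
  split_ifs with hα
  · have h1 := (hN.log hsq).const_mul (-1 / 2)
    refine (h1.congr_of_eventuallyEq (Eventually.of_forall fun w => ?_)).congr_fderiv ?_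
    · simp only [Real.log_pow, one_div, Real.log_inv]
      push_cast
      ring
    · ext w
      have e : ‖y - a‖ ^ (-(α + 2)) = (‖y - a‖ ^ 2)⁻¹ := by
        rw [hα, zero_add, Real.rpow_neg hz.le, Real.rpow_two]
      rw [e]
      simp [InnerProductSpace.toDual_apply_apply]
      ring
  · have h1 := hN.rpow_const (p := -α / 2) (Or.inl hsq)
    refine (h1.congr_of_eventuallyEq (Eventually.of_forall fun w => ?_)).congr_fderiv ?_
    · simp only
      rw [← norm_rpow_eq_sq_rpow, Real.rpow_neg (norm_nonneg _), one_div]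
    · ext w
      have e : ‖y - a‖ ^ (-(α + 2)) = (‖y - a‖ ^ 2) ^ (-α / 2 - 1) := by
        rw [norm_rpow_eq_sq_rpow]; congr 1; ring
      rw [e]
      simp [InnerProductSpace.toDual_apply_apply]
      ring

theorem hasGradientAt_energy {y : Plane} (hy : ∀ i, 1 / 2 ≤ dist y (x i)) :
    HasGradientAt (energy α x) (field α x y) y := by
  have h : ∀ i, HasFDerivAt _ _ y := fun i => (hasGradientAt_iff_hasFDerivAt.1
    (hasGradientAt_particle (α := α) (a := x i) (y := y)
      (dist_pos.1 (by linarith [hy i]))))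
  rw [hasGradientAt_iff_hasFDerivAt]
  refine ((HasFDerivAt.fun_sum fun i (_ : i ∈ Finset.univ) => h i).congr_of_eventuallyEq
    (Eventually.of_forall fun w => ?_)).congr_fderiv ?_
  · unfold energy
    split_ifs <;> rfl
  · rw [← map_sum, field, Finset.smul_sum, ← Finset.sum_neg_distrib]
    congr 1
    refine Finset.sum_congr rfl fun i _ => ?_
    rw [kernel_eq (by rw [← dist_eq_norm]; exact hy i), smul_smul, neg_smul]

theorem gradient_energy {y : Plane} (hy : ∀ i, 1 / 2 ≤ dist y (x i)) :
    gradient (energy α x) y = field α x y :=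
  (hasGradientAt_energy hy).gradient

theorem inner_field_neg (hn : 1 ≤ n) (hα : 0 ≤ α) {y : Plane} (hy : ∀ i, ‖x i‖ < ‖y‖) :
    inner ℝ y (field α x y) < 0 := by
  rw [field, inner_neg_right, inner_smul_right, inner_sum, neg_lt_zero]
  refine mul_pos (strength_pos hα) (Finset.sum_pos (fun i _ => ?_) ⟨⟨0, hn⟩, Finset.mem_univ _⟩)
  rw [kernel, inner_smul_right]
  refine mul_pos (Real.rpow_pos_of_pos (max_half_pos _) _) ?_
  rw [inner_sub_right, real_inner_self_eq_norm_sq, sub_pos]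
  have h1 := real_inner_le_norm y (x i)
  have h2 := hy i
  have : 0 < ‖y‖ := (norm_nonneg _).trans_lt h2
  nlinarith

end Field

end GFA

end

noncomputable section

namespace GFA

open Set Filter Topology
open scoped NNReal

/-! ### Inward flow, attachment and convergence to critical points -/

section Dynamics

variable {n : ℕ} {α : ℝ} {x : Fin n → Plane} {φ : ℝ → Plane → Plane} {K : ℝ≥0}

theorem hasDerivAt_norm_sq_flow (hφ : IsFlow (field α x) φ) (p : Plane) (t : ℝ) :
    HasDerivAt (fun s => ‖φ s p‖ ^ 2) (2 * inner ℝ (φ t p) (field α x (φ t p))) t :=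
  (hφ.hasDerivAt p t).norm_sq

/-- Outside of the disk spanned by the particles the flow points inwards. -/
theorem norm_flow_lt (hn : 1 ≤ n) (hα : 0 ≤ α) (hφ : IsFlow (field α x) φ) {p : Plane}
    (hp : ∀ i, ‖x i‖ < ‖p‖) {t : ℝ} (ht : 0 < t) : ‖φ t p‖ < ‖p‖ := by
  have hle : ∀ s ∈ Icc 0 t, ‖φ s p‖ ^ 2 ≤ ‖p‖ ^ 2 := by
    refine image_le_of_deriv_right_lt_deriv_boundary (B := fun _ => ‖p‖ ^ 2) (B' := fun _ => 0)
      (f' := fun s => 2 * inner ℝ (φ s p) (field α x (φ s p)))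
      (fun s _ => (hasDerivAt_norm_sq_flow hφ p s).continuousAt.continuousWithinAt)
      (fun s _ => (hasDerivAt_norm_sq_flow hφ p s).hasDerivWithinAt) (by simp [hφ.zero])
      (fun s => hasDerivAt_const s _) (fun s _ h => ?_)
    have h' : ‖φ s p‖ = ‖p‖ := (sq_eq_sq₀ (norm_nonneg _) (norm_nonneg _)).1 h
    have := inner_field_neg hn hα (x := x) (y := φ s p) (by rwa [h'])
    linarith
  refine lt_of_le_of_ne ((sq_le_sq₀ (norm_nonneg _) (norm_nonneg _)).1 (hle t ⟨ht.le, le_rfl⟩))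
    fun h => ?_
  have hd := hasDerivAt_norm_sq_flow hφ p t
  have hneg : 2 * inner ℝ (φ t p) (field α x (φ t p)) < 0 := by
    have := inner_field_neg hn hα (x := x) (y := φ t p) (by rwa [h])
    linarith
  -- If the norm were back at its initial value at time t, its negative derivative would make it
  -- larger just before t.
  have hsl := (hasDerivAt_iff_tendsto_slope.1 hd).eventually_lt_const hneg
  have h2 : ∀ᶠ s in 𝓝[<] t, slope (fun s => ‖φ s p‖ ^ 2) t s < 0 :=
    hsl.filter_mono (nhdsWithin_mono _ fun s hs => ne_of_lt hs)
  obtain ⟨s, hs, hs0, hst⟩ := (h2.and (Ioo_mem_nhdsLT ht)).exists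
  have h3 := hle s ⟨hs0.le, hst.le⟩
  rw [slope_def_field, h] at hs
  have : 0 ≤ (‖φ s p‖ ^ 2 - ‖p‖ ^ 2) / (s - t) := div_nonneg_of_nonpos (by linarith) (by linarith)
  linarith

theorem norm_flow_le (hn : 1 ≤ n) (hα : 0 ≤ α) (hφ : IsFlow (field α x) φ) {p : Plane}
    (hp : ∀ i, ‖x i‖ < ‖p‖) {t : ℝ} (ht : 0 ≤ t) : ‖φ t p‖ ≤ ‖p‖ := by
  rcases ht.eq_or_lt with rfl | h
  · rw [hφ.zero]
  · exact (norm_flow_lt hn hα hφ hp h).le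

/-- Trajectories through different points of a large circle are disjoint. -/
theorem eq_of_flow_eq (hn : 1 ≤ n) (hα : 0 ≤ α) (hv : LipschitzWith K (field α x))
    (hφ : IsFlow (field α x) φ) {p q : Plane} (hpq : ‖p‖ = ‖q‖) (hp : ∀ i, ‖x i‖ < ‖p‖) {s t : ℝ}
    (h : φ s p = φ t q) : p = q := by
  have key : ∀ {p q : Plane} {s t : ℝ}, ‖p‖ = ‖q‖ → (∀ i, ‖x i‖ < ‖p‖) → s ≤ t →
      φ s p = φ t q → p = q := by
    intro p q s t hpq hp hst h
    have h1 : p = φ (t - s) q := by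
      refine hφ.injective hv s ?_
      rw [← hφ.add hv, h]
      congr 1
      ring
    rcases hst.eq_or_lt with rfl | hlt
    · rw [h1, sub_self, hφ.zero]
    · have := norm_flow_lt hn hα hφ (p := q) (by rwa [← hpq]) (sub_pos.2 hlt)
      rw [← h1] at this
      exact absurd hpq this.ne
  rcases le_total s t with hst | hst
  · exact key hpq hp hst h
  · exact (key hpq.symm (by rwa [← hpq]) hst h.symm).symm

theorem one_le_dist_of_Ico {γ : ℝ → Plane} {T : ℝ} (hT : 0 < T) (hγ : ContinuousOn γ (Icc 0 T))
    {a : Plane} (h : ∀ t ∈ Ico 0 T, 1 < dist (γ t) a) : ∀ t ∈ Icc 0 T, 1 ≤ dist (γ t) a := by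
  intro t ht
  rcases ht.2.eq_or_lt with rfl | hlt
  · have hc : Tendsto (fun s => dist (γ s) a) (𝓝[Ico 0 t] t) (𝓝 (dist (γ t) a)) :=
      ((hγ t ht).mono Ico_subset_Icc_self).dist continuousWithinAt_const
    have : (𝓝[Ico 0 t] t).NeBot := by
      rw [← mem_closure_iff_nhdsWithin_neBot, closure_Ico hT.ne]
      exact ht
    exact ge_of_tendsto hc (eventually_mem_nhdsWithin.mono fun s hs => (h s hs).le)
  · exact (h t ⟨ht.1, hlt⟩).le

/-- Replaces arbitrary gradient curves by the global flow: by continuity the distances are at least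
1 on the closed interval, where gradient and truncated field agree. -/
theorem attachesTo_iff (hv : LipschitzWith K (field α x)) (hφ : IsFlow (field α x) φ) {i : Fin n}
    {p : Plane} : AttachesTo α x i p ↔ ∃ T, 0 ≤ T ∧
      (∀ t ∈ Ico 0 T, ∀ j, 1 < dist (φ t p) (x j)) ∧ dist (φ T p) (x i) = 1 := by
  constructor
  · rintro ⟨T, γ, hT, h0, hd, hj, hi⟩
    rcases hT.eq_or_lt with rfl | hT
    · refine ⟨0, le_rfl, by simp, ?_⟩
      rw [hφ.zero, ← h0, hi]
    · have hc : ContinuousOn γ (Icc 0 T) := fun t ht => (hd t ht).continuousWithinAt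
      have he : ∀ t ∈ Icc 0 T, γ t = φ t p := by
        rw [← h0]
        refine hφ.eq_of_solution hv fun t ht => ?_
        rw [← gradient_energy fun j => ?_]
        · exact hd t ht
        · have := one_le_dist_of_Ico hT hc (fun t ht => hj t ht j) t ht
          linarith
      refine ⟨T, hT.le, fun t ht j => ?_, ?_⟩
      · rw [← he t (Ico_subset_Icc_self ht)]
        exact hj t ht j
      · rw [← he T ⟨hT.le, le_rfl⟩, hi]
  · rintro ⟨T, hT, hj, hi⟩
    refine ⟨T, fun t => φ t p, hT, hφ.zero p, fun t ht => ?_, hj, hi⟩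
    -- For T = 0 the time interval is a single point, on which every vector is a derivative.
    rcases hT.eq_or_lt with rfl | hT
    · have : t = 0 := le_antisymm ht.2 ht.1
      subst this
      rw [Icc_self]
      exact HasFDerivWithinAt.of_subsingleton subsingleton_singleton
    · rw [gradient_energy fun j => ?_]
      · exact (hφ.hasDerivAt p t).hasDerivWithinAt
      · have := one_le_dist_of_Ico hT (hφ.continuous_time p).continuousOn
          (fun t ht => hj t ht j) t ht
        linarith

theorem one_lt_dist_of_norm {r : ℝ} (hr : ∀ i, ‖x i‖ + 1 < r) {p : Plane} (hp : ‖p‖ = r)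
    (j : Fin n) : 1 < dist p (x j) := by
  have h1 := norm_sub_norm_le p (x j)
  have h2 := hr j
  rw [dist_eq_norm]
  linarith

theorem exists_first_hit (hφ : IsFlow (field α x) φ) {p : Plane} (hp : ∀ j, 1 < dist p (x j))
    {t₀ : ℝ} (ht₀ : 0 ≤ t₀) {j₀ : Fin n} (h : dist (φ t₀ p) (x j₀) ≤ 1) :
    ∃ T i, 0 < T ∧ T ≤ t₀ ∧ (∀ t ∈ Ico 0 T, ∀ j, 1 < dist (φ t p) (x j)) ∧
      dist (φ T p) (x i) = 1 := by
  set S : Set ℝ := {t | 0 ≤ t ∧ ∃ j, dist (φ t p) (x j) ≤ 1} with hS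
  have hcl : IsClosed S := by
    have : S = Ici 0 ∩ ⋃ j, {t | dist (φ t p) (x j) ≤ 1} := by
      ext t; simp [hS]
    rw [this]
    exact isClosed_Ici.inter (isClosed_iUnion_of_finite fun j =>
      isClosed_le ((hφ.continuous_time p).dist continuous_const) continuous_const)
  have hbdd : BddBelow S := ⟨0, fun t ht => ht.1⟩
  have hmem : t₀ ∈ S := ⟨ht₀, j₀, h⟩
  obtain ⟨hT0, i, hi⟩ := hcl.csInf_mem ⟨t₀, hmem⟩ hbdd
  set T := sInf S
  have hlt : ∀ t ∈ Ico 0 T, ∀ j, 1 < dist (φ t p) (x j) := by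
    intro t ht j
    by_contra hcon
    exact absurd (csInf_le hbdd (show t ∈ S from ⟨ht.1, j, not_lt.1 hcon⟩)) (not_le.2 ht.2)
  have hTpos : 0 < T := by
    refine hT0.lt_of_ne fun h0 => ?_
    rw [← h0, hφ.zero] at hi
    exact absurd (hp i) (not_lt.2 hi)
  exact ⟨T, i, hTpos, csInf_le hbdd hmem, hlt, le_antisymm hi
    (one_le_dist_of_Ico hTpos (hφ.continuous_time p).continuousOn (fun t ht => hlt t ht i) T
      ⟨hTpos.le, le_rfl⟩)⟩

theorem one_lt_dist_of_not_attachesTo (hv : LipschitzWith K (field α x))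
    (hφ : IsFlow (field α x) φ) {p : Plane} (hp : ∀ j, 1 < dist p (x j))
    (h : ∀ i, ¬ AttachesTo α x i p) {t : ℝ} (ht : 0 ≤ t) (j : Fin n) :
    1 < dist (φ t p) (x j) := by
  by_contra hcon
  obtain ⟨T, i, hT, -, h1, h2⟩ := exists_first_hit hφ hp ht (not_lt.1 hcon)
  exact h i ((attachesTo_iff hv hφ).2 ⟨T, hT.le, h1, h2⟩)

theorem hasDerivAt_energy_flow (hφ : IsFlow (field α x) φ) {p : Plane} {t : ℝ}
    (h : ∀ i, 1 / 2 ≤ dist (φ t p) (x i)) :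
    HasDerivAt (fun s => energy α x (φ s p)) (‖field α x (φ t p)‖ ^ 2) t := by
  have := (hasGradientAt_iff_hasFDerivAt.1 (hasGradientAt_energy (α := α) h)).comp_hasDerivAt t
    (hφ.hasDerivAt p t)
  rw [InnerProductSpace.toDual_apply_apply, real_inner_self_eq_norm_sq] at this
  exact this

/-- A trajectory that stays forever in a bounded region away from the particles has
velocity tending to zero. -/
theorem tendsto_field_flow_zero (hα : 0 ≤ α) (hv : LipschitzWith K (field α x))
    (hφ : IsFlow (field α x) φ) {p : Plane} {r : ℝ}
    (hdist : ∀ t, 0 ≤ t → ∀ j, 1 < dist (φ t p) (x j)) (hr : ∀ t, 0 ≤ t → ‖φ t p‖ ≤ r) :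
    Tendsto (fun t => field α x (φ t p)) atTop (𝓝 0) := by
  set e : ℝ → ℝ := fun t => energy α x (φ t p) with he
  have hd : ∀ t, 0 ≤ t → HasDerivAt e (‖field α x (φ t p)‖ ^ 2) t := fun t ht =>
    hasDerivAt_energy_flow hφ fun i => by linarith [hdist t ht i]
  have hmono : MonotoneOn e (Ici 0) := by
    refine monotoneOn_of_deriv_nonneg (convex_Ici 0)
      (fun t ht => (hd t ht).continuousAt.continuousWithinAt)
      (fun t ht => ?_) (fun t ht => ?_)
    · rw [interior_Ici] at ht
      exact (hd t (le_of_lt ht)).differentiableAt.differentiableWithinAt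
    · rw [interior_Ici] at ht
      rw [(hd t (le_of_lt ht)).deriv]
      positivity
  obtain ⟨M, hM⟩ : ∃ M, ∀ t, 0 ≤ t → e t ≤ M := by
    have hK : IsCompact (Metric.closedBall (0 : Plane) r ∩ ⋂ j, {y | 1 ≤ dist y (x j)}) :=
      (isCompact_closedBall _ _).inter_right (isClosed_iInter fun j =>
        isClosed_le continuous_const (by fun_prop))
    have hc : ContinuousOn (energy α x)
        (Metric.closedBall (0 : Plane) r ∩ ⋂ j, {y | 1 ≤ dist y (x j)}) := by
      intro y hy
      refine (hasGradientAt_iff_hasFDerivAt.1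
        (hasGradientAt_energy (α := α) (x := x) fun i => ?_)).continuousAt.continuousWithinAt
      have := mem_iInter.1 hy.2 i
      simp only [mem_ofPred_eq] at this
      linarith
    obtain ⟨M, hM⟩ := hK.bddAbove_image hc
    refine ⟨M, fun t ht => hM ⟨φ t p, ⟨by simpa using hr t ht, ?_⟩, rfl⟩⟩
    exact mem_iInter.2 fun j => (hdist t ht j).le
  obtain ⟨ℓ, hℓ⟩ : ∃ ℓ, Tendsto e atTop (𝓝 ℓ) := by
    have hm : Monotone fun t => e (max t 0) := fun s t hst =>
      hmono (mem_Ici.2 (le_max_right _ _)) (mem_Ici.2 (le_max_right _ _)) (max_le_max hst le_rfl)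
    have hb : BddAbove (range fun t => e (max t 0)) := by
      refine ⟨M, ?_⟩
      rintro _ ⟨t, rfl⟩
      exact hM _ (le_max_right _ _)
    refine ⟨_, (tendsto_atTop_ciSup hm hb).congr' ?_⟩
    filter_upwards [eventually_ge_atTop 0] with t ht
    rw [max_eq_left ht]
  obtain ⟨L, hL⟩ := bounded_field (x := x) hα
  have hlipt : LipschitzWith L fun t => φ t p :=
    lipschitzWith_of_nnnorm_deriv_le (fun t => (hφ.hasDerivAt p t).differentiableAt) fun t => by
      rw [(hφ.hasDerivAt p t).deriv]
      exact hL _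
  rw [Metric.tendsto_atTop]
  intro ε hε
  -- During time δ the velocity changes by at most K L δ < ε/2. The energy gain over such a window
  -- tends to 0, so by the mean value theorem the velocity is below ε/2 somewhere in it.
  set δ : ℝ := ε / (2 * (K * L + 1)) with hδ
  have hKL : (0 : ℝ) ≤ K * L := by positivity
  have hδ0 : 0 < δ := by positivity
  have hδK : K * L * δ < ε / 2 := by
    rw [hδ, ← mul_div_assoc, div_lt_iff₀ (by positivity)]
    nlinarith
  have hdiff : Tendsto (fun t => e (t + δ) - e t) atTop (𝓝 0) := by
    have := (hℓ.comp (tendsto_atTop_add_const_right atTop δ tendsto_id)).sub hℓ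
    simpa using this
  have hev := hdiff.eventually_lt_const (show 0 < δ * (ε / 2) ^ 2 by positivity)
  obtain ⟨T, hT⟩ := eventually_atTop.1 (hev.and (eventually_ge_atTop (0 : ℝ)))
  refine ⟨T, fun t ht => ?_⟩
  obtain ⟨h1, h0⟩ := hT t ht
  obtain ⟨ξ, hξ, hξe⟩ := exists_hasDerivAt_eq_slope e (fun s => ‖field α x (φ s p)‖ ^ 2)
    (show t < t + δ by linarith)
    (fun s hs => (hd s (h0.trans hs.1)).continuousAt.continuousWithinAt)
    (fun s hs => hd s (h0.trans hs.1.le))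
  have h2 : ‖field α x (φ ξ p)‖ < ε / 2 := by
    rw [eq_div_iff (by linarith)] at hξe
    have : ‖field α x (φ ξ p)‖ ^ 2 < (ε / 2) ^ 2 := by
      by_contra hcon
      rw [not_lt] at hcon
      nlinarith
    exact (sq_lt_sq₀ (norm_nonneg _) (by positivity)).1 this
  have h3 : dist (field α x (φ t p)) (field α x (φ ξ p)) ≤ K * L * δ := by
    refine (hv.dist_le_mul _ _).trans ?_
    have h4 := hlipt.dist_le_mul t ξ
    have h5 : dist t ξ ≤ δ := by
      rw [Real.dist_eq, abs_le]
      constructor <;> linarith [hξ.1, hξ.2]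
    calc (K : ℝ) * dist (φ t p) (φ ξ p) ≤ K * (L * δ) := by
          gcongr
          exact h4.trans (by gcongr)
      _ = _ := by ring
  rw [dist_zero_right]
  rw [dist_eq_norm] at h3
  have := norm_le_norm_add_norm_sub' (field α x (φ t p)) (field α x (φ ξ p))
  linarith

/-- A bounded trajectory that never comes close to the particles converges to a critical point. -/
theorem exists_tendsto_criticalPoint (hα : 0 ≤ α) (hP : PropertyP α x)
    (hv : LipschitzWith K (field α x)) (hφ : IsFlow (field α x) φ) {p : Plane} {r : ℝ}
    (hdist : ∀ t, 0 ≤ t → ∀ j, 1 < dist (φ t p) (x j)) (hr : ∀ t, 0 ≤ t → ‖φ t p‖ ≤ r) :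
    ∃ c ∈ criticalPoints α x, (∀ i, 1 ≤ dist c (x i)) ∧
      Tendsto (fun t => φ t p) atTop (𝓝 c) := by
  have hv0 := tendsto_field_flow_zero hα hv hφ hdist hr
  set D : Set Plane := Metric.closedBall (0 : Plane) r ∩ ⋂ j, {y | 1 ≤ dist y (x j)} with hD
  have hDc : IsCompact D := (isCompact_closedBall _ _).inter_right (isClosed_iInter fun j =>
        isClosed_le continuous_const (by fun_prop))
  have hDmem : ∀ t, 0 ≤ t → φ t p ∈ D := fun t ht =>
    ⟨by simpa using hr t ht, mem_iInter.2 fun j => (hdist t ht j).le⟩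
  have hcrit : ∀ c ∈ D, field α x c = 0 → c ∈ criticalPoints α x := by
    intro c hc h0
    have h1 : ∀ i, 1 ≤ dist c (x i) := fun i => mem_iInter.1 hc.2 i
    refine ⟨fun i h => ?_, ?_⟩
    · have := h1 i
      rw [h, dist_self] at this
      linarith
    · rw [gradient_energy fun i => by linarith [h1 i], h0]
  -- A general filter is allowed because this is used twice: along all times, and along the times at
  -- which the trajectory lies on a given small circle.
  have hclu : ∀ F : Filter ℝ, F ≤ atTop → F.NeBot → ∀ C : Set Plane, IsClosed C →
      (∀ᶠ t in F, φ t p ∈ C) → ∃ c ∈ D, c ∈ C ∧ c ∈ criticalPoints α x ∧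
        MapClusterPt c F fun t => φ t p := by
    intro F hF _ C hC hev
    have hDC : IsCompact (D ∩ C) := hDc.inter_right hC
    have hle : map (fun t => φ t p) F ≤ 𝓟 (D ∩ C) := by
      rw [le_principal_iff, mem_map]
      filter_upwards [hev, hF (eventually_ge_atTop 0)] with t h1 h2
      exact ⟨hDmem t h2, h1⟩
    obtain ⟨c, hc, hcl⟩ := hDC hle
    refine ⟨c, hc.1, hc.2, hcrit c hc.1 ?_, hcl⟩
    have h1 : MapClusterPt (field α x c) F (fun t => field α x (φ t p)) :=
      MapClusterPt.continuousAt_comp hv.continuous.continuousAt hcl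
    have h2 := hv0.mono_left hF
    have h3 := ClusterPt.mono h1 h2
    rw [ClusterPt] at h3
    exact eq_of_nhds_neBot h3
  obtain ⟨c, hcD, -, hcc, hcl⟩ := hclu atTop le_rfl inferInstance univ isClosed_univ (by simp)
  refine ⟨c, hcc, fun i => mem_iInter.1 hcD.2 i, ?_⟩
  obtain ⟨ε₀, hε₀, hball⟩ : ∃ ε₀ > 0, Metric.ball c ε₀ ⊆ (criticalPoints α x \ {c})ᶜ :=
    Metric.mem_nhds_iff.1 ((hP.subset sdiff_subset).isClosed.isOpen_compl.mem_nhds (by simp))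
  -- Returning to a small circle around c forever would produce a critical point on it. Hence a
  -- trajectory that comes close to c late enough is trapped.
  have hne : ∀ ε, 0 < ε → ε < ε₀ → ∀ᶠ t in atTop, dist (φ t p) c ≠ ε := by
    intro ε hε hεε
    by_contra hcon
    have hfr : ∃ᶠ t in atTop, dist (φ t p) c = ε := by
      simpa only [not_eventually, not_not] using hcon
    have hF : (atTop ⊓ 𝓟 {t | dist (φ t p) c = ε}).NeBot := frequently_mem_iff_neBot.1 hfr
    obtain ⟨c', -, hc', hcrit', -⟩ := hclu _ inf_le_left hF {y | dist y c = ε}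
      (isClosed_eq (by fun_prop) continuous_const) (mem_inf_of_right (mem_principal_self _))
    have hc'' : dist c' c = ε := hc'
    refine hball (show c' ∈ Metric.ball c ε₀ by rw [Metric.mem_ball, hc'']; exact hεε)
      ⟨hcrit', fun h => ?_⟩
    rw [mem_singleton_iff.1 h, dist_self] at hc''
    exact hε.ne hc''
  rw [Metric.tendsto_atTop]
  intro ε hε
  set ε' := min ε (ε₀ / 2)
  have hε' : 0 < ε' := lt_min hε (by linarith)
  have hfr : ∃ᶠ t in atTop, dist (φ t p) c < ε' :=
    hcl.frequently (Metric.ball_mem_nhds c hε')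
  obtain ⟨T₀, hT₀⟩ := eventually_atTop.1
    (hne ε' hε' ((min_le_right _ _).trans_lt (by linarith)))
  obtain ⟨T, hTT, hT⟩ := (frequently_atTop.1 hfr) T₀
  refine ⟨T, fun t ht => lt_of_lt_of_le ?_ (min_le_left ε (ε₀ / 2))⟩
  by_contra hcon
  have hc : ContinuousOn (fun t => dist (φ t p) c) (Icc T t) :=
    ((hφ.continuous_time p).dist continuous_const).continuousOn
  obtain ⟨s, hs, hse⟩ := intermediate_value_Icc ht hc ⟨hT.le, not_lt.1 hcon⟩
  exact hT₀ s (hTT.trans hs.1) hse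

end Dynamics

end GFA

end

noncomputable section

namespace GFA

open Set Filter Topology
open scoped NNReal

/-! ### Stable sets of critical points for α > 0 -/

section StableSet

/-- The function exp(-βt) q(t) is strictly increasing from a nonnegative value, so q eventually
grows at least like a positive multiple of exp(βt). -/
theorem not_bounded_of_deriv_ge {q q' m : ℝ → ℝ} {β B : ℝ} (hβ : 0 < β)
    (hq : ∀ t, 0 ≤ t → HasDerivAt q (q' t) t) (hm : ∀ t, 0 ≤ t → 0 < m t)
    (h : ∀ t, 0 ≤ t → β * q t + m t ≤ q' t) (h0 : 0 ≤ q 0) (hB : ∀ t, 0 ≤ t → q t ≤ B) :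
    False := by
  have hd : ∀ t, 0 ≤ t → HasDerivAt (fun t => Real.exp (-β * t) * q t)
      (Real.exp (-β * t) * (q' t - β * q t)) t := by
    intro t ht
    have h1 : HasDerivAt (fun t => Real.exp (-β * t)) (Real.exp (-β * t) * (-β * 1)) t :=
      ((hasDerivAt_id t).const_mul (-β)).exp
    refine (h1.mul (hq t ht)).congr_deriv ?_
    ring
  have hmono : StrictMonoOn (fun t => Real.exp (-β * t) * q t) (Ici 0) := by
    refine strictMonoOn_of_deriv_pos (convex_Ici 0)
      (fun t ht => (hd t ht).continuousAt.continuousWithinAt) (fun t ht => ?_)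
    rw [interior_Ici] at ht
    rw [(hd t (le_of_lt ht)).deriv]
    have h1 := h t (le_of_lt ht)
    have h2 := hm t (le_of_lt ht)
    exact mul_pos (Real.exp_pos _) (by linarith)
  have h1 : 0 < Real.exp (-β * 1) * q 1 := by
    have := hmono (mem_Ici.2 le_rfl) (mem_Ici.2 zero_le_one) zero_lt_one
    simp only [mul_zero, Real.exp_zero, one_mul] at this
    linarith
  set η := Real.exp (-β * 1) * q 1
  have h2 : ∀ t, 1 ≤ t → η * Real.exp (β * t) ≤ B := by
    intro t ht
    have h3 := hmono.monotoneOn (mem_Ici.2 zero_le_one) (mem_Ici.2 (zero_le_one.trans ht)) ht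
    have h4 : q t = (Real.exp (-β * t) * q t) * Real.exp (β * t) := by
      rw [mul_right_comm, ← Real.exp_add]
      simp
    refine le_trans ?_ (hB t (by linarith))
    rw [h4]
    gcongr
  have h3 : Tendsto (fun t => η * Real.exp (β * t)) atTop atTop :=
    (Real.tendsto_exp_atTop.comp (tendsto_id.const_mul_atTop hβ)).const_mul_atTop h1
  obtain ⟨t, ht, ht'⟩ := ((h3.eventually_gt_atTop B).and (eventually_ge_atTop 1)).exists
  exact absurd (h2 t ht') (not_le.2 ht)

theorem hasDerivAt_coord {γ : ℝ → Plane} {γ' : Plane} {t : ℝ} (h : HasDerivAt γ γ' t) (k : Fin 2) :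
    HasDerivAt (fun s => γ s k) (γ' k) t :=
  (EuclideanSpace.proj (𝕜 := ℝ) k).hasFDerivAt.comp_hasDerivAt t h

theorem plane_norm_sq (w : Plane) : ‖w‖ ^ 2 = w 0 ^ 2 + w 1 ^ 2 := by
  rw [EuclideanSpace.norm_sq_eq]; simp

theorem plane_map_eq (H : Plane →L[ℝ] Plane) (w : Plane) (k : Fin 2) :
    H w k = w 0 * H !₂[1, 0] k + w 1 * H !₂[0, 1] k := by
  have : w = w 0 • !₂[1, 0] + w 1 • !₂[0, 1] := by
    ext j; fin_cases j <;> simp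
  conv_lhs => rw [this]
  simp

/-- Near a zero of a planar field whose linearization is symmetric with positive trace, a
trajectory that stays nearby forever is determined by one coordinate of its starting point. -/
theorem exists_coord_injOn_stableSet {v : Plane → Plane} {φ : ℝ → Plane → Plane} {K : ℝ≥0}
    (hv : LipschitzWith K v) (hφ : IsFlow v φ) {c : Plane} {H : Plane →L[ℝ] Plane}
    (hH : HasStrictFDerivAt v H c) (hsymm : H !₂[0, 1] 0 = H !₂[1, 0] 1)
    (htr : 0 < H !₂[1, 0] 0 + H !₂[0, 1] 1) :
    ∃ δ > 0, ∃ k : Fin 2, ∀ p q : Plane, (∀ t, 0 ≤ t → dist (φ t p) c < δ) →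
      (∀ t, 0 ≤ t → dist (φ t q) c < δ) → p k = q k → p = q := by
  obtain ⟨a, ha⟩ : ∃ a, a = H !₂[1, 0] 0 := ⟨_, rfl⟩
  obtain ⟨b, hb⟩ : ∃ b, b = H !₂[1, 0] 1 := ⟨_, rfl⟩
  obtain ⟨d, hd⟩ : ∃ d, d = H !₂[0, 1] 1 := ⟨_, rfl⟩
  rw [← ha, ← hd] at htr
  have approx : ∀ ε : ℝ, 0 < ε → ∃ δ > 0, ∀ p q : Plane, dist p c < δ → dist q c < δ →
      ∃ e₀ e₁ : ℝ, v p 0 - v q 0 = a * (p 0 - q 0) + b * (p 1 - q 1) + e₀ ∧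
        v p 1 - v q 1 = b * (p 0 - q 0) + d * (p 1 - q 1) + e₁ ∧
        e₀ ^ 2 + e₁ ^ 2 ≤ ε ^ 2 * ((p 0 - q 0) ^ 2 + (p 1 - q 1) ^ 2) := by
    intro ε hε
    obtain ⟨s, hs, hap⟩ := hH.approximates_deriv_on_nhds (c := ⟨ε, hε.le⟩) (Or.inr hε)
    obtain ⟨δ, hδ, hδs⟩ := Metric.mem_nhds_iff.1 hs
    refine ⟨δ, hδ, fun p q hp hq => ?_⟩
    have h1 := hap p (hδs hp) q (hδs hq)
    set e := v p - v q - H (p - q) with he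
    refine ⟨e 0, e 1, ?_, ?_, ?_⟩
    · have : e 0 = v p 0 - v q 0 - H (p - q) 0 := by rw [he]; simp
      rw [this, plane_map_eq H (p - q) 0, hsymm, ← ha, ← hb]
      simp
      ring
    · have : e 1 = v p 1 - v q 1 - H (p - q) 1 := by rw [he]; simp
      rw [this, plane_map_eq H (p - q) 1, ← hb, ← hd]
      simp
      ring
    · rw [← plane_norm_sq]
      have h2 : ‖p - q‖ ^ 2 = (p 0 - q 0) ^ 2 + (p 1 - q 1) ^ 2 := by
        rw [plane_norm_sq]; simp
      rw [← h2, ← mul_pow]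
      exact pow_le_pow_left₀ (norm_nonneg _) h1 2
  have bound : ∀ δ : ℝ, ∀ p q : Plane, dist p c < δ → dist q c < δ →
      (p 0 - q 0) ^ 2 + (p 1 - q 1) ^ 2 ≤ (2 * δ) ^ 2 := by
    intro δ p q hp hq
    have h1 : ‖p - q‖ ≤ 2 * δ := by
      rw [← dist_eq_norm]
      linarith [dist_triangle_right p q c]
    have h2 : ‖p - q‖ ^ 2 = (p 0 - q 0) ^ 2 + (p 1 - q 1) ^ 2 := by
      rw [plane_norm_sq]; simp
    rw [← h2]
    exact pow_le_pow_left₀ (norm_nonneg _) h1 2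
  have pos : ∀ p q : Plane, p ≠ q → ∀ t, 0 < (φ t p 0 - φ t q 0) ^ 2 + (φ t p 1 - φ t q 1) ^ 2 := by
    intro p q hpq t
    have h2 : ‖φ t p - φ t q‖ ^ 2 = (φ t p 0 - φ t q 0) ^ 2 + (φ t p 1 - φ t q 1) ^ 2 := by
      rw [plane_norm_sq]; simp
    rw [← h2]
    have := norm_pos_iff.2 (sub_ne_zero.2 fun h => hpq (hφ.injective hv t h))
    positivity
  have hder : ∀ (p q : Plane) (t : ℝ) (k : Fin 2), HasDerivAt (fun s => φ s p k - φ s q k)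
      (v (φ t p) k - v (φ t q) k) t := fun p q t k =>
    (hasDerivAt_coord (hφ.hasDerivAt p t) k).sub (hasDerivAt_coord (hφ.hasDerivAt q t) k)
  -- Write H = βI + M with M symmetric and traceless, so M² = (m² + b²)I. For the difference w of
  -- two trajectories, the form ⟨Mw, w⟩ has derivative 2β⟨Mw, w⟩ + 2(m² + b²)|w|² plus an error.
  set β := (a + d) / 2 with hβ
  have hβ0 : 0 < β := by positivity
  set m := (a - d) / 2 with hm
  have ha' : a = β + m := by rw [hβ, hm]; ring
  have hd' : d = β - m := by rw [hβ, hm]; ring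
  rcases (show 0 ≤ m ^ 2 + b ^ 2 by positivity).eq_or_lt with hD | hD
  · have hm0 : m = 0 := by nlinarith [sq_nonneg m, sq_nonneg b]
    have hb0 : b = 0 := by nlinarith [sq_nonneg m, sq_nonneg b]
    obtain ⟨δ, hδ, hap⟩ := approx (β / 4) (by positivity)
    refine ⟨δ, hδ, 0, fun p q hp hq _ => ?_⟩
    by_contra hpq
    refine not_bounded_of_deriv_ge (q := fun t => (φ t p 0 - φ t q 0) ^ 2 +
      (φ t p 1 - φ t q 1) ^ 2) (q' := _)
      (m := fun t => β / 4 * ((φ t p 0 - φ t q 0) ^ 2 + (φ t p 1 - φ t q 1) ^ 2))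
      hβ0 (fun t ht => ((hder p q t 0).pow 2).add ((hder p q t 1).pow 2))
      (fun t ht => mul_pos (by positivity) (pos p q hpq t)) (fun t ht => ?_) (by positivity)
      (fun t ht => bound δ _ _ (hp t ht) (hq t ht))
    obtain ⟨e₀, e₁, h0, h1, he⟩ := hap _ _ (hp t ht) (hq t ht)
    simp only [h0, h1, ha', hd', hm0, hb0]
    generalize φ t p 0 - φ t q 0 = w₀ at *
    generalize φ t p 1 - φ t q 1 = w₁ at *
    have h2 : -(β / 4) * (w₀ ^ 2 + w₁ ^ 2) ≤ w₀ * e₀ + w₁ * e₁ := by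
      have h3 : 0 ≤ (β * w₀ + 4 * e₀) ^ 2 + (β * w₁ + 4 * e₁) ^ 2 := by positivity
      have h4 : 0 ≤ β * (w₀ * e₀ + w₁ * e₁ + β / 4 * (w₀ ^ 2 + w₁ ^ 2)) := by nlinarith
      have := nonneg_of_mul_nonneg_right h4 hβ0
      linarith
    have h5 : 0 ≤ β * (w₀ ^ 2 + w₁ ^ 2) := by positivity
    norm_num
    linarith
  -- This tolerance is half the operator norm of M, so the error consumes at most half of the gain
  -- 2(m² + b²)|w|².
  · obtain ⟨δ, hδ, hap⟩ := approx (Real.sqrt (m ^ 2 + b ^ 2) / 2) (by positivity)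
    -- The diagonal entries of M are m and -m, so the form is nonnegative on one of the coordinate
    -- axes.
    obtain ⟨k, hk⟩ : ∃ k : Fin 2, ∀ w : Fin 2 → ℝ, w k = 0 →
        0 ≤ m * w 0 ^ 2 + 2 * b * (w 0 * w 1) - m * w 1 ^ 2 := by
      rcases le_total 0 m with h | h
      · refine ⟨1, fun w hw => ?_⟩
        rw [hw]
        have := mul_nonneg h (sq_nonneg (w 0))
        linarith
      · refine ⟨0, fun w hw => ?_⟩
        rw [hw]
        have := mul_nonneg (neg_nonneg.2 h) (sq_nonneg (w 1))
        linarith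
    refine ⟨δ, hδ, k, fun p q hp hq hpk => ?_⟩
    by_contra hpq
    refine not_bounded_of_deriv_ge (q := fun t => m * (φ t p 0 - φ t q 0) ^ 2 +
      2 * b * ((φ t p 0 - φ t q 0) * (φ t p 1 - φ t q 1)) - m * (φ t p 1 - φ t q 1) ^ 2) (q' := _)
      (m := fun t => (m ^ 2 + b ^ 2) * ((φ t p 0 - φ t q 0) ^ 2 + (φ t p 1 - φ t q 1) ^ 2))
      (B := (|m| + |b|) * (2 * δ) ^ 2) (β := 2 * β)
      (by positivity) (fun t ht => ((((hder p q t 0).pow 2).const_mul m).add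
        (((hder p q t 0).mul (hder p q t 1)).const_mul (2 * b))).sub
        (((hder p q t 1).pow 2).const_mul m))
      (fun t ht => mul_pos hD (pos p q hpq t)) (fun t ht => ?_) ?_
      (fun t ht => ?_)
    · obtain ⟨e₀, e₁, h0, h1, he⟩ := hap _ _ (hp t ht) (hq t ht)
      simp only [h0, h1, ha', hd']
      generalize φ t p 0 - φ t q 0 = w₀ at *
      generalize φ t p 1 - φ t q 1 = w₁ at *
      rw [div_pow, Real.sq_sqrt hD.le] at he
      have h3 : 0 ≤ ((m * w₀ + b * w₁) + 2 * e₀) ^ 2 + ((b * w₀ - m * w₁) + 2 * e₁) ^ 2 := by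
        positivity
      norm_num
      nlinarith
    · have := hk (fun j => p j - q j) (by simp [hpk])
      simpa [hφ.zero] using this
    · have h1 := bound δ _ _ (hp t ht) (hq t ht)
      generalize φ t p 0 - φ t q 0 = w₀ at *
      generalize φ t p 1 - φ t q 1 = w₁ at *
      have h2 : m * (w₀ ^ 2 - w₁ ^ 2) ≤ |m| * (w₀ ^ 2 + w₁ ^ 2) := by
        have h3 := le_abs_self m
        have h4 := neg_abs_le m
        nlinarith [mul_nonneg (sub_nonneg.2 h3) (sq_nonneg w₀),
          mul_nonneg (show 0 ≤ |m| + m by linarith) (sq_nonneg w₁)]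
      have h3 : 2 * b * (w₀ * w₁) ≤ |b| * (w₀ ^ 2 + w₁ ^ 2) := by
        have h3 := le_abs_self b
        have h4 := neg_abs_le b
        nlinarith [mul_nonneg (sub_nonneg.2 h3) (sq_nonneg (w₀ + w₁)),
          mul_nonneg (show 0 ≤ |b| + b by linarith) (sq_nonneg (w₀ - w₁))]
      have h4 : (|m| + |b|) * (w₀ ^ 2 + w₁ ^ 2) ≤ (|m| + |b|) * (2 * δ) ^ 2 := by gcongr
      linarith

variable {n : ℕ} {α : ℝ} {x : Fin n → Plane} {φ : ℝ → Plane → Plane} {K : ℝ≥0}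

/-- Two trajectories converging to c from the same side in coordinate k take a common value of that
coordinate near c, by the intermediate value theorem. They then pass through the same point and so
start at the same point of the circle. Thus at most two starting points exist. -/
theorem finite_stable_circle_of_pos (hn : 1 ≤ n) (hα : 0 < α) (hv : LipschitzWith K (field α x))
    (hφ : IsFlow (field α x) φ) {r : ℝ} (hr : ∀ i, ‖x i‖ < r) {c : Plane}
    (hc : c ∈ criticalPoints α x) (hcd : ∀ i, 1 ≤ dist c (x i)) :
    {p : Plane | ‖p‖ = r ∧ Tendsto (fun t => φ t p) atTop (𝓝 c)}.Finite := by
  obtain ⟨H, hH, hs, ht⟩ := exists_hasStrictFDerivAt_field (α := α) hn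
    (fun i => (by linarith [hcd i] : 1 / 2 < dist c (x i)))
  obtain ⟨δ, hδ, k, hinj⟩ := exists_coord_injOn_stableSet hv hφ hH hs (ht hα)
  have hc0 : field α x c = 0 := by
    rw [← gradient_energy fun i => by linarith [hcd i]]
    exact hc.2
  have hcfix : ∀ t, φ t c = c := by
    intro t
    refine congrFun (global_solution_unique (f := fun _ => field α x) (fun _ => hv)
      (hφ.hasDerivAt c) (γ₂ := fun _ => c) (fun t => ?_) (t₀ := 0) (hφ.zero c)) t
    rw [hc0]
    exact hasDerivAt_const t c
  set A := {p : Plane | ‖p‖ = r ∧ Tendsto (fun t => φ t p) atTop (𝓝 c)}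
  have hτ : ∀ p : Plane, ∃ τ, p ∈ A → ∀ t, τ ≤ t → dist (φ t p) c < δ := by
    intro p
    by_cases hp : p ∈ A
    · obtain ⟨τ, h⟩ := Metric.tendsto_atTop.1 hp.2 δ hδ
      exact ⟨τ, fun _ t ht => h t ht⟩
    · exact ⟨0, fun h => absurd h hp⟩
  choose τ hτ using hτ
  have hstay : ∀ p ∈ A, ∀ t, τ p ≤ t → ∀ s, 0 ≤ s → dist (φ s (φ t p)) c < δ := by
    intro p hp t ht s hs
    rw [← hφ.add hv]
    exact hτ p hp _ (by linarith)
  -- Equality would put the trajectory at c itself, forcing p = c; but no point of the circle is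
  -- critical.
  have hne : ∀ p ∈ A, φ (τ p) p k - c k ≠ 0 := by
    intro p hp h
    have h1 : φ (τ p) p = c := hinj _ _ (hstay p hp _ le_rfl)
      (fun t _ => by rw [hcfix, dist_self]; exact hδ) (sub_eq_zero.1 h)
    have h2 : p = c := by
      rw [← hφ.neg_apply hv (τ p) p, h1, hcfix]
    have h3 := inner_field_neg (x := x) hn hα.le (y := p) (by rw [hp.1]; exact hr)
    rw [h2, hc0, inner_zero_right] at h3
    exact lt_irrefl _ h3
  have key : ∀ s : ℝ, ∀ p ∈ A, ∀ q ∈ A, 0 < s * (φ (τ p) p k - c k) →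
      s * (φ (τ p) p k - c k) ≤ s * (φ (τ q) q k - c k) → p = q := by
    intro s p hp q hq h0 hle
    have hcont : Continuous fun t => s * (φ t q k - c k) := by
      have h1 : Continuous fun t => φ t q := hφ.continuous_time q
      have h2 : Continuous fun t => φ t q k :=
        (EuclideanSpace.proj (𝕜 := ℝ) k).continuous.comp h1
      fun_prop
    have hlim : Tendsto (fun t => s * (φ t q k - c k)) atTop (𝓝 0) := by
      have h2 : Tendsto (fun t => φ t q k) atTop (𝓝 (c k)) :=
        ((EuclideanSpace.proj (𝕜 := ℝ) k).continuous.tendsto c).comp hq.2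
      simpa using (h2.sub_const (c k)).const_mul s
    obtain ⟨t, ht, htq⟩ :=
      ((hlim.eventually_lt_const h0).and (eventually_ge_atTop (τ q))).exists
    obtain ⟨u, hu, hue⟩ := intermediate_value_Icc' htq hcont.continuousOn ⟨ht.le, hle⟩
    have hs : s ≠ 0 := by
      rintro rfl
      simp at h0
    have h1 : φ u q k = φ (τ p) p k := by
      have := mul_left_cancel₀ hs hue
      linarith
    have h2 := hinj _ _ (hstay q hq u hu.1) (hstay p hp _ le_rfl) h1
    exact (eq_of_flow_eq hn hα.le hv hφ (by rw [hq.1, hp.1]) (by rw [hq.1]; exact hr) h2).symm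
  refine Set.Finite.of_finite_image (f := fun p => decide (0 < φ (τ p) p k - c k))
    (Set.toFinite _) ?_
  intro p hp q hq hpq
  simp only [decide_eq_decide] at hpq
  have := hne p hp
  have := hne q hq
  by_cases h : 0 < φ (τ p) p k - c k
  · have h' := hpq.1 h
    rcases le_total (φ (τ p) p k - c k) (φ (τ q) q k - c k) with hle | hle
    · exact key 1 p hp q hq (by linarith) (by linarith)
    · exact (key 1 q hq p hp (by linarith) (by linarith)).symm
  · have h' := fun h2 => h (hpq.2 h2)
    have h1 : φ (τ p) p k - c k < 0 := lt_of_le_of_ne (not_lt.1 h) (hne p hp)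
    have h2 : φ (τ q) q k - c k < 0 := lt_of_le_of_ne (not_lt.1 h') (hne q hq)
    rcases le_total (φ (τ p) p k - c k) (φ (τ q) q k - c k) with hle | hle
    · exact (key (-1) q hq p hp (by linarith) (by linarith)).symm
    · exact key (-1) p hp q hq (by linarith) (by linarith)

end StableSet

end GFA

end

noncomputable section

namespace GFA

open Set Filter Topology
open scoped NNReal ComplexConjugate

/-! ### The logarithmic case in complex notation -/

section Logarithmic

/-- The identification of the plane with the complex numbers. -/
def toComplex : Plane ≃ₗᵢ[ℝ] ℂ := Complex.orthonormalBasisOneI.repr.symm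

theorem toComplex_apply (y : Plane) : toComplex y = y 0 + y 1 * Complex.I := by
  rw [toComplex, ← OrthonormalBasis.sum_repr_symm]
  simp

theorem toComplex_circlePoint (r θ : ℝ) :
    toComplex (circlePoint r θ) = r * Complex.exp (θ * Complex.I) := by
  rw [toComplex_apply, circlePoint, Complex.exp_mul_I]
  simp
  ring

theorem toComplex_field_zero {n : ℕ} {x : Fin n → Plane} {y : Plane}
    (hy : ∀ i, 1 / 2 ≤ dist y (x i)) :
    toComplex (field 0 x y) = -conj (∑ i, (toComplex y - toComplex (x i))⁻¹) := by
  simp only [field, map_neg, map_sum, strength, if_true, one_smul]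
  congr 1
  refine Finset.sum_congr rfl fun i _ => ?_
  rw [kernel_eq (by rw [← dist_eq_norm]; exact hy i), map_smul, Complex.inv_def, map_mul,
    Complex.conj_conj, Complex.conj_ofReal, Complex.real_smul, mul_comm, map_sub]
  congr 2
  rw [Complex.normSq_eq_norm_sq, ← map_sub, LinearIsometryEquiv.norm_map, zero_add,
    Real.rpow_neg (norm_nonneg _), Real.rpow_two]

variable {n : ℕ} {x : Fin n → Plane} {φ : ℝ → Plane → Plane} {K : ℝ≥0}

/-- The polynomial with the particles as roots. -/
def particlePoly (x : Fin n → Plane) (y : Plane) : ℂ := ∏ i, (toComplex y - toComplex (x i))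

theorem continuous_particlePoly : Continuous (particlePoly x) :=
  continuous_finsetProd _ fun _ _ => toComplex.continuous.sub continuous_const

theorem hasDerivAt_particlePoly_flow (hφ : IsFlow (field 0 x) φ) {p : Plane} {t : ℝ}
    (h : ∀ i, 1 / 2 ≤ dist (φ t p) (x i)) :
    HasDerivAt (fun s => particlePoly x (φ s p))
      (-((‖field 0 x (φ t p)‖ ^ 2 : ℝ) : ℂ) * particlePoly x (φ t p)) t := by
  have hne : ∀ i, toComplex (φ t p) - toComplex (x i) ≠ 0 := by
    intro i h0
    have := h i
    rw [toComplex.injective (sub_eq_zero.1 h0), dist_self] at this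
    norm_num at this
  have hz : HasDerivAt (fun s => toComplex (φ s p)) (toComplex (field 0 x (φ t p))) t :=
    (toComplex.toContinuousLinearEquiv : Plane →L[ℝ] ℂ).hasFDerivAt.comp_hasDerivAt t
      (hφ.hasDerivAt p t)
  have h1 := HasDerivAt.fun_finsetProd (u := Finset.univ)
    (f := fun i s => toComplex (φ s p) - toComplex (x i)) (x := t)
    fun i _ => hz.sub_const (toComplex (x i))
  refine h1.congr_deriv ?_
  have e : ∀ i, (∏ j ∈ Finset.univ.erase i, (toComplex (φ t p) - toComplex (x j))) =
      particlePoly x (φ t p) * (toComplex (φ t p) - toComplex (x i))⁻¹ := by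
    intro i
    rw [particlePoly, ← Finset.mul_prod_erase _ _ (Finset.mem_univ i)]
    field_simp [hne i]
  simp only [e, smul_eq_mul]
  rw [← Finset.sum_mul, ← Finset.mul_sum]
  have h2 := toComplex_field_zero h
  rw [← LinearIsometryEquiv.norm_map toComplex, h2, norm_neg, Complex.norm_conj,
    ← Complex.normSq_eq_norm_sq, ← Complex.mul_conj]
  ring

/-- Along logarithmic gradient ascent the argument of the particle polynomial is preserved. -/
theorem im_particlePoly_eq_zero (hφ : IsFlow (field 0 x) φ) {p c : Plane}
    (hdist : ∀ t, 0 ≤ t → ∀ j, 1 < dist (φ t p) (x j)) (hc : ∀ j, 1 ≤ dist c (x j))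
    (hlim : Tendsto (fun t => φ t p) atTop (𝓝 c)) :
    (particlePoly x p * conj (particlePoly x c)).im = 0 := by
  have hhalf : ∀ t, 0 ≤ t → ∀ j, 1 / 2 ≤ dist (φ t p) (x j) := fun t ht j => by
    linarith [hdist t ht j]
  -- With P the particle polynomial, exp(E) = 1/|P|, so this product is P/|P|; the derivatives of
  -- its two factors cancel.
  have hd : ∀ t, 0 ≤ t → HasDerivAt (fun s => ((Real.exp (energy 0 x (φ s p)) : ℝ) : ℂ) *
      particlePoly x (φ s p)) 0 t := by
    intro t ht
    have h1 := ((hasDerivAt_energy_flow hφ (hhalf t ht)).exp.ofReal_comp).mul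
      (hasDerivAt_particlePoly_flow hφ (hhalf t ht))
    refine h1.congr_deriv ?_
    push_cast
    ring
  have hconst : ∀ t, 0 ≤ t → ((Real.exp (energy 0 x (φ t p)) : ℝ) : ℂ) * particlePoly x (φ t p) =
      ((Real.exp (energy 0 x p) : ℝ) : ℂ) * particlePoly x p := by
    intro t ht
    have := constant_of_has_deriv_right_zero (a := 0) (b := t)
      (fun s hs => (hd s hs.1).continuousAt.continuousWithinAt)
      (fun s hs => (hd s hs.1).hasDerivWithinAt) t ⟨ht, le_rfl⟩
    simpa [hφ.zero] using this
  have hEc : ContinuousAt (energy 0 x) c := (hasGradientAt_iff_hasFDerivAt.1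
    (hasGradientAt_energy (x := x) fun i => by linarith [hc i])).continuousAt
  have hl : Tendsto (fun t => ((Real.exp (energy 0 x (φ t p)) : ℝ) : ℂ) *
      particlePoly x (φ t p)) atTop
      (𝓝 (((Real.exp (energy 0 x c) : ℝ) : ℂ) * particlePoly x c)) := by
    have h1 : ContinuousAt (fun y => ((Real.exp (energy 0 x y) : ℝ) : ℂ) * particlePoly x y) c :=
      (Complex.continuous_ofReal.continuousAt.comp (Real.continuous_exp.continuousAt.comp hEc)).mul
        continuous_particlePoly.continuousAt
    exact h1.tendsto.comp hlim
  have heq := tendsto_nhds_unique (hl.congr' (by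
    filter_upwards [eventually_ge_atTop 0] with t ht using hconst t ht)) tendsto_const_nhds
  have hE : ((Real.exp (energy 0 x p) : ℝ) : ℂ) ≠ 0 := by
    exact_mod_cast (Real.exp_pos _).ne'
  have h2 : particlePoly x p = ((Real.exp (energy 0 x c) / Real.exp (energy 0 x p) : ℝ) : ℂ) *
      particlePoly x c := by
    push_cast
    field_simp
    push_cast at heq
    rw [heq]
    ring
  rw [h2, mul_assoc, Complex.mul_conj, ← Complex.ofReal_mul]
  exact Complex.ofReal_im _

-- On the circle conj z = r²/z, so multiplying the reality condition by z^n turns it into a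
-- polynomial equation in z. It is nontrivial because its constant term is -W r^(2n).
open Polynomial in
theorem finite_circle_im_particlePoly (hn : 1 ≤ n) {r : ℝ} (hr : 0 < r) {W : ℂ} (hW : W ≠ 0) :
    {p : Plane | ‖p‖ = r ∧ (particlePoly x p * conj W).im = 0}.Finite := by
  set R : ℂ[X] := C (conj W) * X ^ n * ∏ i, (X - C (toComplex (x i))) -
    C W * ∏ i, (C ((r : ℂ) ^ 2) - C (conj (toComplex (x i))) * X) with hR
  have hR0 : R ≠ 0 := by
    intro h
    have h1 : R.eval 0 = 0 := by rw [h, eval_zero]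
    have hn0 : n ≠ 0 := by omega
    simp [hR, eval_prod, hn0, hW, hr.ne'] at h1
  refine Set.Finite.of_finite_image (f := toComplex)
    ((Polynomial.finite_setOfPred_isRoot hR0).subset ?_) toComplex.injective.injOn
  rintro _ ⟨p, ⟨hp, him⟩, rfl⟩
  set z := toComplex p with hz
  have hzz : z * conj z = (r : ℂ) ^ 2 := by
    rw [Complex.mul_conj, Complex.normSq_eq_norm_sq, hz, LinearIsometryEquiv.norm_map, hp]
    push_cast
    rfl
  have hc : particlePoly x p * conj W = conj (particlePoly x p) * W := by
    have h1 := Complex.conj_eq_iff_im.2 him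
    rw [map_mul, Complex.conj_conj] at h1
    exact h1.symm
  have h2 : ∏ i, ((r : ℂ) ^ 2 - conj (toComplex (x i)) * z) = z ^ n * conj (particlePoly x p) := by
    have : z ^ n = ∏ _i : Fin n, z := by simp
    rw [this, particlePoly, map_prod, ← Finset.prod_mul_distrib]
    refine Finset.prod_congr rfl fun i _ => ?_
    rw [map_sub, ← hzz]
    ring
  show R.eval z = 0
  simp only [hR, eval_sub, eval_mul, eval_prod, eval_C, eval_X, eval_pow]
  rw [h2]
  have h3 : ∏ i, (z - toComplex (x i)) = particlePoly x p := rfl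
  rw [h3]
  linear_combination z ^ n * hc

end Logarithmic

/-! ### Finiteness of the exceptional starting points -/

section NonAttaching

variable {n : ℕ} {α : ℝ} {x : Fin n → Plane} {φ : ℝ → Plane → Plane} {K : ℝ≥0}

theorem pos_of_norm_add_one_lt (hn : 1 ≤ n) {r : ℝ} (hr : ∀ i, ‖x i‖ + 1 < r) : 0 < r := by
  have := hr ⟨0, hn⟩
  linarith [norm_nonneg (x ⟨0, hn⟩)]

/-- All but finitely many points of a large circle attach to some particle. -/
theorem finite_nonattaching (hn : 1 ≤ n) (hα : 0 ≤ α) (hP : PropertyP α x) {r : ℝ}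
    (hr : ∀ i, ‖x i‖ + 1 < r) : {p : Plane | ‖p‖ = r ∧ ∀ i, ¬ AttachesTo α x i p}.Finite := by
  obtain ⟨K, hv⟩ := lipschitz_field (x := x) hα
  obtain ⟨L, hL⟩ := bounded_field (x := x) hα
  obtain ⟨φ, hφ⟩ := exists_isFlow hv hL
  have hr' : ∀ i, ‖x i‖ < r := fun i => by linarith [hr i]
  have hr0 := pos_of_norm_add_one_lt hn hr
  have hfin : ∀ c ∈ criticalPoints α x, {p : Plane | ‖p‖ = r ∧ (∀ i, ¬ AttachesTo α x i p) ∧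
      (∀ i, 1 ≤ dist c (x i)) ∧ Tendsto (fun t => φ t p) atTop (𝓝 c)}.Finite := by
    intro c hc
    rcases hα.eq_or_lt with rfl | hα0
    · by_cases hW : particlePoly x c = 0
      · refine Set.finite_empty.subset ?_
        rintro p ⟨-, -, h, -⟩
        obtain ⟨i, -, hi⟩ := Finset.prod_eq_zero_iff.1 hW
        exact absurd (toComplex.injective (sub_eq_zero.1 hi)) (hc.1 i)
      · refine (finite_circle_im_particlePoly (x := x) hn hr0 hW).subset ?_
        rintro p ⟨hp, hna, hcd, hlim⟩
        exact ⟨hp, im_particlePoly_eq_zero hφ (fun t ht j => one_lt_dist_of_not_attachesTo hv hφ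
          (one_lt_dist_of_norm hr hp) hna ht j) hcd hlim⟩
    · by_cases hcd : ∀ i, 1 ≤ dist c (x i)
      · refine (finite_stable_circle_of_pos hn hα0 hv hφ hr' hc hcd).subset ?_
        rintro p ⟨hp, -, -, hlim⟩
        exact ⟨hp, hlim⟩
      · refine Set.finite_empty.subset ?_
        rintro p ⟨-, -, h, -⟩
        exact absurd h hcd
  refine (hP.biUnion hfin).subset ?_
  rintro p ⟨hp, hna⟩
  obtain ⟨c, hc, hcd, hlim⟩ := exists_tendsto_criticalPoint hα hP hv hφ
    (fun t ht j => one_lt_dist_of_not_attachesTo hv hφ (one_lt_dist_of_norm hr hp) hna ht j)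
    (fun t ht => norm_flow_le hn hα hφ (by rw [hp]; exact hr') ht)
  exact mem_biUnion hc ⟨hp, hna, hcd, hlim⟩

/-- Only finitely many points of a large circle attach to two given particles at once. -/
theorem finite_doubly_attaching (hn : 1 ≤ n) (hα : 0 ≤ α) (hx : Function.Injective x) {r : ℝ}
    (hr : ∀ i, ‖x i‖ + 1 < r) {i j : Fin n} (hij : i ≠ j) :
    {p : Plane | ‖p‖ = r ∧ AttachesTo α x i p ∧ AttachesTo α x j p}.Finite := by
  obtain ⟨K, hv⟩ := lipschitz_field (x := x) hα
  obtain ⟨L, hL⟩ := bounded_field (x := x) hα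
  obtain ⟨φ, hφ⟩ := exists_isFlow hv hL
  have hr' : ∀ i, ‖x i‖ < r := fun i => by linarith [hr i]
  set A := {p : Plane | ‖p‖ = r ∧ AttachesTo α x i p ∧ AttachesTo α x j p}
  have hit : ∀ p : Plane, ∃ T, p ∈ A → dist (φ T p) (x i) = 1 ∧ dist (φ T p) (x j) = 1 := by
    intro p
    by_cases hp : p ∈ A
    · obtain ⟨T, hT, h1, h2⟩ := (attachesTo_iff hv hφ).1 hp.2.1
      obtain ⟨S, hS, h3, h4⟩ := (attachesTo_iff hv hφ).1 hp.2.2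
      -- Before either hitting time all distances exceed 1, so neither hit can precede the other.
      have : S = T := by
        rcases lt_trichotomy S T with h | h | h
        · exact absurd (h1 S ⟨hS, h⟩ j) (by rw [h4]; exact lt_irrefl _)
        · exact h
        · exact absurd (h3 T ⟨hT, h⟩ i) (by rw [h2]; exact lt_irrefl _)
      subst this
      exact ⟨S, fun _ => ⟨h2, h4⟩⟩
    · exact ⟨0, fun h => absurd h hp⟩
  choose T hT using hit
  have hcirc : {y : Plane | dist y (x i) = 1 ∧ dist y (x j) = 1}.Finite := by
    by_contra hinf
    obtain ⟨s, hs, hcard⟩ := Set.Infinite.exists_subset_card_eq hinf 3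
    obtain ⟨a, b, c, hab, hac, hbc, rfl⟩ := Finset.card_eq_three.1 hcard
    have ha := hs (show a ∈ _ by simp)
    have hb := hs (show b ∈ _ by simp)
    have hc := hs (show c ∈ _ by simp)
    have hd : Module.finrank ℝ Plane = 2 := by simp
    rcases EuclideanGeometry.eq_of_dist_eq_of_dist_eq_of_finrank_eq_two hd (hx.ne hij) hab
      ha.1 hb.1 hc.1 ha.2 hb.2 hc.2 with h | h
    · exact hac h.symm
    · exact hbc h.symm
  refine Set.Finite.of_finite_image (f := fun p => φ (T p) p) (hcirc.subset ?_) ?_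
  · rintro _ ⟨p, hp, rfl⟩
    exact hT p hp
  · intro p hp q hq h
    exact eq_of_flow_eq hn hα hv hφ (by rw [hp.1, hq.1]) (by rw [hp.1]; exact hr') h

end NonAttaching

end GFA

end

noncomputable section

namespace GFA

open Set Filter Topology MeasureTheory
open scoped NNReal

/-! ### Angular parametrization of circles -/

section Circle

theorem circlePoint_zero_coord (r θ : ℝ) : circlePoint r θ 0 = r * Real.cos θ := rfl

theorem circlePoint_one_coord (r θ : ℝ) : circlePoint r θ 1 = r * Real.sin θ := rfl

theorem norm_circlePoint {r : ℝ} (hr : 0 ≤ r) (θ : ℝ) : ‖circlePoint r θ‖ = r := by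
  rw [← sq_eq_sq₀ (norm_nonneg _) hr, plane_norm_sq, circlePoint_zero_coord, circlePoint_one_coord]
  linear_combination r ^ 2 * Real.sin_sq_add_cos_sq θ

theorem continuous_circlePoint (r : ℝ) : Continuous (circlePoint r) := by
  refine (PiLp.continuous_toLp 2 _).comp (continuous_pi fun k => ?_)
  fin_cases k
  · exact continuous_const.mul Real.continuous_cos
  · exact continuous_const.mul Real.continuous_sin

theorem circlePoint_add_two_pi (r θ : ℝ) : circlePoint r (θ + 2 * Real.pi) = circlePoint r θ := by
  simp [circlePoint]

theorem circlePoint_periodic (r : ℝ) : Function.Periodic (circlePoint r) (2 * Real.pi) :=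
  circlePoint_add_two_pi r

theorem angle_eq_of_circlePoint_eq {r : ℝ} (hr : 0 < r) {θ ψ : ℝ}
    (h : circlePoint r θ = circlePoint r ψ) : (θ : Real.Angle) = ψ := by
  refine Real.Angle.cos_sin_inj (mul_left_cancel₀ hr.ne' ?_) (mul_left_cancel₀ hr.ne' ?_)
  · rw [← circlePoint_zero_coord, h, circlePoint_zero_coord]
  · rw [← circlePoint_one_coord, h, circlePoint_one_coord]

theorem circlePoint_injOn {r : ℝ} (hr : 0 < r) (a : ℝ) :
    InjOn (circlePoint r) (Ico a (a + 2 * Real.pi)) := by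
  intro θ hθ ψ hψ h
  obtain ⟨k, hk⟩ := Real.Angle.angle_eq_iff_two_pi_dvd_sub.1 (angle_eq_of_circlePoint_eq hr h)
  have hpi := Real.pi_pos
  have h1 : (k : ℝ) < 1 := by
    by_contra hc
    rw [not_lt] at hc
    nlinarith [hθ.1, hθ.2, hψ.1, hψ.2]
  have h2 : (-1 : ℝ) < k := by
    by_contra hc
    rw [not_lt] at hc
    nlinarith [hθ.1, hθ.2, hψ.1, hψ.2]
  have h3 : k = 0 := by
    have h1' : k < 1 := by exact_mod_cast h1
    have h2' : -1 < k := by exact_mod_cast h2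
    omega
  rw [h3] at hk
  simp at hk
  linarith

theorem exists_circlePoint_eq {r : ℝ} {p : Plane} (hp : ‖p‖ = r) (a : ℝ) :
    ∃ θ ∈ Ico a (a + 2 * Real.pi), circlePoint r θ = p := by
  refine ⟨toIcoMod Real.two_pi_pos a (Complex.arg (toComplex p)), toIcoMod_mem_Ico _ _ _, ?_⟩
  rw [toIcoMod, (circlePoint_periodic r).sub_zsmul_eq]
  apply toComplex.injective
  rw [toComplex_circlePoint, ← hp, ← LinearIsometryEquiv.norm_map toComplex]
  exact Complex.norm_mul_exp_arg_mul_I _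

end Circle

/-! ### Measurability and total probability -/

section Measurability

variable {n : ℕ} {α : ℝ} {x : Fin n → Plane} {φ : ℝ → Plane → Plane} {K : ℝ≥0}

/-- Expresses "x_i is hit no later than any other particle" by countably many conditions on closed
reach sets. Rational deadlines suffice: if another particle were hit first, at time T with x_i still
farther than 1, a rational slightly above T would violate the condition. -/
theorem attachesTo_iff_reach (hv : LipschitzWith K (field α x)) (hφ : IsFlow (field α x) φ)
    {i : Fin n} {p : Plane} (hp : ∀ j, 1 < dist p (x j)) :
    AttachesTo α x i p ↔ (∃ N : ℕ, ∃ s ∈ Icc (0 : ℝ) N, φ s p ∈ Metric.closedBall (x i) 1) ∧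
      ∀ (j : Fin n) (q : ℚ), (∃ s ∈ Icc (0 : ℝ) q, φ s p ∈ Metric.closedBall (x j) 1) →
        ∃ s ∈ Icc (0 : ℝ) q, φ s p ∈ Metric.closedBall (x i) 1 := by
  rw [attachesTo_iff hv hφ]
  constructor
  · rintro ⟨T, hT, hlt, hi⟩
    refine ⟨⟨⌈T⌉₊, T, ⟨hT, Nat.le_ceil T⟩, hi.le⟩, ?_⟩
    rintro j q ⟨s, hs, hsj⟩
    refine ⟨T, ⟨hT, ?_⟩, hi.le⟩
    by_contra hcon
    exact absurd (hlt s ⟨hs.1, hs.2.trans_lt (not_le.1 hcon)⟩ j) (not_lt.2 hsj)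
  · rintro ⟨⟨N, s, hs, hsi⟩, hq⟩
    obtain ⟨T, j, hT, -, hlt, hj⟩ := exists_first_hit hφ hp hs.1 hsi
    refine ⟨T, hT.le, hlt, ?_⟩
    have hge : 1 ≤ dist (φ T p) (x i) := one_le_dist_of_Ico hT (hφ.continuous_time p).continuousOn
      (fun t ht => hlt t ht i) T ⟨hT.le, le_rfl⟩
    refine le_antisymm ?_ hge
    by_contra hcon
    rw [not_le] at hcon
    have hc : Continuous fun t => dist (φ t p) (x i) :=
      (hφ.continuous_time p).dist continuous_const
    obtain ⟨ε, hε, hball⟩ := Metric.mem_nhds_iff.1 ((isOpen_lt continuous_const hc).mem_nhds hcon)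
    obtain ⟨q, hTq, hqε⟩ := exists_rat_btwn (show T < T + ε by linarith)
    obtain ⟨u, hu, hui⟩ := hq j q ⟨T, ⟨hT.le, hTq.le⟩, hj.le⟩
    have huT : T ≤ u := by
      by_contra h
      exact absurd (hlt u ⟨hu.1, not_le.1 h⟩ i) (not_lt.2 hui)
    have hmem : u ∈ Metric.ball T ε := by
      rw [Metric.mem_ball, Real.dist_eq, abs_lt]
      constructor <;> linarith [hu.2]
    have h1 : 1 < dist (φ u p) (x i) := hball hmem
    exact absurd (Metric.mem_closedBall.1 hui) (not_le.2 h1)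

theorem measurableSet_attaching_angle (hn : 1 ≤ n) (hα : 0 ≤ α) {r : ℝ}
    (hr : ∀ i, ‖x i‖ + 1 < r) (i : Fin n) :
    MeasurableSet {θ | AttachesTo α x i (circlePoint r θ)} := by
  obtain ⟨K, hv⟩ := lipschitz_field (x := x) hα
  obtain ⟨L, hL⟩ := bounded_field (x := x) hα
  obtain ⟨φ, hφ⟩ := exists_isFlow hv hL
  have hr0 := pos_of_norm_add_one_lt hn hr
  set R : Fin n → ℝ → Set Plane := fun j T =>
    {p | ∃ s ∈ Icc (0 : ℝ) T, φ s p ∈ Metric.closedBall (x j) 1} with hR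
  have hRm : ∀ j T, MeasurableSet (R j T) := fun j T =>
    (hφ.isClosed_reach hv Metric.isClosed_closedBall T).measurableSet
  have hM : MeasurableSet ((⋃ N : ℕ, R i N) ∩ ⋂ (j : Fin n), ⋂ (q : ℚ), ((R j q)ᶜ ∪ R i q)) :=
    (MeasurableSet.iUnion fun N : ℕ => hRm i N).inter (MeasurableSet.iInter fun j =>
      MeasurableSet.iInter fun q : ℚ => (hRm j q).compl.union (hRm i q))
  convert (continuous_circlePoint r).measurable hM using 1
  ext θ
  have hp : ∀ j, 1 < dist (circlePoint r θ) (x j) :=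
    one_lt_dist_of_norm hr (norm_circlePoint hr0.le θ)
  simp only [mem_preimage, mem_inter_iff, mem_iUnion, mem_iInter, mem_union, mem_compl_iff,
    ← imp_iff_not_or]
  exact attachesTo_iff_reach hv hφ hp

theorem attachingAngles_eq (i : Fin n) (r : ℝ) : attachingAngles α x i r =
    {θ | AttachesTo α x i (circlePoint r θ)} ∩ Ico 0 (2 * Real.pi) := by
  ext θ
  exact and_comm

theorem measurableSet_attachingAngles (hn : 1 ≤ n) (hα : 0 ≤ α) {r : ℝ}
    (hr : ∀ i, ‖x i‖ + 1 < r) (i : Fin n) : MeasurableSet (attachingAngles α x i r) := by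
  rw [attachingAngles_eq]
  exact (measurableSet_attaching_angle hn hα hr i).inter measurableSet_Ico

theorem finite_angles_of_finite_circle {r : ℝ} (hr : 0 < r) {P : Plane → Prop}
    (h : {p : Plane | ‖p‖ = r ∧ P p}.Finite) :
    {θ | θ ∈ Ico 0 (2 * Real.pi) ∧ P (circlePoint r θ)}.Finite := by
  refine Set.Finite.of_finite_image (f := circlePoint r) (h.subset ?_) ?_
  · rintro _ ⟨θ, hθ, rfl⟩
    exact ⟨norm_circlePoint hr.le θ, hθ.2⟩
  · refine (circlePoint_injOn hr 0).mono fun θ hθ => ?_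
    rw [zero_add]
    exact hθ.1

theorem sum_attachProb (hn : 1 ≤ n) (hα : 0 ≤ α) (hx : Function.Injective x)
    (hP : PropertyP α x) {r : ℝ} (hr : ∀ i, ‖x i‖ + 1 < r) : ∑ i, attachProb α x i r = 1 := by
  have hr0 := pos_of_norm_add_one_lt hn hr
  have hfin : ∀ i, volume (attachingAngles α x i r) ≠ ⊤ := fun i =>
    ne_top_of_le_ne_top measure_Ico_lt_top.ne (measure_mono (fun θ hθ => hθ.1 :
      attachingAngles α x i r ⊆ Ico 0 (2 * Real.pi)))
  have hdisj : Pairwise (Function.onFun (AEDisjoint volume) fun i => attachingAngles α x i r) := by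
    intro i j hij
    refine Set.Finite.measure_zero (Set.Finite.subset
      (finite_angles_of_finite_circle hr0 (finite_doubly_attaching hn hα hx hr hij)) ?_) _
    rintro θ ⟨hi, hj⟩
    exact ⟨hi.1, hi.2, hj.2⟩
  have hunion : volume (⋃ i, attachingAngles α x i r) = volume (Ico 0 (2 * Real.pi)) := by
    refine le_antisymm (measure_mono (iUnion_subset fun i θ hθ => hθ.1)) ?_
    have hsub : Ico 0 (2 * Real.pi) ⊆ (⋃ i, attachingAngles α x i r) ∪
        {θ | θ ∈ Ico 0 (2 * Real.pi) ∧ ∀ i, ¬ AttachesTo α x i (circlePoint r θ)} := by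
      intro θ hθ
      by_cases h : ∃ i, AttachesTo α x i (circlePoint r θ)
      · obtain ⟨i, hi⟩ := h
        exact Or.inl (mem_iUnion.2 ⟨i, hθ, hi⟩)
      · exact Or.inr ⟨hθ, not_exists.1 h⟩
    refine (measure_mono hsub).trans ((measure_union_le _ _).trans ?_)
    rw [Set.Finite.measure_zero (finite_angles_of_finite_circle hr0
      (finite_nonattaching hn hα hP hr)), add_zero]
  rw [measure_iUnion₀ hdisj fun i =>
    (measurableSet_attachingAngles hn hα hr i).nullMeasurableSet, tsum_fintype] at hunion
  have h2 : ∑ i, volume.real (attachingAngles α x i r) = 2 * Real.pi := by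
    simp only [Measure.real]
    rw [← ENNReal.toReal_sum fun i _ => hfin i, hunion]
    simp [Real.pi_pos.le]
  simp only [attachProb]
  rw [← Finset.sum_div, h2, div_self (by positivity)]

end Measurability

end GFA

end

noncomputable section

namespace GFA

open Set Filter Topology MeasureTheory
open scoped NNReal

/-! ### Time changes and attachment along a trajectory -/

section Reparametrization

/-- With τ the integral of s, both y and the flow at time τ(u) solve z' = s(u) v(z), so they agree
by uniqueness. The factor s is first extended continuously beyond [a, b]. -/
theorem IsFlow.exists_reparametrization {E : Type*} [NormedAddCommGroup E] [NormedSpace ℝ E]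
    {v : E → E} {φ : ℝ → E → E} {K : ℝ≥0} (hv : LipschitzWith K v) (hφ : IsFlow v φ) {y : ℝ → E}
    {s : ℝ → ℝ} {a b : ℝ} (hab : a ≤ b) (hs : ContinuousOn s (Icc a b))
    (hs0 : ∀ u ∈ Icc a b, 0 ≤ s u)
    (hy : ∀ u ∈ Icc a b, HasDerivAt y (s u • v (y u)) u) :
    ∃ τ, 0 ≤ τ ∧ φ τ (y a) = y b := by
  set σ : ℝ → ℝ := fun u => s (projIcc a b hab u) with hσ
  have hσc : Continuous σ := (continuousOn_iff_continuous_domRestrict.1 hs).comp continuous_projIcc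
  have hσs : ∀ u ∈ Icc a b, σ u = s u := fun u hu => by rw [hσ]; simp [projIcc_of_mem hab hu]
  obtain ⟨S, hS⟩ := (isCompact_Icc.image_of_continuousOn hs).isBounded.exists_norm_le
  have hσS : ∀ u, ‖σ u‖ ≤ S := fun u => hS _ ⟨_, (projIcc a b hab u).2, rfl⟩
  have hS0 : 0 ≤ S := (norm_nonneg _).trans (hσS a)
  set τ : ℝ → ℝ := fun u => ∫ w in a..u, σ w with hτ
  have hτd : ∀ u, HasDerivAt τ (σ u) u := fun u =>
    intervalIntegral.integral_hasDerivAt_right (hσc.intervalIntegrable _ _)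
      (hσc.stronglyMeasurableAtFilter _ _) hσc.continuousAt
  refine ⟨τ b, intervalIntegral.integral_nonneg hab fun u hu => by
    rw [hσs u hu]; exact hs0 u hu, ?_⟩
  have hlip : ∀ u, LipschitzWith (S.toNNReal * K) fun z => σ u • v z := by
    intro u
    refine LipschitzWith.of_dist_le_mul fun p q => ?_
    rw [dist_smul₀]
    calc ‖σ u‖ * dist (v p) (v q) ≤ S * (K * dist p q) := by
          gcongr
          · exact hσS u
          · exact hv.dist_le_mul p q
      _ = _ := by rw [NNReal.coe_mul, Real.coe_toNNReal _ hS0, mul_assoc]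
  have hd : ∀ u, HasDerivAt (fun u => φ (τ u) (y a)) (σ u • v (φ (τ u) (y a))) u := fun u =>
    (hφ.hasDerivAt (y a) (τ u)).scomp u (hτd u)
  refine ODE_solution_unique (v := fun u z => σ u • v z) hlip
    (fun u _ => (hd u).continuousAt.continuousWithinAt) (fun u _ => (hd u).hasDerivWithinAt)
    (fun u hu => (hy u hu).continuousAt.continuousWithinAt) (fun u hu => ?_) ?_ ⟨hab, le_rfl⟩
  · have hu' := Ico_subset_Icc_self hu
    simp only [hσs u hu']
    exact (hy u hu').hasDerivWithinAt
  · simp [hτ, hφ.zero]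

variable {n : ℕ} {α : ℝ} {x : Fin n → Plane} {φ : ℝ → Plane → Plane} {K : ℝ≥0}

theorem attachesTo_flow_iff (hv : LipschitzWith K (field α x)) (hφ : IsFlow (field α x) φ)
    {p : Plane} {τ : ℝ} (hτ : 0 ≤ τ) (h : ∀ t ∈ Icc 0 τ, ∀ j, 1 < dist (φ t p) (x j)) (i : Fin n) :
    AttachesTo α x i (φ τ p) ↔ AttachesTo α x i p := by
  rw [attachesTo_iff hv hφ, attachesTo_iff hv hφ]
  constructor
  · rintro ⟨T, hT, hlt, hi⟩
    refine ⟨T + τ, by linarith, fun t ht j => ?_, by rw [hφ.add hv, hi]⟩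
    rcases le_total t τ with htτ | htτ
    · exact h t ⟨ht.1, htτ⟩ j
    · have := hlt (t - τ) ⟨by linarith, by linarith [ht.2]⟩ j
      rwa [← hφ.add hv, sub_add_cancel] at this
  · rintro ⟨T, hT, hlt, hi⟩
    have hτT : τ < T := by
      by_contra hcon
      exact absurd hi (h T ⟨hT, not_lt.1 hcon⟩ i).ne'
    refine ⟨T - τ, by linarith, fun t ht j => ?_, ?_⟩
    · rw [← hφ.add hv]
      exact hlt (t + τ) ⟨by linarith [ht.1], by linarith [ht.2]⟩ j
    · rw [← hφ.add hv, sub_add_cancel, hi]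

theorem le_norm_flow_of_le (hn : 1 ≤ n) (hα : 0 ≤ α) (hv : LipschitzWith K (field α x))
    (hφ : IsFlow (field α x) φ) {r : ℝ} (hr : ∀ i, ‖x i‖ + 1 < r) {p : Plane} {t τ : ℝ}
    (htτ : t ≤ τ) (hτ : r ≤ ‖φ τ p‖) : r ≤ ‖φ t p‖ := by
  by_contra hcon
  rw [not_le] at hcon
  -- The level must lie below r and above every ‖x i‖. Once the trajectory is at that level the norm
  -- cannot rise again.
  obtain ⟨t', ht', hm⟩ := intermediate_value_Icc htτ
    (hφ.continuous_time p).norm.continuousOn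
    (show max ‖φ t p‖ (r - 1) ∈ Icc ‖φ t p‖ ‖φ τ p‖ from
      ⟨le_max_left _ _, max_le (hcon.le.trans hτ) (by linarith)⟩)
  have hm' : ‖φ t' p‖ = max ‖φ t p‖ (r - 1) := hm
  have h1 := norm_flow_le hn hα hφ (p := φ t' p) (t := τ - t')
    (fun i => by rw [hm']; exact lt_max_of_lt_right (by linarith [hr i])) (by linarith [ht'.2])
  rw [← hφ.add hv, sub_add_cancel, hm'] at h1
  have h2 : max ‖φ t p‖ (r - 1) < r := max_lt hcon (by linarith)
  linarith

theorem one_lt_dist_of_le_norm {r : ℝ} (hr : ∀ i, ‖x i‖ + 1 < r) {p : Plane} (hp : r ≤ ‖p‖)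
    (j : Fin n) : 1 < dist p (x j) :=
  one_lt_dist_of_norm (fun i => (hr i).trans_le hp) rfl j

theorem attachesTo_flow_iff_of_norm (hn : 1 ≤ n) (hα : 0 ≤ α) (hv : LipschitzWith K (field α x))
    (hφ : IsFlow (field α x) φ) {r : ℝ} (hr : ∀ i, ‖x i‖ + 1 < r) {p : Plane} {τ : ℝ}
    (hτ : 0 ≤ τ) (h : r ≤ ‖φ τ p‖) (i : Fin n) :
    AttachesTo α x i (φ τ p) ↔ AttachesTo α x i p :=
  attachesTo_flow_iff hv hφ hτ (fun _ ht j => one_lt_dist_of_le_norm hr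
    (le_norm_flow_of_le hn hα hv hφ hr ht.2 h) j) i

end Reparametrization

/-! ### Gradient lines in the coordinates u = 1/r and θ -/

section PolarEquation

variable {n : ℕ} (α : ℝ) (x : Fin n → Plane)

/-- The squared norm of `(a, b) - u x i`, for a unit vector `(a, b)`. -/
def polarSq (i : Fin n) (z : ℝ × ℝ × ℝ) : ℝ :=
  1 - 2 * z.1 * (x i 0 * z.2.1 + x i 1 * z.2.2) + z.1 ^ 2 * ‖x i‖ ^ 2

/-- The weight of particle `i`, seen from the point `(a, b) / u`. -/
def polarWeight (i : Fin n) (z : ℝ × ℝ × ℝ) : ℝ := polarSq x i z ^ (-(α + 2) / 2)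

/-- The tangential force, up to normalization. -/
def polarTangential (z : ℝ × ℝ × ℝ) : ℝ :=
  ∑ i, (x i 1 * z.2.1 - x i 0 * z.2.2) * polarWeight α x i z

/-- The radial force, up to normalization. -/
def polarRadial (z : ℝ × ℝ × ℝ) : ℝ :=
  ∑ i, (1 - z.1 * (x i 0 * z.2.1 + x i 1 * z.2.2)) * polarWeight α x i z

/-- The slope of the gradient lines in the coordinates `u = 1 / r` and `θ`. -/
def polarSlope (z : ℝ × ℝ × ℝ) : ℝ := polarTangential α x z / polarRadial α x z

/-- The domain on which the polar equation is considered. -/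
def polarBox (u₀ : ℝ) : Set (ℝ × ℝ × ℝ) := Icc 0 u₀ ×ˢ Icc (-1) 1 ×ˢ Icc (-1) 1

variable {α x}

theorem abs_coord_le (y : Plane) (k : Fin 2) : |y k| ≤ ‖y‖ := by
  have := PiLp.norm_apply_le y k
  simpa using this

theorem polarBox_bound {u₀ : ℝ} (hu : ∀ i, u₀ * ‖x i‖ ≤ 1 / 8) {z : ℝ × ℝ × ℝ}
    (hz : z ∈ polarBox u₀) (i : Fin n) :
    z.1 * (x i 0 * z.2.1 + x i 1 * z.2.2) ≤ 1 / 4 := by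
  obtain ⟨⟨h1, h2⟩, ⟨h3, h4⟩, h5, h6⟩ := hz
  have key : ∀ k : Fin 2, ∀ w : ℝ, -1 ≤ w → w ≤ 1 → x i k * w ≤ ‖x i‖ := fun k w hw hw' =>
    calc x i k * w ≤ |x i k * w| := le_abs_self _
      _ = |x i k| * |w| := abs_mul _ _
      _ ≤ ‖x i‖ * 1 := by
        gcongr
        · exact abs_coord_le _ _
        · exact abs_le.2 ⟨hw, hw'⟩
      _ = ‖x i‖ := mul_one _
  have h7 := key 0 _ h3 h4
  have h8 := key 1 _ h5 h6
  -- The box is a convex square rather than the unit circle in (cos θ, sin θ), hence the factor 2;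
  -- the bound 1/8 on u₀ ‖x i‖ allows for it.
  calc z.1 * (x i 0 * z.2.1 + x i 1 * z.2.2) ≤ z.1 * (2 * ‖x i‖) := by gcongr; linarith
    _ ≤ u₀ * (2 * ‖x i‖) := by gcongr
    _ ≤ 1 / 4 := by linarith [hu i]

theorem polarSq_pos {u₀ : ℝ} (hu : ∀ i, u₀ * ‖x i‖ ≤ 1 / 8) {z : ℝ × ℝ × ℝ}
    (hz : z ∈ polarBox u₀) (i : Fin n) : 0 < polarSq x i z := by
  have h1 := polarBox_bound hu hz i
  have h2 : 0 ≤ z.1 ^ 2 * ‖x i‖ ^ 2 := by positivity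
  unfold polarSq
  linarith

theorem polarRadial_pos (hn : 1 ≤ n) {u₀ : ℝ} (hu : ∀ i, u₀ * ‖x i‖ ≤ 1 / 8) {z : ℝ × ℝ × ℝ}
    (hz : z ∈ polarBox u₀) : 0 < polarRadial α x z := by
  refine Finset.sum_pos (fun i _ => mul_pos ?_ (Real.rpow_pos_of_pos (polarSq_pos hu hz i) _))
    ⟨⟨0, hn⟩, Finset.mem_univ _⟩
  linarith [polarBox_bound hu hz i]

theorem contDiffAt_polar {u₀ : ℝ} (hu : ∀ i, u₀ * ‖x i‖ ≤ 1 / 8) {z : ℝ × ℝ × ℝ}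
    (hz : z ∈ polarBox u₀) :
    ContDiffAt ℝ 1 (polarTangential α x) z ∧ ContDiffAt ℝ 1 (polarRadial α x) z := by
  have hw : ∀ i, ContDiffAt ℝ 1 (polarWeight α x i) z := by
    intro i
    have h1 : ContDiff ℝ 1 (polarSq x i) := by
      unfold polarSq
      fun_prop
    exact h1.contDiffAt.rpow_const_of_ne (polarSq_pos hu hz i).ne'
  constructor
  · refine ContDiffAt.sum fun i _ => ContDiffAt.mul ?_ (hw i)
    fun_prop
  · refine ContDiffAt.sum fun i _ => ContDiffAt.mul ?_ (hw i)
    fun_prop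

theorem contDiffOn_polarSlope (hn : 1 ≤ n) {u₀ : ℝ} (hu : ∀ i, u₀ * ‖x i‖ ≤ 1 / 8) :
    ContDiffOn ℝ 1 (polarSlope α x) (polarBox u₀) := fun _ hz =>
  ((contDiffAt_polar hu hz).1.div (contDiffAt_polar hu hz).2
    (polarRadial_pos hn hu hz).ne').contDiffWithinAt

/-- The argument `(u, cos θ, sin θ)` of the polar functions. -/
def polarArg (u θ : ℝ) : ℝ × ℝ × ℝ := (u, Real.cos θ, Real.sin θ)

theorem polarArg_mem {u₀ u : ℝ} (hu : u ∈ Icc 0 u₀) (θ : ℝ) : polarArg u θ ∈ polarBox u₀ :=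
  ⟨hu, ⟨Real.neg_one_le_cos θ, Real.cos_le_one θ⟩, Real.neg_one_le_sin θ, Real.sin_le_one θ⟩

theorem norm_sub_sq_polar {u : ℝ} (hu : 0 < u) (θ : ℝ) (i : Fin n) :
    ‖circlePoint (1 / u) θ - x i‖ ^ 2 = polarSq x i (polarArg u θ) / u ^ 2 := by
  rw [eq_div_iff (by positivity), plane_norm_sq, polarSq, plane_norm_sq (x i), polarArg]
  simp only [PiLp.sub_apply, circlePoint_zero_coord, circlePoint_one_coord]
  have h1 : ∀ w, 1 / u * w * u = w := fun w => by field_simp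
  linear_combination (-2 * x i 0 * u) * h1 (Real.cos θ) + (-2 * x i 1 * u) * h1 (Real.sin θ) +
    (Real.cos θ + 1 / u * Real.cos θ * u) * h1 (Real.cos θ) +
    (Real.sin θ + 1 / u * Real.sin θ * u) * h1 (Real.sin θ) + Real.sin_sq_add_cos_sq θ

theorem kernel_polar {u : ℝ} (hu : 0 < u) (θ : ℝ) (i : Fin n)
    (hd : 1 / 2 ≤ dist (circlePoint (1 / u) θ) (x i)) (hpos : 0 < polarSq x i (polarArg u θ)) :
    kernel (α + 2) (circlePoint (1 / u) θ - x i) =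
      (u ^ (α + 2) * polarWeight α x i (polarArg u θ)) • (circlePoint (1 / u) θ - x i) := by
  rw [kernel_eq (by rwa [← dist_eq_norm]), norm_rpow_eq_sq_rpow, norm_sub_sq_polar hu,
    Real.div_rpow hpos.le (by positivity), polarWeight, ← Real.rpow_natCast u 2,
    ← Real.rpow_mul hu.le, mul_comm (u ^ (α + 2)), div_eq_mul_inv, ← Real.rpow_neg hu.le]
  congr 3
  push_cast
  ring

/-- A solution of the polar equation is a reparametrized gradient line. -/
theorem hasDerivAt_circlePoint_polar (hn : 1 ≤ n) (hα : 0 ≤ α) {u₀ : ℝ}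
    (hu : ∀ i, u₀ * ‖x i‖ ≤ 1 / 8) (hu₀ : u₀ ≤ 1) {Θ : ℝ → ℝ} {u : ℝ} (hu0 : 0 < u) (huu : u ≤ u₀)
    (hΘ : HasDerivAt Θ (polarSlope α x (polarArg u (Θ u))) u) :
    HasDerivAt (fun w => circlePoint (1 / w) (Θ w))
      ((strength α * u ^ (α + 3) * polarRadial α x (polarArg u (Θ u)))⁻¹ •
        field α x (circlePoint (1 / u) (Θ u))) u := by
  have hz := polarArg_mem (⟨hu0.le, huu⟩ : u ∈ Icc 0 u₀) (Θ u)
  set z := polarArg u (Θ u) with hzdef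
  have hB := polarRadial_pos (α := α) hn hu hz
  set B := polarRadial α x z with hBdef
  set A := polarTangential α x z with hAdef
  have hsq : ∀ i, 0 < polarSq x i z := fun i => polarSq_pos hu hz i
  have hdist : ∀ i, 1 / 2 ≤ dist (circlePoint (1 / u) (Θ u)) (x i) := by
    intro i
    have h1 := norm_sub_norm_le (circlePoint (1 / u) (Θ u)) (x i)
    rw [norm_circlePoint (by positivity)] at h1
    rw [dist_eq_norm]
    have h2 : ‖x i‖ ≤ 1 / 8 * (1 / u) := by
      rw [mul_one_div, le_div_iff₀ hu0, mul_comm]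
      exact (mul_le_mul_of_nonneg_right huu (norm_nonneg _)).trans (hu i)
    have h3 : 1 ≤ 1 / u := by rw [le_div_iff₀ hu0]; linarith
    linarith
  have hf : field α x (circlePoint (1 / u) (Θ u)) = -((strength α * u ^ (α + 2)) •
      ∑ i, polarWeight α x i z • (circlePoint (1 / u) (Θ u) - x i)) := by
    rw [field, mul_smul, Finset.smul_sum (r := u ^ (α + 2))]
    congr 2
    refine Finset.sum_congr rfl fun i _ => ?_
    rw [kernel_polar hu0 _ i (hdist i) (hsq i), mul_smul]
  -- This identity and the next one resolve the force into its radial part B and tangential part A.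
  -- In these terms, with c = `strength α`, du/dt = c u^(α+3) B and dθ/dt = c u^(α+3) A.
  have hsum0 : (∑ i, polarWeight α x i z * (circlePoint (1 / u) (Θ u) 0 - x i 0)) * u =
      B * Real.cos (Θ u) + u * A * Real.sin (Θ u) := by
    rw [hBdef, hAdef, polarRadial, polarTangential, Finset.sum_mul, Finset.sum_mul, Finset.mul_sum,
      Finset.sum_mul, ← Finset.sum_add_distrib]
    refine Finset.sum_congr rfl fun i _ => ?_
    generalize polarWeight α x i z = W
    simp only [hzdef, polarArg, circlePoint_zero_coord]
    have h1 : 1 / u * Real.cos (Θ u) * u = Real.cos (Θ u) := by field_simp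
    linear_combination W * h1 +
      (W * u * x i 0) * Real.sin_sq_add_cos_sq (Θ u)
  have hsum1 : (∑ i, polarWeight α x i z * (circlePoint (1 / u) (Θ u) 1 - x i 1)) * u =
      B * Real.sin (Θ u) - u * A * Real.cos (Θ u) := by
    rw [hBdef, hAdef, polarRadial, polarTangential, Finset.sum_mul, Finset.sum_mul, Finset.mul_sum,
      Finset.sum_mul, ← Finset.sum_sub_distrib]
    refine Finset.sum_congr rfl fun i _ => ?_
    generalize polarWeight α x i z = W
    simp only [hzdef, polarArg, circlePoint_one_coord]
    have h1 : 1 / u * Real.sin (Θ u) * u = Real.sin (Θ u) := by field_simp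
    linear_combination W * h1 +
      (W * u * x i 1) * Real.sin_sq_add_cos_sq (Θ u)
  have hc := strength_pos hα
  have hinv : HasDerivAt (fun w : ℝ => 1 / w) (-1 / u ^ 2) u := by
    simpa [one_div, neg_div] using hasDerivAt_inv hu0.ne'
  have hslope : polarSlope α x z = A / B := rfl
  have hpow : u ^ (α + 3) = u ^ (α + 2) * u := by
    rw [← Real.rpow_add_one hu0.ne']; congr 1; ring
  have hup : 0 < u ^ (α + 2) := by positivity
  have hcoord : ∀ k : Fin 2, HasDerivAt (fun w => circlePoint (1 / w) (Θ w) k)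
      (((strength α * u ^ (α + 3) * B)⁻¹ • field α x (circlePoint (1 / u) (Θ u))) k) u := by
    intro k
    fin_cases k
    · refine (hinv.mul hΘ.cos).congr_deriv ?_
      rw [hf, hslope, hpow]
      simp only [Fin.zero_eta, PiLp.smul_apply, PiLp.neg_apply, WithLp.ofLp_sum, Finset.sum_apply,
        PiLp.sub_apply, smul_eq_mul]
      rw [← eq_div_iff hu0.ne'] at hsum0
      rw [hsum0]
      field_simp
      ring
    · refine (hinv.mul hΘ.sin).congr_deriv ?_
      rw [hf, hslope, hpow]
      simp only [Fin.mk_one, PiLp.smul_apply, PiLp.neg_apply, WithLp.ofLp_sum, Finset.sum_apply,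
        PiLp.sub_apply, smul_eq_mul]
      rw [← eq_div_iff hu0.ne'] at hsum1
      rw [hsum1]
      field_simp
      ring
  have h1 := hasDerivAt_pi.2 hcoord
  exact ((PiLp.continuousLinearEquiv 2 ℝ fun _ : Fin 2 => ℝ).symm :
    (Fin 2 → ℝ) →L[ℝ] Plane).hasFDerivAt.comp_hasDerivAt u h1

end PolarEquation

end GFA

end

noncomputable section

namespace GFA

open Set Filter Topology MeasureTheory
open scoped NNReal

/-! ### Existence of the limiting probabilities -/

section Limit

variable {n : ℕ} {α : ℝ} {x : Fin n → Plane}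

theorem measure_inter_Ico_eq_of_periodic {A : Set ℝ} (hA : MeasurableSet A) {T : ℝ} (hT : 0 < T)
    (hper : ∀ θ, θ + T ∈ A ↔ θ ∈ A) (a b : ℝ) :
    volume (A ∩ Ico a (a + T)) = volume (A ∩ Ico b (b + T)) := by
  have h1 : ∀ c, volume (A ∩ Ico c (c + T)) = volume (A ∩ Ioc c (c + T)) := fun c =>
    measure_congr (EventuallyEq.rfl.inter Ico_ae_eq_Ioc)
  rw [h1, h1]
  refine (isAddFundamentalDomain_Ioc hT a).measure_set_eq (isAddFundamentalDomain_Ioc hT b) hA ?_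
  rintro ⟨g, hg⟩
  obtain ⟨k, rfl⟩ := AddSubgroup.mem_zmultiples_iff.1 hg
  have hp : Function.Periodic (fun θ => θ ∈ A) T := fun θ => propext (hper θ)
  ext θ
  have := (hp.zsmul k) θ
  simp only [mem_preimage, AddSubgroup.mk_vadd, vadd_eq_add]
  rw [add_comm]
  exact Iff.of_eq this

/-- The slope of the polar equation, extended to all values of `u`. -/
def clampedSlope (α : ℝ) (x : Fin n → Plane) {u₀ : ℝ} (h : 0 ≤ u₀) (u θ : ℝ) : ℝ :=
  polarSlope α x (polarArg (projIcc 0 u₀ h u) θ)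

/-- A C¹ function on a compact convex box is Lipschitz and bounded. The box includes u = 0, so the
constants do not degenerate at infinite radius. -/
theorem clampedSlope_props (hn : 1 ≤ n) {u₀ : ℝ} (h : 0 ≤ u₀) (hu : ∀ i, u₀ * ‖x i‖ ≤ 1 / 8) :
    ∃ K L : ℝ≥0, (∀ u, LipschitzWith K (clampedSlope α x h u)) ∧
      (∀ θ, Continuous fun u => clampedSlope α x h u θ) ∧ ∀ u θ, ‖clampedSlope α x h u θ‖ ≤ L := by
  have hbox : IsCompact (polarBox u₀) := isCompact_Icc.prod (isCompact_Icc.prod isCompact_Icc)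
  have hconv : Convex ℝ (polarBox u₀) :=
    (convex_Icc _ _).prod ((convex_Icc _ _).prod (convex_Icc _ _))
  have hC := contDiffOn_polarSlope (α := α) hn hu
  obtain ⟨K, hK⟩ := hC.exists_lipschitzOnWith one_ne_zero hconv hbox
  obtain ⟨L, hL⟩ := (hbox.image_of_continuousOn hC.continuousOn).isBounded.exists_norm_le
  have hmem : ∀ u θ, polarArg (projIcc 0 u₀ h u) θ ∈ polarBox u₀ := fun u θ =>
    polarArg_mem (projIcc 0 u₀ h u).2 θ
  refine ⟨K, L.toNNReal, fun u => LipschitzWith.of_dist_le_mul fun θ ψ => ?_, fun θ => ?_,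
    fun u θ => (hL _ ⟨_, hmem u θ, rfl⟩).trans (Real.le_coe_toNNReal _)⟩
  · refine (hK.dist_le_mul _ (hmem u θ) _ (hmem u ψ)).trans ?_
    gcongr
    simp only [polarArg, Prod.dist_eq, dist_self]
    refine max_le dist_nonneg (max_le ?_ ?_)
    · exact Real.abs_cos_sub_cos_le θ ψ
    · exact Real.abs_sin_sub_sin_le θ ψ
  · refine hC.continuousOn.comp_continuous ?_ fun u => hmem u θ
    unfold polarArg
    exact (continuous_subtype_val.comp continuous_projIcc).prodMk continuous_const

theorem clampedSlope_eq {u₀ : ℝ} (h : 0 ≤ u₀) {u : ℝ} (hu : u ∈ Icc 0 u₀) (θ : ℝ) :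
    clampedSlope α x h u θ = polarSlope α x (polarArg u θ) := by
  rw [clampedSlope, projIcc_of_mem h hu]

theorem attachesTo_polar_solution (hn : 1 ≤ n) (hα : 0 ≤ α) {u₀ : ℝ}
    (hu : ∀ i, u₀ * ‖x i‖ ≤ 1 / 8) (hu₀ : u₀ ≤ 1) {u₁ u₂ : ℝ} (h2 : 0 < u₂) (h21 : u₂ ≤ u₁)
    (h1 : u₁ ≤ u₀) (hr : ∀ i, ‖x i‖ + 1 < 1 / u₁) {Θ : ℝ → ℝ}
    (hΘ : ∀ u ∈ Icc u₂ u₁, HasDerivAt Θ (polarSlope α x (polarArg u (Θ u))) u) (i : Fin n) :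
    AttachesTo α x i (circlePoint (1 / u₁) (Θ u₁)) ↔
      AttachesTo α x i (circlePoint (1 / u₂) (Θ u₂)) := by
  obtain ⟨K, hv⟩ := lipschitz_field (x := x) hα
  obtain ⟨L, hL⟩ := bounded_field (x := x) hα
  obtain ⟨φ, hφ⟩ := exists_isFlow hv hL
  have hmem : ∀ u ∈ Icc u₂ u₁, polarArg u (Θ u) ∈ polarBox u₀ := fun u hu' =>
    polarArg_mem ⟨h2.le.trans hu'.1, hu'.2.trans h1⟩ _
  have hpos : ∀ u ∈ Icc u₂ u₁, 0 < strength α * u ^ (α + 3) *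
      polarRadial α x (polarArg u (Θ u)) := fun u hu' =>
    mul_pos (mul_pos (strength_pos hα) (Real.rpow_pos_of_pos (h2.trans_le hu'.1) _))
      (polarRadial_pos hn hu (hmem u hu'))
  have hs : ContinuousOn (fun u => (strength α * u ^ (α + 3) *
      polarRadial α x (polarArg u (Θ u)))⁻¹) (Icc u₂ u₁) := by
    refine ContinuousOn.inv₀ (ContinuousOn.mul (continuousOn_const.mul fun u hu' => ?_) ?_)
      (fun u hu' => (hpos u hu').ne')
    · exact (Real.continuousAt_rpow_const _ _
        (Or.inl (h2.trans_le hu'.1).ne')).continuousWithinAt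
    · intro u hu'
      have hc : ContinuousAt (fun u => polarArg u (Θ u)) u := by
        unfold polarArg
        exact continuousAt_id.prodMk ((Real.continuous_cos.continuousAt.comp
          (hΘ u hu').continuousAt).prodMk (Real.continuous_sin.continuousAt.comp
          (hΘ u hu').continuousAt))
      exact (ContinuousAt.comp (f := fun u => polarArg u (Θ u)) (g := polarRadial α x)
        (contDiffAt_polar hu (hmem u hu')).2.continuousAt hc).continuousWithinAt
  obtain ⟨τ, hτ, hτe⟩ := hφ.exists_reparametrization hv
    (y := fun w => circlePoint (1 / w) (Θ w))
    (s := fun u => (strength α * u ^ (α + 3) * polarRadial α x (polarArg u (Θ u)))⁻¹) h21 hs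
    (fun u hu' => (inv_pos.2 (hpos u hu')).le)
    (fun u hu' => hasDerivAt_circlePoint_polar hn hα hu hu₀ (h2.trans_le hu'.1) (hu'.2.trans h1)
      (hΘ u hu'))
  have hu1 : 0 < u₁ := h2.trans_le h21
  rw [← hτe]
  refine attachesTo_flow_iff_of_norm hn hα hv hφ hr hτ ?_ i
  rw [hτe, norm_circlePoint (by positivity)]

/-- Following gradient lines from radius r₂ in to r₁ preserves the particle reached, and Grönwall's
inequality bounds the stretching of angles. -/
theorem volume_attachingAngles_le (hn : 1 ≤ n) (hα : 0 ≤ α) :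
    ∃ K R : ℝ, 0 < R ∧ (∀ i, ‖x i‖ + 1 < R) ∧ ∀ r₁ r₂, R ≤ r₁ → r₁ ≤ r₂ → ∀ i,
      volume.real (attachingAngles α x i r₁) ≤
        Real.exp (K * (1 / r₁ - 1 / r₂)) * volume.real (attachingAngles α x i r₂) := by
  -- Chosen so that 1/R meets both requirements of the polar equation and R exceeds every ‖x i‖ + 1.
  set R : ℝ := 8 * ∑ i, ‖x i‖ + 2 with hR
  have hle : ∀ i, ‖x i‖ ≤ ∑ i, ‖x i‖ := fun i =>
    Finset.single_le_sum (f := fun i => ‖x i‖) (fun _ _ => norm_nonneg _) (Finset.mem_univ i)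
  have hnn : 0 ≤ ∑ i, ‖x i‖ := Finset.sum_nonneg fun _ _ => norm_nonneg _
  have hR0 : 0 < R := by positivity
  set u₀ : ℝ := 1 / R with hu₀
  have hu00 : 0 ≤ u₀ := by positivity
  have hu : ∀ i, u₀ * ‖x i‖ ≤ 1 / 8 := fun i => by
    rw [hu₀, one_div_mul_eq_div, div_le_iff₀ hR0]
    linarith [hle i]
  have hu1 : u₀ ≤ 1 := by
    rw [hu₀, div_le_iff₀ hR0]
    linarith
  have hxR : ∀ i, ‖x i‖ + 1 < R := fun i => by linarith [hle i, norm_nonneg (x i)]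
  obtain ⟨K, L, hK, hc, hL⟩ := clampedSlope_props (α := α) hn hu00 hu
  refine ⟨K, R, hR0, hxR, fun r₁ r₂ hr₁ hr₁₂ i => ?_⟩
  have hr10 : 0 < r₁ := hR0.trans_le hr₁
  have hr20 : 0 < r₂ := hr10.trans_le hr₁₂
  have hx1 : ∀ i, ‖x i‖ + 1 < r₁ := fun i => (hxR i).trans_le hr₁
  have hx2 : ∀ i, ‖x i‖ + 1 < r₂ := fun i => (hx1 i).trans_le hr₁₂
  set u₁ := 1 / r₁ with hu₁
  set u₂ := 1 / r₂ with hu₂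
  have h20 : 0 < u₂ := by positivity
  have h21 : u₂ ≤ u₁ := one_div_le_one_div_of_le hr10 hr₁₂
  have h10 : u₁ ≤ u₀ := one_div_le_one_div_of_le hR0 hr₁
  choose Θ hΘ0 hΘ using fun θ => exists_global_solution hK hc hL u₂ θ
  have hattach : ∀ θ, AttachesTo α x i (circlePoint r₁ (Θ θ u₁)) ↔
      AttachesTo α x i (circlePoint r₂ θ) := by
    intro θ
    have := attachesTo_polar_solution hn hα hu hu1 h20 h21 h10
      (by rw [hu₁, one_div_one_div]; exact hx1) (Θ := Θ θ) (fun u hu' => by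
        rw [← clampedSlope_eq hu00 ⟨h20.le.trans hu'.1, hu'.2.trans h10⟩]
        exact hΘ θ u) i
    rwa [hu₁, hu₂, one_div_one_div, one_div_one_div, ← hu₁, ← hu₂, hΘ0] at this
  set f : ℝ → ℝ := fun θ => Θ θ u₁ with hf
  set C : ℝ≥0 := (Real.exp (K * (u₁ - u₂))).toNNReal with hC
  have hflip : LipschitzWith C f := by
    refine LipschitzWith.of_dist_le_mul fun θ ψ => ?_
    have := dist_le_of_trajectories_ODE (a := u₂) (b := u₁) hK
      (fun s _ => (hΘ θ s).continuousAt.continuousWithinAt)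
      (fun s _ => (hΘ θ s).hasDerivWithinAt)
      (fun s _ => (hΘ ψ s).continuousAt.continuousWithinAt)
      (fun s _ => (hΘ ψ s).hasDerivWithinAt) (δ := dist θ ψ) (by rw [hΘ0, hΘ0]) u₁ ⟨h21, le_rfl⟩
    rw [hC, Real.coe_toNNReal _ (Real.exp_nonneg _), mul_comm]
    exact this
  -- The equation is 2π-periodic in θ, so f carries a full turn to a full turn. By continuity its
  -- image covers the period starting at f 0.
  have hshift : f (0 + 2 * Real.pi) = f 0 + 2 * Real.pi := by
    have h1 : ∀ u, HasDerivAt (fun u => Θ 0 u + 2 * Real.pi)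
        (clampedSlope α x hu00 u (Θ 0 u + 2 * Real.pi)) u := by
      intro u
      have e : clampedSlope α x hu00 u (Θ 0 u + 2 * Real.pi) = clampedSlope α x hu00 u (Θ 0 u) := by
        simp only [clampedSlope, polarArg, Real.cos_add_two_pi, Real.sin_add_two_pi]
      rw [e]
      exact (hΘ 0 u).add_const _
    exact congrFun (global_solution_unique hK (hΘ (0 + 2 * Real.pi)) h1 (t₀ := u₂)
      (by simp only [hΘ0])) u₁
  set A₁ := {θ | AttachesTo α x i (circlePoint r₁ θ)} with hA₁
  set A₂ := {θ | AttachesTo α x i (circlePoint r₂ θ)} with hA₂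
  have hsub : A₁ ∩ Ico (f 0) (f 0 + 2 * Real.pi) ⊆ f '' (A₂ ∩ Ico 0 (2 * Real.pi)) := by
    rintro ψ ⟨hψ, hψ1, hψ2⟩
    have hpi := Real.pi_pos
    rw [← hshift] at hψ2
    obtain ⟨θ, hθ, rfl⟩ := intermediate_value_Icc (show (0 : ℝ) ≤ 0 + 2 * Real.pi by linarith)
      hflip.continuous.continuousOn ⟨hψ1, hψ2.le⟩
    refine ⟨θ, ⟨(hattach θ).1 hψ, hθ.1, ?_⟩, rfl⟩
    rcases hθ.2.eq_or_lt with h | h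
    · rw [h] at hψ2
      exact absurd hψ2 (lt_irrefl _)
    · linarith
  have hvol : volume (attachingAngles α x i r₁) ≤ C * volume (attachingAngles α x i r₂) := by
    rw [attachingAngles_eq, attachingAngles_eq]
    have h1 := measure_inter_Ico_eq_of_periodic (measurableSet_attaching_angle hn hα hx1 i)
      Real.two_pi_pos (fun θ => by
        simp only [mem_ofPred_eq]
        rw [circlePoint_add_two_pi]) 0 (f 0)
    rw [zero_add] at h1
    rw [h1]
    refine (measure_mono hsub).trans ?_
    have h2 := hflip.hausdorffMeasure_image_le (d := 1) zero_le_one (A₂ ∩ Ico 0 (2 * Real.pi))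
    rw [hausdorffMeasure_real, ENNReal.rpow_one] at h2
    exact h2
  have hfin : volume (attachingAngles α x i r₂) ≠ ⊤ :=
    ne_top_of_le_ne_top measure_Ico_lt_top.ne (measure_mono (fun θ hθ => hθ.1 :
      attachingAngles α x i r₂ ⊆ Ico 0 (2 * Real.pi)))
  have := ENNReal.toReal_mono (ENNReal.mul_ne_top ENNReal.coe_ne_top hfin) hvol
  rw [ENNReal.toReal_mul, ENNReal.coe_toReal, hC, Real.coe_toNNReal _ (Real.exp_nonneg _)] at this
  exact this

theorem tendsto_attachProb (hn : 1 ≤ n) (hα : 0 ≤ α) (i : Fin n) :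
    ∃ p, Tendsto (fun r => attachProb α x i r) atTop (𝓝 p) := by
  obtain ⟨K, R, hR, -, h⟩ := volume_attachingAngles_le (x := x) hn hα
  set F : ℝ → ℝ := fun r => volume.real (attachingAngles α x i r)
  have hF : ∀ r, F r ≤ 2 * Real.pi := by
    intro r
    have h1 := measureReal_mono (μ := volume) (fun θ hθ => hθ.1 :
      attachingAngles α x i r ⊆ Ico 0 (2 * Real.pi)) measure_Ico_lt_top.ne
    refine h1.trans ?_
    rw [Real.volume_real_Ico_of_le Real.two_pi_pos.le, sub_zero]
  -- Freezing the radius below R makes the monotone quantity monotone on the whole line.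
  set G : ℝ → ℝ := fun r => Real.exp (-(K * (1 / max r R))) * F (max r R)
  have hmono : Monotone G := by
    intro r s hrs
    have h1 := h (max r R) (max s R) (le_max_right _ _) (max_le_max hrs le_rfl) i
    calc G r ≤ Real.exp (-(K * (1 / max r R))) *
          (Real.exp (K * (1 / max r R - 1 / max s R)) * F (max s R)) := by
          simp only [G]
          gcongr
      _ = G s := by
          rw [← mul_assoc, ← Real.exp_add]
          simp only [G]
          congr 2
          ring
  have hbdd : BddAbove (range G) := by
    refine ⟨Real.exp (|K| * (1 / R)) * (2 * Real.pi), ?_⟩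
    rintro _ ⟨r, rfl⟩
    simp only [G]
    gcongr
    · have h1 : 1 / max r R ≤ 1 / R := one_div_le_one_div_of_le hR (le_max_right _ _)
      have h2 : 0 ≤ 1 / max r R := by
        have := hR.trans_le (le_max_right r R)
        positivity
      calc -(K * (1 / max r R)) = (-K) * (1 / max r R) := by ring
        _ ≤ |K| * (1 / max r R) := by gcongr; exact neg_le_abs K
        _ ≤ |K| * (1 / R) := by gcongr
    · exact hF _
  have hG := tendsto_atTop_ciSup hmono hbdd
  have hE : Tendsto (fun r : ℝ => Real.exp (K * (1 / r))) atTop (𝓝 1) := by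
    have h1 : Tendsto (fun r : ℝ => K * (1 / r)) atTop (𝓝 0) := by
      simpa using (tendsto_inv_atTop_zero (𝕜 := ℝ)).const_mul K
    simpa [Function.comp_def] using (Real.continuous_exp.tendsto 0).comp h1
  refine ⟨(⨆ r, G r) * 1 / (2 * Real.pi), ((hG.mul hE).div_const _).congr' ?_⟩
  filter_upwards [eventually_ge_atTop R] with r hr
  simp only [G, attachProb, max_eq_left hr]
  rw [mul_right_comm, ← Real.exp_add]
  simp [F]

end Limit

end GFA

end

noncomputable section

namespace GFA

open Set Filter Topology
open scoped NNReal ComplexConjugate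

/-! ### Crossing curves in a disk -/

section Crossing

theorem exists_int_im_eq {z : ℂ} {ρ A : ℝ} (hρ : 0 < ρ)
    (h : Complex.exp z = ρ * Complex.exp (A * Complex.I)) :
    ∃ k : ℤ, z.im = A + k * (2 * Real.pi) := by
  have h1 : Complex.exp z = Complex.exp (Real.log ρ + A * Complex.I) := by
    rw [h, Complex.exp_add, ← Complex.ofReal_exp, Real.exp_log hρ]
  obtain ⟨k, hk⟩ := Complex.exp_eq_exp_iff_exists_int.1 h1
  refine ⟨k, ?_⟩
  rw [hk]
  simp

/-- The increment of a logarithm along a curve that stays in a half-plane. -/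
theorem im_sub_im_of_halfPlane {M : ℝ → ℂ} (hM : Continuous M) {ω A B ρ₀ ρ₁ : ℝ}
    (hpos : ∀ t, 0 < (Complex.exp (M t) * Complex.exp (-ω * Complex.I)).re)
    (hρ₀ : 0 < ρ₀) (h0 : Complex.exp (M 0) = ρ₀ * Complex.exp (A * Complex.I))
    (hρ₁ : 0 < ρ₁) (h1 : Complex.exp (M 1) = ρ₁ * Complex.exp (B * Complex.I))
    (hA : |A - ω| < Real.pi / 2) (hB : |B - ω| < Real.pi / 2) :
    (M 1).im - (M 0).im = B - A := by
  obtain ⟨k, hk⟩ := exists_int_im_eq hρ₀ h0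
  obtain ⟨l, hl⟩ := exists_int_im_eq hρ₁ h1
  have hpi := Real.pi_pos
  have hcos : ∀ t, 0 < Real.cos ((M t).im - ω - k * (2 * Real.pi)) := by
    intro t
    rw [Real.cos_sub_int_mul_two_pi]
    have h2 := hpos t
    rw [← Complex.exp_add, Complex.exp_re] at h2
    have h3 := pos_of_mul_pos_right h2 (Real.exp_pos _).le
    simpa [sub_eq_add_neg] using h3
  have hc : Continuous fun t => (M t).im - ω - k * (2 * Real.pi) := by fun_prop
  have hstart : |(M 0).im - ω - k * (2 * Real.pi)| < Real.pi / 2 := by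
    rw [hk]
    convert hA using 2
    ring
  have hend : |(M 1).im - ω - k * (2 * Real.pi)| < Real.pi / 2 := by
    by_contra hcon
    rw [not_lt] at hcon
    obtain ⟨t, -, ht⟩ := intermediate_value_Icc zero_le_one hc.abs.continuousOn ⟨hstart.le, hcon⟩
    have h2 := hcos t
    rw [← Real.cos_abs] at h2
    have ht' : |(M t).im - ω - k * (2 * Real.pi)| = Real.pi / 2 := ht
    rw [ht', Real.cos_pi_div_two] at h2
    exact lt_irrefl _ h2
  rw [abs_lt] at hB hend
  rw [hl] at hend
  have h3 : (l : ℝ) - k < 1 := by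
    by_contra hcon
    rw [not_lt] at hcon
    nlinarith
  have h4 : (-1 : ℝ) < l - k := by
    by_contra hcon
    rw [not_lt] at hcon
    nlinarith
  have h5 : l = k := by
    have h3' : l - k < 1 := by exact_mod_cast h3
    have h4' : -1 < l - k := by exact_mod_cast h4
    omega
  rw [hl, hk, h5]
  ring

theorem chord_eq (r θ ψ : ℝ) :
    (r : ℂ) * Complex.exp (θ * Complex.I) - r * Complex.exp (ψ * Complex.I) =
      ((2 * r * Real.sin ((θ - ψ) / 2) : ℝ) : ℂ) *
        Complex.exp (((θ + ψ) / 2 + Real.pi / 2 : ℝ) * Complex.I) := by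
  obtain ⟨m, hm⟩ : ∃ m, m = (θ + ψ) / 2 := ⟨_, rfl⟩
  obtain ⟨h, hh⟩ : ∃ h, h = (θ - ψ) / 2 := ⟨_, rfl⟩
  have hθ : θ = m + h := by rw [hm, hh]; ring
  have hψ : ψ = m - h := by rw [hm, hh]; ring
  rw [← hm, ← hh, hθ, hψ]
  push_cast
  rw [add_mul, sub_mul, add_mul, sub_eq_add_neg ((m : ℂ) * Complex.I), Complex.exp_add,
    Complex.exp_add, Complex.exp_add, Complex.exp_pi_div_two_mul_I, ← neg_mul,
    Complex.exp_mul_I (h : ℂ), Complex.exp_mul_I (-(h : ℂ)), Complex.cos_neg, Complex.sin_neg]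
  ring

/-- The disk lies on one side of its tangent at a boundary point and touches it only there. -/
theorem chord_re_pos {r : ℝ} {w : ℂ} {θ : ℝ} (hw : ‖w‖ ≤ r)
    (hne : (r : ℂ) * Complex.exp (θ * Complex.I) - w ≠ 0) :
    0 < (((r : ℂ) * Complex.exp (θ * Complex.I) - w) * Complex.exp (-θ * Complex.I)).re := by
  have e : ((r : ℂ) * Complex.exp (θ * Complex.I) - w) * Complex.exp (-θ * Complex.I) =
      r - w * Complex.exp (-θ * Complex.I) := by
    rw [sub_mul, mul_assoc, ← Complex.exp_add]
    simp
  set u := w * Complex.exp (-θ * Complex.I) with hu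
  have hun : ‖u‖ = ‖w‖ := by
    rw [hu, norm_mul, ← Complex.ofReal_neg, Complex.norm_exp_ofReal_mul_I, mul_one]
  rw [e, Complex.sub_re, Complex.ofReal_re, sub_pos]
  refine lt_of_le_of_ne ((Complex.re_le_norm u).trans (hun.le.trans hw)) fun h => ?_
  have h1 : u.re ^ 2 + u.im ^ 2 = ‖u‖ ^ 2 := by
    rw [← Complex.normSq_eq_norm_sq, Complex.normSq_apply]; ring
  have h2 : ‖u‖ = r := le_antisymm (hun.le.trans hw) (h ▸ Complex.re_le_norm u)
  have h3 : u.im = 0 := by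
    rw [h2, h] at h1
    nlinarith
  have h4 : u = r := by
    apply Complex.ext
    · simpa using h
    · simpa using h3
  apply hne
  have h5 : ((r : ℂ) * Complex.exp (θ * Complex.I) - w) * Complex.exp (-θ * Complex.I) = 0 := by
    rw [e, h4, sub_self]
  exact (mul_eq_zero.1 h5).resolve_right (Complex.exp_ne_zero _)

/-- If the curves were disjoint, f(s) - g(t) would have a continuous logarithm on the simply
connected parameter plane. On each side of the unit square one curve is fixed at a boundary point,
so the difference stays in a half-plane and the change of argument is determined by its ends. -/
theorem curves_meet {r a b c d : ℝ} (hr : 0 < r) (hab : a < b) (hbc : b < c) (hcd : c < d)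
    (hda : d < a + 2 * Real.pi) {f g : ℝ → ℂ} (hf : Continuous f) (hg : Continuous g)
    (hfr : ∀ s, ‖f s‖ ≤ r) (hgr : ∀ t, ‖g t‖ ≤ r)
    (hf0 : f 0 = r * Complex.exp (a * Complex.I)) (hf1 : f 1 = r * Complex.exp (c * Complex.I))
    (hg0 : g 0 = r * Complex.exp (b * Complex.I)) (hg1 : g 1 = r * Complex.exp (d * Complex.I)) :
    ∃ s t, f s = g t := by
  by_contra hcon
  push Not at hcon
  have hpi := Real.pi_pos
  have hsc : IsSimplyConnected (univ : Set (ℝ × ℝ)) := by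
    have : ContractibleSpace (univ : Set (ℝ × ℝ)) := convex_univ.contractibleSpace univ_nonempty
    exact (inferInstance : SimplyConnectedSpace (univ : Set (ℝ × ℝ)))
  obtain ⟨L, hLc, hL⟩ := Complex.exists_continuousOn_eqOn_exp_comp (X := ℝ × ℝ) (U := univ)
    (g := fun z => f z.1 - g z.2) hsc isOpen_univ
    (by fun_prop) (by
      rintro ⟨z, -, hz⟩
      exact hcon _ _ (sub_eq_zero.1 hz))
  have hLc' : Continuous L := by rwa [← continuousOn_univ]
  have hexp : ∀ s t, Complex.exp (L (s, t)) = f s - g t := fun s t => hL (mem_univ (s, t))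
  have hne : ∀ s t, f s - g t ≠ 0 := fun s t => sub_ne_zero.2 (hcon s t)
  have hsin : ∀ θ ψ : ℝ, ψ < θ → θ < ψ + 2 * Real.pi → 0 < 2 * r * Real.sin ((θ - ψ) / 2) :=
    fun θ ψ h1 h2 => mul_pos (by positivity)
      (Real.sin_pos_of_pos_of_lt_pi (by linarith) (by linarith))
  have hneg : ∀ θ ψ A : ℝ, (∃ k : ℤ, A = (θ + ψ) / 2 - Real.pi / 2 + k * (2 * Real.pi)) →
      (r : ℂ) * Complex.exp (θ * Complex.I) - r * Complex.exp (ψ * Complex.I) =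
        ((2 * r * Real.sin ((ψ - θ) / 2) : ℝ) : ℂ) * Complex.exp (A * Complex.I) := by
    rintro θ ψ A ⟨k, rfl⟩
    have e : (((θ + ψ) / 2 - Real.pi / 2 + k * (2 * Real.pi) : ℝ) : ℂ) * Complex.I =
        ((θ + ψ) / 2 + Real.pi / 2 : ℝ) * Complex.I - Real.pi * Complex.I +
          k * (2 * Real.pi * Complex.I) := by
      push_cast
      ring
    have e2 : (ψ - θ) / 2 = -((θ - ψ) / 2) := by ring
    rw [chord_eq, e, Complex.exp_add, Complex.exp_int_mul_two_pi_mul_I, Complex.exp_sub_pi_mul_I,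
      e2, Real.sin_neg]
    push_cast
    ring
  have side_s0 := im_sub_im_of_halfPlane (M := fun t => L (0, t)) (ω := a)
    (A := (a + b) / 2 - Real.pi / 2) (B := (a + d) / 2 - Real.pi / 2) (by fun_prop)
    (fun t => by
      rw [hexp, hf0]
      exact chord_re_pos (hgr t) (by rw [← hf0]; exact hne 0 t))
    (hsin b a hab (by linarith)) (by rw [hexp, hf0, hg0]; exact hneg _ _ _ ⟨0, by simp⟩)
    (hsin d a (by linarith) hda) (by rw [hexp, hf0, hg1]; exact hneg _ _ _ ⟨0, by simp⟩)
    (by rw [abs_lt]; constructor <;> linarith) (by rw [abs_lt]; constructor <;> linarith)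
  have side_s1 := im_sub_im_of_halfPlane (M := fun t => L (1, t)) (ω := c)
    (A := (c + b) / 2 + Real.pi / 2) (B := (c + d) / 2 - Real.pi / 2) (by fun_prop)
    (fun t => by
      rw [hexp, hf1]
      exact chord_re_pos (hgr t) (by rw [← hf1]; exact hne 1 t))
    (hsin c b hbc (by linarith)) (by rw [hexp, hf1, hg0]; exact chord_eq _ _ _)
    (hsin d c hcd (by linarith)) (by rw [hexp, hf1, hg1]; exact hneg _ _ _ ⟨0, by simp⟩)
    (by rw [abs_lt]; constructor <;> linarith) (by rw [abs_lt]; constructor <;> linarith)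
  have half : ∀ (s t θ σ : ℝ), g t = r * Complex.exp (θ * Complex.I) →
      (σ = θ + Real.pi ∨ σ = θ - Real.pi) →
      0 < (Complex.exp (L (s, t)) * Complex.exp (-σ * Complex.I)).re := by
    intro s t θ σ hgt hσ
    have h1 := chord_re_pos (hfr s) (θ := θ) (by
      rw [← hgt, ← neg_ne_zero, neg_sub]
      exact hne s t)
    have h2 : Complex.exp (-σ * Complex.I) = -Complex.exp (-θ * Complex.I) := by
      rcases hσ with rfl | rfl
      · rw [← Complex.exp_sub_pi_mul_I]
        congr 1
        push_cast
        ring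
      · rw [← Complex.exp_add_pi_mul_I]
        congr 1
        push_cast
        ring
    rw [hexp, hgt, h2]
    convert h1 using 2
    ring
  -- The extra 2π in the initial angle brings it within π/2 of the axis b + π of the half-plane.
  have side_t0 := im_sub_im_of_halfPlane (M := fun s => L (s, 0)) (ω := b + Real.pi)
    (A := (a + b) / 2 - Real.pi / 2 + 2 * Real.pi) (B := (c + b) / 2 + Real.pi / 2) (by fun_prop)
    (fun s => half s 0 b _ hg0 (Or.inl rfl))
    (hsin b a hab (by linarith)) (by rw [hexp, hf0, hg0]; exact hneg _ _ _ ⟨1, by simp⟩)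
    (hsin c b hbc (by linarith)) (by rw [hexp, hf1, hg0]; exact chord_eq _ _ _)
    (by rw [abs_lt]; constructor <;> linarith) (by rw [abs_lt]; constructor <;> linarith)
  have side_t1 := im_sub_im_of_halfPlane (M := fun s => L (s, 1)) (ω := d - Real.pi)
    (A := (a + d) / 2 - Real.pi / 2) (B := (c + d) / 2 - Real.pi / 2) (by fun_prop)
    (fun s => half s 1 d _ hg1 (Or.inr rfl))
    (hsin d a (by linarith) hda) (by rw [hexp, hf0, hg1]; exact hneg _ _ _ ⟨0, by simp⟩)
    (hsin d c hcd (by linarith)) (by rw [hexp, hf1, hg1]; exact hneg _ _ _ ⟨0, by simp⟩)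
    (by rw [abs_lt]; constructor <;> linarith) (by rw [abs_lt]; constructor <;> linarith)
  -- From (0, 0) to (1, 1), the two routes along the square give changes of argument differing by
  -- 2π.
  linarith

/-- Two sets in a disk that join interleaved pairs of boundary points meet. -/
theorem not_disjoint_of_joinedIn {r a b c d : ℝ} (hr : 0 < r) (hab : a < b) (hbc : b < c)
    (hcd : c < d) (hda : d < a + 2 * Real.pi) {S T : Set Plane}
    (hS : S ⊆ Metric.closedBall 0 r) (hT : T ⊆ Metric.closedBall 0 r)
    (hac : JoinedIn S (circlePoint r a) (circlePoint r c))
    (hbd : JoinedIn T (circlePoint r b) (circlePoint r d)) : ¬ Disjoint S T := by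
  obtain ⟨γ, hγ⟩ := hac
  obtain ⟨δ, hδ⟩ := hbd
  have hγ' : ∀ s, γ.extend s ∈ S := fun s => by
    have : γ.extend s ∈ range γ := by
      rw [← Path.extend_range]
      exact mem_range_self s
    obtain ⟨u, hu⟩ := this
    exact hu ▸ hγ u
  have hδ' : ∀ s, δ.extend s ∈ T := fun s => by
    have : δ.extend s ∈ range δ := by
      rw [← Path.extend_range]
      exact mem_range_self s
    obtain ⟨u, hu⟩ := this
    exact hu ▸ hδ u
  obtain ⟨s, t, hst⟩ := curves_meet hr hab hbc hcd hda
    (f := fun s => toComplex (γ.extend s)) (g := fun s => toComplex (δ.extend s))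
    (toComplex.continuous.comp γ.continuous_extend) (toComplex.continuous.comp δ.continuous_extend)
    (fun s => by
      rw [LinearIsometryEquiv.norm_map]
      simpa using hS (hγ' s))
    (fun s => by
      rw [LinearIsometryEquiv.norm_map]
      simpa using hT (hδ' s))
    (by rw [Path.extend_zero, toComplex_circlePoint])
    (by rw [Path.extend_one, toComplex_circlePoint])
    (by rw [Path.extend_zero, toComplex_circlePoint])
    (by rw [Path.extend_one, toComplex_circlePoint])
  have h := toComplex.injective hst
  exact fun hd => disjoint_left.1 hd (hγ' s) (h ▸ hδ' t)

end Crossing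

end GFA

end

noncomputable section

namespace GFA

open Set Filter Topology
open scoped NNReal

/-! ### Elementary geometry of touching disks -/

section Geometry

/-- By Stewart's identity the squared distance is at least 1 - st ≥ 3/4. -/
theorem half_lt_dist_of_mem_segment {h a w z : Plane} (hz : z ∈ segment ℝ h a)
    (hha : dist h a = 1) (hhw : 1 ≤ dist h w) (haw : 1 ≤ dist a w) : 1 / 2 < dist z w := by
  obtain ⟨s, t, hs, ht, hst, rfl⟩ := hz
  have e1 : dist (s • h + t • a) w ^ 2 =
      s * dist h w ^ 2 + t * dist a w ^ 2 - s * t * dist h a ^ 2 := by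
    simp only [dist_eq_norm, plane_norm_sq]
    simp only [PiLp.sub_apply, PiLp.add_apply, PiLp.smul_apply, smul_eq_mul]
    obtain rfl : s = 1 - t := by linarith
    ring
  have h1 : 1 ≤ dist h w ^ 2 := by nlinarith
  have h2 : 1 ≤ dist a w ^ 2 := by nlinarith
  rw [hha] at e1
  by_contra hcon
  rw [not_lt] at hcon
  have h3 : dist (s • h + t • a) w ^ 2 ≤ (1 / 2) ^ 2 := pow_le_pow_left₀ dist_nonneg hcon 2
  obtain rfl : s = 1 - t := by linarith
  nlinarith [mul_le_mul_of_nonneg_left h1 hs, mul_le_mul_of_nonneg_left h2 ht,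
    sq_nonneg (t - 1 / 2)]

theorem dist_le_half_of_mem_segment {a b z : Plane} (hz : z ∈ segment ℝ a b) (hab : dist a b = 1) :
    dist z a ≤ 1 / 2 ∨ dist z b ≤ 1 / 2 := by
  have h := dist_add_dist_of_mem_segment hz
  rw [hab, dist_comm a z] at h
  by_contra hcon
  push Not at hcon
  linarith [hcon.1, hcon.2]

theorem eq_of_mem_segment_of_one_le {h a z : Plane} (hz : z ∈ segment ℝ h a) (hha : dist h a = 1)
    (hza : 1 ≤ dist z a) : z = h := by
  have h1 := dist_add_dist_of_mem_segment hz
  have : dist h z ≤ 0 := by linarith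
  exact (dist_le_zero.1 this).symm

/-- At a common point, exchanging the endpoints a and b would give two paths of total length 2 but
with end-to-end distances summing to more than 2. -/
theorem segment_disjoint_of_dist {h a k b : Plane} (hha : dist h a = 1) (hkb : dist k b = 1)
    (hhb : 1 ≤ dist h b) (hka : 1 < dist k a) : Disjoint (segment ℝ h a) (segment ℝ k b) := by
  rw [disjoint_left]
  intro z hz hz'
  have h1 := dist_add_dist_of_mem_segment hz
  have h2 := dist_add_dist_of_mem_segment hz'
  have h3 := dist_triangle h z b
  have h4 := dist_triangle k z a
  linarith

/-- At most six disks of radius `1/2` touch a given one without overlapping each other. -/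
theorem not_seven_neighbours {a : Plane} {y : Fin 7 → Plane} (hy : ∀ l, dist (y l) a = 1)
    (hsep : ∀ l l', l ≠ l' → 1 ≤ dist (y l) (y l')) : False := by
  have hpi := Real.pi_pos
  set w : Fin 7 → ℂ := fun l => toComplex (y l - a) with hw
  have hw1 : ∀ l, ‖w l‖ = 1 := fun l => by
    rw [hw]
    simp only
    rw [LinearIsometryEquiv.norm_map, ← dist_eq_norm, hy]
  -- Pigeonhole into six half-open sectors of angle π/3. Two unit vectors in one sector enclose an
  -- angle below π/3, so their distance is below 1.
  obtain ⟨l, -, l', -, hne, hbox⟩ := Finset.exists_ne_map_eq_of_card_lt_of_maps_to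
    (s := Finset.univ) (t := Finset.Icc (1 : ℤ) 6)
    (f := fun l => ⌈((w l).arg + Real.pi) / (Real.pi / 3)⌉) (by simp) (fun l _ => by
      have h1 := Complex.neg_pi_lt_arg (w l)
      have h2 := Complex.arg_le_pi (w l)
      simp only [Finset.coe_Icc, mem_Icc]
      constructor
      · rw [Int.one_le_ceil_iff]
        apply div_pos <;> linarith
      · rw [Int.ceil_le, div_le_iff₀ (by positivity)]
        push_cast
        linarith)
  have hdiff : |(w l).arg - (w l').arg| < Real.pi / 3 := by
    have h1 : |((w l).arg + Real.pi) / (Real.pi / 3) -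
        ((w l').arg + Real.pi) / (Real.pi / 3)| < 1 := by
      have e : (⌈((w l).arg + Real.pi) / (Real.pi / 3)⌉ : ℝ) =
        ⌈((w l').arg + Real.pi) / (Real.pi / 3)⌉ := congrArg Int.cast hbox
      have u1 := Int.le_ceil (((w l).arg + Real.pi) / (Real.pi / 3))
      have u2 := Int.le_ceil (((w l').arg + Real.pi) / (Real.pi / 3))
      have u3 := Int.ceil_lt_add_one (((w l).arg + Real.pi) / (Real.pi / 3))
      have u4 := Int.ceil_lt_add_one (((w l').arg + Real.pi) / (Real.pi / 3))
      rw [abs_lt]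
      constructor <;> linarith
    rw [← sub_div, abs_div, abs_of_pos (by positivity : 0 < Real.pi / 3),
      div_lt_one (by positivity), add_sub_add_right_eq_sub] at h1
    exact h1
  have hcos : 1 / 2 < Real.cos ((w l).arg - (w l').arg) := by
    rw [← Real.cos_abs, ← Real.cos_pi_div_three]
    exact Real.cos_lt_cos_of_nonneg_of_le_pi (abs_nonneg _) (by linarith) hdiff
  have hd := hsep l l' hne
  have h1 : dist (y l) (y l') ^ 2 = ‖w l - w l'‖ ^ 2 := by
    rw [hw]
    simp only
    rw [← map_sub, LinearIsometryEquiv.norm_map, sub_sub_sub_cancel_right, dist_eq_norm]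
  have hre : ∀ l, (w l).re = Real.cos (w l).arg ∧ (w l).im = Real.sin (w l).arg := by
    intro l
    rw [Complex.cos_arg (by rw [← norm_pos_iff, hw1]; exact one_pos), Complex.sin_arg, hw1]
    simp
  have h2 : ‖w l - w l'‖ ^ 2 = 2 - 2 * Real.cos ((w l).arg - (w l').arg) := by
    rw [← Complex.normSq_eq_norm_sq, Complex.normSq_apply, Complex.sub_re, Complex.sub_im,
      (hre l).1, (hre l).2, (hre l').1, (hre l').2, Real.cos_sub]
    linear_combination Real.sin_sq_add_cos_sq (w l).arg + Real.sin_sq_add_cos_sq (w l').arg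
  nlinarith

end Geometry

/-! ### Covering a set by intervals through alternation -/

section Arcs

/-- A set of reals that does not alternate more than `m` times with `B` is covered, up to finitely
many points, by at most `m` open intervals avoiding `B`. -/
theorem exists_intervals_of_alternation {A B : Set ℝ} {u v : ℝ} (hA : A ⊆ Icc u v)
    (hAB : Disjoint A B) (m : ℕ)
    (h : ∀ a : Fin (m + 1) → ℝ, StrictMono a → (∀ l, a l ∈ A) →
      ¬ ∀ l l', l < l' → ∃ b ∈ B, a l < b ∧ b < a l') :
    ∃ k ≤ m, ∃ c d : Fin k → ℝ, (∀ j, c j < d j ∧ u ≤ c j ∧ d j ≤ v) ∧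
      (∀ j, Disjoint (Ioo (c j) (d j)) B) ∧ (A \ ⋃ j, Ioo (c j) (d j)).Finite := by
  classical
  -- A set S of pairwise B-separated points that cannot be enlarged is wanted. The first failing
  -- size is k + 1, and any S of size k will do.
  set P : ℕ → Prop := fun k => ∃ S : Finset ℝ, S.card = k ∧ (∀ s ∈ S, s ∈ A) ∧
    ∀ s ∈ S, ∀ t ∈ S, s < t → ∃ b ∈ B, s < b ∧ b < t with hP
  have hnot : ∃ k, ¬ P k := by
    refine ⟨m + 1, ?_⟩
    rintro ⟨S, hcard, hSA, hS⟩
    refine h (S.orderEmbOfFin hcard) (S.orderEmbOfFin hcard).strictMono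
      (fun l => hSA _ (S.orderEmbOfFin_mem hcard l)) fun l l' hl => ?_
    exact hS _ (S.orderEmbOfFin_mem hcard l) _ (S.orderEmbOfFin_mem hcard l')
      ((S.orderEmbOfFin hcard).strictMono hl)
  obtain ⟨k, hk⟩ : ∃ k, Nat.find hnot = k + 1 := by
    refine Nat.exists_eq_succ_of_ne_zero fun h0 => ?_
    have := Nat.find_spec hnot
    rw [h0] at this
    exact this ⟨∅, by simp, by simp, by simp⟩
  have hPk : P k := not_not.1 (Nat.find_min hnot (by omega))
  have hPk1 : ¬ P (k + 1) := hk ▸ Nat.find_spec hnot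
  have hkm : k ≤ m := by
    by_contra hcon
    rw [not_le] at hcon
    have hPm : P (m + 1) := not_not.1 (Nat.find_min hnot (by omega))
    obtain ⟨S, hcard, hSA, hS⟩ := hPm
    refine h (S.orderEmbOfFin hcard) (S.orderEmbOfFin hcard).strictMono
      (fun l => hSA _ (S.orderEmbOfFin_mem hcard l)) fun l l' hl => ?_
    exact hS _ (S.orderEmbOfFin_mem hcard l) _ (S.orderEmbOfFin_mem hcard l')
      ((S.orderEmbOfFin hcard).strictMono hl)
  obtain ⟨S, hcard, hSA, hS⟩ := hPk
  -- The points of A not separated from s by B. Their span contains no point of B in its interior,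
  -- and by maximality of S these classes cover A.
  set C : ℝ → Set ℝ := fun s => {a | a ∈ A ∧ ∀ b ∈ B, ¬ (a < b ∧ b < s) ∧ ¬ (s < b ∧ b < a)} with hC
  have hCA : ∀ s, C s ⊆ Icc u v := fun s a ha => hA ha.1
  have hCb : ∀ s, BddBelow (C s) := fun s => bddBelow_Icc.mono (hCA s)
  have hCa : ∀ s, BddAbove (C s) := fun s => bddAbove_Icc.mono (hCA s)
  have hself : ∀ s ∈ S, s ∈ C s := fun s hs => ⟨hSA s hs, fun b _ =>
    ⟨fun hb => lt_asymm hb.1 hb.2, fun hb => lt_asymm hb.1 hb.2⟩⟩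
  have hcover : ∀ a ∈ A, ∃ s ∈ S, a ∈ C s := by
    intro a ha
    by_contra hcon
    push Not at hcon
    have hsep : ∀ s ∈ S, ∃ b ∈ B, (a < b ∧ b < s) ∨ (s < b ∧ b < a) := by
      intro s hs
      by_contra hno
      push Not at hno
      refine hcon s hs ⟨ha, fun b hb => ⟨fun h1 => ?_, fun h1 => ?_⟩⟩
      · exact absurd h1.2 (not_lt.2 ((hno b hb).1 h1.1))
      · exact absurd h1.2 (not_lt.2 ((hno b hb).2 h1.1))
    have haS : a ∉ S := fun haS => hcon a haS (hself a haS)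
    refine hPk1 ⟨insert a S, by rw [Finset.card_insert_of_notMem haS, hcard], ?_, ?_⟩
    · intro s hs
      rcases Finset.mem_insert.1 hs with rfl | hs
      · exact ha
      · exact hSA s hs
    · intro s hs t ht hst
      rcases Finset.mem_insert.1 hs with hs' | hs' <;> rcases Finset.mem_insert.1 ht with ht' | ht'
      · exact absurd hst (hs'.trans ht'.symm).not_lt
      · rw [hs'] at hst ⊢
        obtain ⟨b, hb, h1 | h1⟩ := hsep t ht'
        · exact ⟨b, hb, h1⟩
        · linarith [h1.1, h1.2]
      · rw [ht'] at hst ⊢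
        obtain ⟨b, hb, h1 | h1⟩ := hsep s hs'
        · linarith [h1.1, h1.2]
        · exact ⟨b, hb, h1⟩
      · exact hS s hs' t ht' hst
  -- One-point classes give no open interval; they join the interval endpoints in the finite
  -- exceptional set.
  set S' := S.filter fun s => sInf (C s) < sSup (C s) with hS'
  have hmemS : ∀ j : Fin S'.card, (S'.equivFin.symm j : ℝ) ∈ S ∧
      sInf (C (S'.equivFin.symm j)) < sSup (C (S'.equivFin.symm j)) := fun j =>
    Finset.mem_filter.1 (S'.equivFin.symm j).2
  refine ⟨S'.card, (Finset.card_filter_le _ _).trans (by omega),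
    fun j => sInf (C (S'.equivFin.symm j)), fun j => sSup (C (S'.equivFin.symm j)),
    fun j => ⟨(hmemS j).2, ?_, ?_⟩, fun j => ?_, ?_⟩
  · exact le_csInf ⟨_, hself _ (hmemS j).1⟩ fun a ha => (hCA _ ha).1
  · exact csSup_le ⟨_, hself _ (hmemS j).1⟩ fun a ha => (hCA _ ha).2
  · rw [disjoint_left]
    rintro b ⟨hb1, hb2⟩ hb
    have hs := hself _ (hmemS j).1
    obtain ⟨a, ha, hab⟩ := exists_lt_of_csInf_lt ⟨_, hs⟩ hb1
    obtain ⟨a', ha', hba'⟩ := exists_lt_of_lt_csSup ⟨_, hs⟩ hb2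
    rcases lt_trichotomy b (S'.equivFin.symm j : ℝ) with h1 | h1 | h1
    · exact (ha.2 b hb).1 ⟨hab, h1⟩
    · exact disjoint_left.1 hAB hs.1 (h1 ▸ hb)
    · exact (ha'.2 b hb).2 ⟨h1, hba'⟩
  · refine Set.Finite.subset (S.finite_toSet.biUnion
      (t := fun s => {sInf (C s), sSup (C s)}) fun s _ => Set.toFinite _) ?_
    rintro a ⟨ha, hno⟩
    obtain ⟨s, hs, has⟩ := hcover a ha
    refine mem_biUnion (Finset.mem_coe.2 hs) ?_
    have h1 := csInf_le (hCb s) has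
    have h2 := le_csSup (hCa s) has
    by_contra hcon
    rw [mem_insert_iff, mem_singleton_iff, not_or] at hcon
    have h3 : sInf (C s) < a := lt_of_le_of_ne h1 (Ne.symm hcon.1)
    have h4 : a < sSup (C s) := lt_of_le_of_ne h2 hcon.2
    have hsS' : s ∈ S' := Finset.mem_filter.2 ⟨hs, h3.trans h4⟩
    refine hno (mem_iUnion.2 ⟨S'.equivFin ⟨s, hsS'⟩, ?_⟩)
    simpa using ⟨h3, h4⟩

end Arcs

end GFA

end

noncomputable section

namespace GFA

open Set Filter Topology
open scoped NNReal

/-! ### Trajectories prolonged to the particles -/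

section Arms

variable {n : ℕ} {α : ℝ} {x : Fin n → Plane} {φ : ℝ → Plane → Plane} {K : ℝ≥0} {r : ℝ}

/-- The union of the disks of the particles other than `x i`. -/
def skeleton (x : Fin n → Plane) (i : Fin n) : Set Plane := {z | ∃ a ≠ i, dist z (x a) ≤ 1 / 2}

theorem segment_subset_skeleton {i a b : Fin n} (ha : a ≠ i) (hb : b ≠ i)
    (hab : dist (x a) (x b) = 1) : segment ℝ (x a) (x b) ⊆ skeleton x i := by
  intro z hz
  rcases dist_le_half_of_mem_segment hz hab with h | h
  · exact ⟨a, ha, h⟩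
  · exact ⟨b, hb, h⟩

theorem skeleton_subset_closedBall (hr : ∀ i, ‖x i‖ + 1 < r) (i : Fin n) :
    skeleton x i ⊆ Metric.closedBall 0 r := by
  rintro z ⟨a, -, hz⟩
  rw [mem_closedBall_zero_iff]
  have h1 := norm_le_norm_add_norm_sub' z (x a)
  rw [← dist_eq_norm] at h1
  linarith [hr a]

/-- Every other particle is connected, away from `x i`, with a neighbour of `x i`. -/
theorem exists_neighbour_joinedIn (h : IsCluster x) {i j : Fin n} (hji : j ≠ i) :
    ∃ k, k ≠ i ∧ dist (x k) (x i) = 1 ∧ JoinedIn (skeleton x i) (x j) (x k) := by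
  obtain ⟨w⟩ := h.connected.preconnected j i
  induction w with
  | nil => exact absurd rfl hji
  | @cons u v w huv _ ih =>
    have huv' : dist (x u) (x v) = 1 := huv
    by_cases hvw : v = w
    · subst hvw
      exact ⟨u, hji, huv', JoinedIn.refl ⟨u, hji, by simp⟩⟩
    · obtain ⟨k, hk, hd, hj⟩ := ih hvw
      exact ⟨k, hk, hd, (JoinedIn.of_segment_subset
        (segment_subset_skeleton hji hvw huv')).trans hj⟩

/-- The trajectory of `p` leads to the particle `i` at time `T`. -/
structure LeadsTo (φ : ℝ → Plane → Plane) (x : Fin n → Plane) (i : Fin n) (p : Plane)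
    (T : ℝ) : Prop where
  pos : 0 < T
  one_le : ∀ t ∈ Icc 0 T, ∀ j, 1 ≤ dist (φ t p) (x j)
  hit : dist (φ T p) (x i) = 1

theorem exists_leadsTo (hv : LipschitzWith K (field α x)) (hφ : IsFlow (field α x) φ)
    (hr : ∀ i, ‖x i‖ + 1 < r) {i : Fin n} {p : Plane} (hp : ‖p‖ = r) (h : AttachesTo α x i p) :
    ∃ T, LeadsTo φ x i p T ∧
      ∀ k, ¬ AttachesTo α x k p → ∀ t ∈ Icc 0 T, 1 < dist (φ t p) (x k) := by
  obtain ⟨T, hT, h1, h2⟩ := (attachesTo_iff hv hφ).1 h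
  have hT' : 0 < T := by
    refine hT.lt_of_ne fun h0 => ?_
    rw [← h0, hφ.zero] at h2
    exact absurd h2 (one_lt_dist_of_norm hr hp i).ne'
  have hle : ∀ t ∈ Icc 0 T, ∀ j, 1 ≤ dist (φ t p) (x j) := fun t ht j =>
    one_le_dist_of_Ico hT' (hφ.continuous_time p).continuousOn (fun t ht => h1 t ht j) t ht
  refine ⟨T, ⟨hT', hle, h2⟩, fun k hk t ht => ?_⟩
  rcases ht.2.eq_or_lt with rfl | hlt
  · exact (hle t ht k).lt_of_ne fun heq => hk ((attachesTo_iff hv hφ).2 ⟨t, hT, h1, heq.symm⟩)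
  · exact h1 t ⟨ht.1, hlt⟩ k

/-- The trajectory of `p` up to time `T`, followed by the segment to the particle `x i`. -/
def arm (φ : ℝ → Plane → Plane) (x : Fin n → Plane) (i : Fin n) (p : Plane) (T : ℝ) : Set Plane :=
  (fun t => φ t p) '' Icc 0 T ∪ segment ℝ (φ T p) (x i)

theorem joinedIn_arm (hφ : IsFlow (field α x) φ) {i : Fin n} {p : Plane} {T : ℝ} (hT : 0 ≤ T) :
    JoinedIn (arm φ x i p T) p (x i) := by
  have h1 : JoinedIn ((fun t => φ t p) '' Icc 0 T) p (φ T p) := by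
    have hpc : IsPathConnected ((fun t => φ t p) '' Icc 0 T) :=
      ((convex_Icc 0 T).isPathConnected ⟨0, le_rfl, hT⟩).image (hφ.continuous_time p)
    refine hpc.joinedIn _ ⟨0, ⟨le_rfl, hT⟩, hφ.zero p⟩ _ ⟨T, ⟨hT, le_rfl⟩, rfl⟩
  exact (h1.mono subset_union_left).trans
    ((JoinedIn.of_segment_subset Subset.rfl).mono subset_union_right)

theorem arm_subset_closedBall (hn : 1 ≤ n) (hα : 0 ≤ α) (hφ : IsFlow (field α x) φ)
    (hr : ∀ i, ‖x i‖ + 1 < r) (i : Fin n) {p : Plane} (hp : ‖p‖ = r) {T : ℝ} (hT : 0 ≤ T) :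
    arm φ x i p T ⊆ Metric.closedBall 0 r := by
  have h1 : ∀ t, 0 ≤ t → φ t p ∈ Metric.closedBall (0 : Plane) r := fun t ht => by
    rw [mem_closedBall_zero_iff, ← hp]
    exact norm_flow_le hn hα hφ (fun i => by rw [hp]; linarith [hr i]) ht
  refine union_subset ?_ ((convex_closedBall 0 r).segment_subset (h1 T hT) ?_)
  · rintro _ ⟨t, ht, rfl⟩
    exact h1 t ht.1
  · rw [mem_closedBall_zero_iff]
    linarith [hr i]

/-- The two trajectories are disjoint because they start on one circle. A trajectory keeps distance
at least 1 from the centres, so it could meet the other arm's segment only at its outer end, which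
lies on the other trajectory. The strict inequality `hqi` keeps the two segments apart. -/
theorem disjoint_arm (hn : 1 ≤ n) (hα : 0 ≤ α) (hv : LipschitzWith K (field α x))
    (hφ : IsFlow (field α x) φ) {p q : Plane} {i j : Fin n} {S T : ℝ} (hpq : ‖p‖ = ‖q‖)
    (hp : ∀ i, ‖x i‖ < ‖p‖) (hne : p ≠ q) (hpi : LeadsTo φ x i p T) (hqj : LeadsTo φ x j q S)
    (hqi : 1 < dist (φ S q) (x i)) : Disjoint (arm φ x i p T) (arm φ x j q S) := by
  rw [arm, arm, disjoint_union_left, disjoint_union_right, disjoint_union_right]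
  have hmemT : T ∈ Icc 0 T := ⟨hpi.pos.le, le_rfl⟩
  have hmemS : S ∈ Icc 0 S := ⟨hqj.pos.le, le_rfl⟩
  refine ⟨⟨?_, ?_⟩, ?_, segment_disjoint_of_dist hpi.hit hqj.hit (hpi.one_le T hmemT j) hqi⟩
  · rw [disjoint_left]
    rintro _ ⟨s, -, rfl⟩ ⟨t, -, h⟩
    exact hne (eq_of_flow_eq hn hα hv hφ hpq hp h.symm)
  · rw [disjoint_left]
    rintro _ ⟨s, hs, rfl⟩ h
    exact hne (eq_of_flow_eq hn hα hv hφ hpq hp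
      (eq_of_mem_segment_of_one_le h hqj.hit (hpi.one_le s hs j)))
  · rw [disjoint_right]
    rintro _ ⟨s, hs, rfl⟩ h
    exact hne (eq_of_flow_eq hn hα hv hφ hpq hp
      (eq_of_mem_segment_of_one_le h hpi.hit (hqj.one_le s hs i)).symm)

theorem disjoint_arm_skeleton (h : IsCluster x) {p : Plane} {i : Fin n} {T : ℝ}
    (hpi : LeadsTo φ x i p T) : Disjoint (arm φ x i p T) (skeleton x i) := by
  rw [disjoint_left]
  rintro z (⟨t, ht, rfl⟩ | hz) ⟨a, ha, hza⟩
  · have := hpi.one_le t ht a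
    simp only at hza
    linarith
  · have := half_lt_dist_of_mem_segment hz hpi.hit (hpi.one_le T ⟨hpi.pos.le, le_rfl⟩ a)
      (h.separated i a (Ne.symm ha))
    linarith

/-- Points of the circle leading to `x i` cannot be interlaced with points leading elsewhere,
to particles connected with the same neighbour of `x i`. -/
theorem not_interlaced (hn : 1 ≤ n) (hα : 0 ≤ α) (h : IsCluster x) (hr : ∀ i, ‖x i‖ + 1 < r)
    {a b c d : ℝ} (hab : a < b) (hbc : b < c) (hcd : c < d) (hda : d < a + 2 * Real.pi)
    {i j j' k : Fin n} (hj : JoinedIn (skeleton x i) (x j) (x k))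
    (hj' : JoinedIn (skeleton x i) (x j') (x k))
    (ha : AttachesTo α x i (circlePoint r a)) (hc : AttachesTo α x i (circlePoint r c))
    (hb : AttachesTo α x j (circlePoint r b)) (hb' : ¬ AttachesTo α x i (circlePoint r b))
    (hd : AttachesTo α x j' (circlePoint r d)) (hd' : ¬ AttachesTo α x i (circlePoint r d)) :
    False := by
  obtain ⟨K, hv⟩ := lipschitz_field (x := x) hα
  obtain ⟨L, hL⟩ := bounded_field (x := x) hα
  obtain ⟨φ, hφ⟩ := exists_isFlow hv hL
  have hr0 := pos_of_norm_add_one_lt hn hr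
  have hN := fun θ => norm_circlePoint hr0.le θ
  have hlt : ∀ θ i, ‖x i‖ < ‖circlePoint r θ‖ := fun θ i => by rw [hN]; linarith [hr i]
  obtain ⟨Ta, hTa, -⟩ := exists_leadsTo hv hφ hr (hN a) ha
  obtain ⟨Tc, hTc, -⟩ := exists_leadsTo hv hφ hr (hN c) hc
  obtain ⟨Tb, hTb, hib⟩ := exists_leadsTo hv hφ hr (hN b) hb
  obtain ⟨Td, hTd, hid⟩ := exists_leadsTo hv hφ hr (hN d) hd
  have hib' := hib i hb' Tb ⟨hTb.pos.le, le_rfl⟩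
  have hid' := hid i hd' Td ⟨hTd.pos.le, le_rfl⟩
  have hball := fun i θ {T : ℝ} (hT : 0 ≤ T) => arm_subset_closedBall hn hα hφ hr i (hN θ) hT
  -- One path joins the angles a and c through x_i; the other joins b and d through the disks of the
  -- other particles, meeting at x_k.
  refine not_disjoint_of_joinedIn (S := arm φ x i (circlePoint r a) Ta ∪
      arm φ x i (circlePoint r c) Tc) (T := skeleton x i ∪ (arm φ x j (circlePoint r b) Tb ∪
      arm φ x j' (circlePoint r d) Td)) hr0 hab hbc hcd hda
    (union_subset (hball i a hTa.pos.le) (hball i c hTc.pos.le))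
    (union_subset (skeleton_subset_closedBall hr i)
      (union_subset (hball j b hTb.pos.le) (hball j' d hTd.pos.le))) ?_ ?_ ?_
  · exact ((joinedIn_arm hφ hTa.pos.le).mono subset_union_left).trans
      ((joinedIn_arm hφ hTc.pos.le).mono subset_union_right).symm
  · refine ((joinedIn_arm hφ hTb.pos.le).mono ?_).trans (((hj.trans hj'.symm).mono
      subset_union_left).trans ((joinedIn_arm hφ hTd.pos.le).mono ?_).symm)
    · exact subset_union_left.trans subset_union_right
    · exact subset_union_right.trans subset_union_right
  · have hne : ∀ {p q : Plane}, AttachesTo α x i p → ¬ AttachesTo α x i q → p ≠ q :=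
      fun hp hq heq => hq (heq ▸ hp)
    have hdis := fun {θ ψ T S l} (hθ : AttachesTo α x i (circlePoint r θ))
        (hψ : ¬ AttachesTo α x i (circlePoint r ψ)) (h1 : LeadsTo φ x i (circlePoint r θ) T)
        (h2 : LeadsTo φ x l (circlePoint r ψ) S) h3 =>
      disjoint_arm hn hα hv hφ ((hN θ).trans (hN ψ).symm) (hlt θ) (hne hθ hψ) h1 h2 h3
    rw [disjoint_union_left, disjoint_union_right, disjoint_union_right, disjoint_union_right,
      disjoint_union_right]
    exact ⟨⟨disjoint_arm_skeleton h hTa, hdis ha hb' hTa hTb hib', hdis ha hd' hTa hTd hid'⟩,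
      disjoint_arm_skeleton h hTc, hdis hc hb' hTc hTb hib', hdis hc hd' hTc hTd hid'⟩

end Arms

end GFA

end

noncomputable section

namespace GFA

open Set Filter Topology
open scoped NNReal

/-! ### At most six arcs -/

section Intervals

variable {n : ℕ} {α : ℝ} {x : Fin n → Plane} {r : ℝ}

theorem not_seven_alternations (hn : 1 ≤ n) (hα : 0 ≤ α) (h : IsCluster x)
    (hr : ∀ i, ‖x i‖ + 1 < r) {i : Fin n} {θ₀ : ℝ} {B : Set ℝ}
    (hB : ∀ θ ∈ B, (∃ j, AttachesTo α x j (circlePoint r θ)) ∧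
      ¬ AttachesTo α x i (circlePoint r θ)) (hθ₀ : θ₀ + 2 * Real.pi ∈ B)
    {a : Fin (6 + 1) → ℝ} (ha : StrictMono a) (hmem : ∀ l, a l ∈ Ioo θ₀ (θ₀ + 2 * Real.pi))
    (hatt : ∀ l, AttachesTo α x i (circlePoint r (a l)))
    (halt : ∀ l l', l < l' → ∃ b ∈ B, a l < b ∧ b < a l') : False := by
  have hb : ∀ l : Fin (6 + 1), ∃ b ∈ B, a l < b ∧ b ≤ θ₀ + 2 * Real.pi ∧
      ∀ l', l < l' → b < a l' := by
    intro l
    -- Seven points on the circle leave seven cyclic gaps; the last gap is represented by the cut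
    -- point θ₀ + 2π, itself in B.
    by_cases hl : l = Fin.last 6
    · exact ⟨_, hθ₀, (hmem l).2, le_rfl, fun l' hl' => absurd (hl ▸ hl') (Fin.le_last l').not_gt⟩
    · have hl6 : (l : ℕ) < 6 := Fin.val_lt_last hl
      obtain ⟨b, hbB, h1, h2⟩ := halt l ⟨l + 1, by omega⟩ (Fin.lt_def.2 (Nat.lt_succ_self _))
      refine ⟨b, hbB, h1, h2.le.trans (hmem _).2.le, fun l' hl' => h2.trans_le ?_⟩
      exact ha.monotone (Fin.le_def.2 hl')
  choose b hbB hab hbv hba using hb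
  choose j hj using fun l => (hB _ (hbB l)).1
  have hji : ∀ l, j l ≠ i := fun l heq => (hB _ (hbB l)).2 (heq ▸ hj l)
  choose k hk hki hjk using fun l => exists_neighbour_joinedIn h (hji l)
  have key : ∀ l l', l < l' → k l ≠ k l' := by
    intro l l' hl heq
    refine not_interlaced hn hα h hr (hab l) (hba l l' hl) (hab l')
      ((hbv l').trans_lt (by linarith [(hmem l).1])) (hjk l) (heq ▸ hjk l') (hatt l) (hatt l')
      (hj l) (hB _ (hbB l)).2 (hj l') (hB _ (hbB l')).2
  refine not_seven_neighbours (a := x i) (y := fun l => x (k l)) hki fun l l' hl => ?_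
  rcases lt_or_gt_of_ne hl with h1 | h1
  · exact h.separated _ _ (key l l' h1)
  · exact h.separated _ _ (key l' l h1).symm

/-- Around an aggregate, the points of a large circle that lead to a given particle form at most
six open arcs, up to finitely many points. -/
theorem exists_arcs (hn : 1 ≤ n) (hα : 0 ≤ α) (hP : PropertyP α x) (h : IsCluster x)
    (hr : ∀ i, ‖x i‖ + 1 < r) (i : Fin n) :
    ∃ k : ℕ, k ≤ 6 ∧ ∃ a b : Fin k → ℝ, (∀ j, a j < b j ∧ b j ≤ a j + 2 * Real.pi) ∧
      (symmDiff (attachingSet α x i r) (⋃ j, openArc r (a j) (b j))).Finite := by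
  have hr0 := pos_of_norm_add_one_lt hn hr
  have hfin := finite_nonattaching hn hα hP hr
  -- If no point leads only elsewhere, the full circle minus one point is the required arc.
  -- Otherwise the circle is cut open at a point leading only elsewhere.
  by_cases hall : ∀ p : Plane, ‖p‖ = r → ∀ j, AttachesTo α x j p → AttachesTo α x i p
  · refine ⟨1, by norm_num, fun _ => 0, fun _ => 2 * Real.pi,
      fun _ => ⟨Real.two_pi_pos, by rw [zero_add]⟩,
      (hfin.union (finite_singleton (circlePoint r 0))).subset ?_⟩
    rintro p (⟨⟨hp, -⟩, hno⟩ | ⟨harc, hno⟩)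
    · right
      obtain ⟨θ, hθ, rfl⟩ := exists_circlePoint_eq hp 0
      rw [zero_add] at hθ
      rcases hθ.1.eq_or_lt with h0 | h0
      · rw [← h0]
        rfl
      · exact (hno (mem_iUnion.2 ⟨0, θ, ⟨h0, hθ.2⟩, rfl⟩)).elim
    · left
      obtain ⟨-, θ, -, rfl⟩ := mem_iUnion.1 harc
      have hN := norm_circlePoint hr0.le θ
      exact ⟨hN, fun j hj => hno ⟨hN, hall _ hN j hj⟩⟩
  · push Not at hall
    obtain ⟨p₀, hp₀, j₀, hj₀, hi₀⟩ := hall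
    obtain ⟨θ₀, -, rfl⟩ := exists_circlePoint_eq hp₀ 0
    set A : Set ℝ := {θ | θ ∈ Ioo θ₀ (θ₀ + 2 * Real.pi) ∧ AttachesTo α x i (circlePoint r θ)}
      with hA
    set B : Set ℝ := {θ | (∃ j, AttachesTo α x j (circlePoint r θ)) ∧
      ¬ AttachesTo α x i (circlePoint r θ)} with hB
    have hθ₀ : θ₀ + 2 * Real.pi ∈ B := by
      show (∃ j, AttachesTo α x j (circlePoint r (θ₀ + 2 * Real.pi))) ∧ _
      rw [circlePoint_add_two_pi]
      exact ⟨⟨j₀, hj₀⟩, hi₀⟩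
    obtain ⟨k, hk, c, d, hcd, hdis, hcov⟩ := exists_intervals_of_alternation (A := A) (B := B)
      (u := θ₀) (v := θ₀ + 2 * Real.pi) (fun θ hθ => Ioo_subset_Icc_self hθ.1)
      (disjoint_left.2 fun θ h1 h2 => h2.2 h1.2) 6 fun a ha haA halt =>
        not_seven_alternations hn hα h hr (fun θ hθ => hθ) hθ₀ ha (fun l => (haA l).1)
          (fun l => (haA l).2) halt
    refine ⟨k, hk, c, d, fun j => ⟨(hcd j).1, by linarith [(hcd j).2.1, (hcd j).2.2]⟩,
      (hfin.union (hcov.image (circlePoint r))).subset ?_⟩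
    rintro p (⟨⟨hp, hpi⟩, hno⟩ | ⟨harc, hno⟩)
    · right
      obtain ⟨θ, hθ, rfl⟩ := exists_circlePoint_eq hp θ₀
      have hne : θ₀ ≠ θ := fun heq => hi₀ (heq ▸ hpi)
      refine ⟨θ, ⟨⟨⟨hθ.1.lt_of_ne hne, hθ.2⟩, hpi⟩, fun hmem => hno ?_⟩, rfl⟩
      obtain ⟨j, hj⟩ := mem_iUnion.1 hmem
      exact mem_iUnion.2 ⟨j, θ, hj, rfl⟩
    · left
      obtain ⟨j, θ, hθ, rfl⟩ := mem_iUnion.1 harc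
      have hN := norm_circlePoint hr0.le θ
      refine ⟨hN, fun l hl => ?_⟩
      -- The arcs avoid B, so a point of an arc that does not lead to x_i leads nowhere; there are
      -- finitely many such points.
      exact disjoint_left.1 (hdis j) hθ ⟨⟨l, hl⟩, fun hi => hno ⟨hN, hi⟩⟩

end Intervals

end GFA

end

theorem theorem1 (n : ℕ) (hn : 1 ≤ n) (α : ℝ) (hα : 0 ≤ α)
    (x : Fin n → GFA.Plane) (hx : Function.Injective x) (hP : GFA.PropertyP α x) :
    (∀ᶠ r : ℝ in Filter.atTop, ∀ i, MeasurableSet (GFA.attachingAngles α x i r)) ∧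
    (∃ p : Fin n → ℝ,
      (∀ i, Filter.Tendsto (fun r : ℝ => GFA.attachProb α x i r) Filter.atTop (nhds (p i))) ∧
      ∑ i, p i = 1) ∧
    (GFA.IsCluster x → (∀ i, ‖x i‖ ≤ n) → ∀ i, ∀ r : ℝ, 10 * (n : ℝ) ≤ r →
      ∃ k : ℕ, k ≤ 6 ∧ ∃ a b : Fin k → ℝ,
        (∀ j, a j < b j ∧ b j ≤ a j + 2 * Real.pi) ∧
        (symmDiff (GFA.attachingSet α x i r) (⋃ j, GFA.openArc r (a j) (b j))).Finite) := by
  have hlarge : ∀ᶠ r : ℝ in Filter.atTop, ∀ i, ‖x i‖ + 1 < r :=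
    Filter.eventually_all.2 fun i => Filter.eventually_gt_atTop _
  refine ⟨?_, ?_, ?_⟩
  · exact hlarge.mono fun r hr i => GFA.measurableSet_attachingAngles hn hα hr i
  · choose p hp using fun i => GFA.tendsto_attachProb (x := x) hn hα i
    refine ⟨p, hp, tendsto_nhds_unique (tendsto_finsetSum _ fun i _ => hp i) ?_⟩
    refine tendsto_const_nhds.congr' (hlarge.mono fun r hr => ?_)
    exact (GFA.sum_attachProb hn hα hx hP hr).symm
  · intro hc hb i r hr
    have hn' : (1 : ℝ) ≤ n := by exact_mod_cast hn
    -- The bound 10n is generous: ‖x i‖ + 1 ≤ n + 1 < 10n ≤ r.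
    exact GFA.exists_arcs hn hα hP hc (fun i => by linarith [hb i]) i
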